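/- **Setting.** Let $(\mathcal X,\Sigma)$ be a measurable space, $\mathcal Y=\{+1,-1\}$, and $D$ a probability measure on $\mathcal X\times\mathcal Y$ with marginal $D_{\mathcal X}$ and conditional probability $\eta(x)=\mathbb P(y=+1\mid x)$. Let $h^\star=\operatorname{sgn}(2\eta-1)$ and $\operatorname{err}(h)=\mathbb P_{(x,y)\sim D}(h(x)\ne y)$. Let $\mathcal F$ be a class of measurable functions $\mathcal X\to[0,1]$ with some $f^\star\in\mathcal F$ satisfying $f^\star=\eta$ ($D_{\mathcal X}$-a.e.). Its pseudo dimension (the VC dimension of $\{(x,\zeta)\mapsto \mathbb 1(f(x)>\zeta):f\in\mathcal F\}$) is at most an integer $d\ge1$. For $\gamma_0,\epsilon_0>0$ put $$\theta_{f}(\mathcal F,\gamma_0,\epsilon_0)=\max\Big\{1,\ \sup_{\mu}\sup_{\gamma>\gamma_0,\,\epsilon>\epsilon_0}\tfrac{\gamma^2}{\epsilon^2}\,\mu\big(x:\exists g\in\mathcal F,\ |g(x)-f(x)|>\gamma,\ \|g-f\|_{L^2(\mu)}\le\epsilon\big)\Big\},$$ the supremum being over all probability measures $\mu$ on $\mathcal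 X$. A regression oracle returns, for every finite list $S$ of labelled examples, some $\hat f_S\in\mathcal F$ minimizing over $\mathcal F$ the loss $R_S(f)=\sum_{(x,y)\in S}(f(x)-\mathbb 1(y=+1))^2$. Regularity assumed: $\mathcal F$ is pointwise separable (it has a countable subclass of which every $f\in\mathcal F$ is a pointwise sequential limit), and for every $n$ and $r\ge0$ the maps $(S,x)\mapsto\inf f(x)$ and $(S,x)\mapsto\sup f(x)$ over $\{f\in\mathcal F:R_S(f)\le R_S(\hat f_S)+r\}$ are measurable on $(\mathcal X\times\mathcal Y)^n\times\mathcal X$. **Algorithm** (inputs $\gamma\in(0,1/2)$, $T$, $C_\delta$). Let $M=\lceil\log_2T\rceil$, $\tau_0'=0$, $\tau_m'=2^m$ for $m\ge1$, and $\beta_m=(M-m+1)C_\delta$. In epoch $m=1,\dots,M$, let $S_m$ be the list of examples whose labels were queried so far, $\hat f_m=\hat f_{S_m}$, $\mathcal F_m=\{f\in\mathcal F:R_{S_m}(f)\le R_{S_m}(\hat f_m)+\beta_m\}$, $\mathrm{lcb}_m(x)=\inf_{f\in\mathcal F_m}f(x)$ and $\mathrm{ucb}_m(x)=\sup_{f\in\mathcal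 F_m}f(x)$. Define $\hat h_m(x)=\bot$ if $[\mathrm{lcb}_m(x),\mathrm{ucb}_m(x)]\subseteq[\frac12-\gamma,\frac12+\gamma]$, and $\hat h_m(x)=\operatorname{sgn}(2\hat f_m(x)-1)$ otherwise, where the tie $\hat f_m(x)=\frac12$ is resolved to $+1$ if $\mathrm{ucb}_m(x)>\frac12$ and to $-1$ if not. If $m=M$, return $\hat h_M$. Otherwise, for $t=\tau_{m-1}'+1,\dots,\tau_m'$, observe $x_t$ and query its label $y_t$ if and only if $\frac12\in(\mathrm{lcb}_m(x_t),\mathrm{ucb}_m(x_t))$ and $\hat h_m(x_t)\neq\bot$. Here $(x_1,y_1),(x_2,y_2),\dots$ are i.i.d. with law $D$. The randomized classifier $\check h$ agrees with $\hat h_M$ where $\hat h_M\ne\bot$ and predicts $\pm1$ with equal probability (a fresh fair coin) where $\hat h_M=\bot$; its error $\operatorname{err}(\check h)$ averages over the coin. **Theorem.** There are universal constants $K_1,K_2,K_3>0$ such that the following holds in every such setting, for all $\epsilon\in(0,1]$ and $\delta\in(0,1)$. Let $\gamma$ be as chosen below, let $\theta$ be any finite upper bound for $\sup_{f\in\mathcal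 F,\,\iota>0}\theta_f(\mathcal F,\gamma/2,\iota)$, and run the algorithm with $$T=K_1\frac{\theta d}{\epsilon\gamma}\log\frac{\theta d}{\epsilon\gamma\delta},\qquad C_\delta=K_2\,d\,\log\frac T\delta .$$ 1. (*Noise-seeking Massart noise.*) Suppose $0\le\zeta_0<\tau_0\le\frac12$ and $\mathbb P_{x\sim D_{\mathcal X}}(\zeta_0<|\eta(x)-\frac12|\le\tau_0)=0$. With $\gamma=\min\{\tau_0,\frac14\}$, with probability at least $1-2\delta$, one has $\operatorname{err}(\check h)-\operatorname{err}(h^\star)\le\epsilon+\zeta_0$ and the number of queried labels is at most $$K_3\,\theta d\;\tau_0^{-2}\,\log^2\!\Big(\frac{\theta d}{\epsilon\tau_0}\Big)\log\!\Big(\frac{\theta d}{\epsilon\tau_0\delta}\Big)=\tilde O(\tau_0^{-2}).$$ 2. (*Noise-seeking Tsybakov noise.*) Suppose $0\le\zeta_0<\frac12$, $\beta\ge0$, $c>0$ and $\mathbb P_{x\sim D_{\mathcal X}}(\zeta_0<|\eta(x)-\frac12|\le\tau)\le c\,\tau^\beta$ for all $\tau>\zeta_0$. With $\gamma=\min\{(\epsilon/(2c))^{1/(1+\beta)},\frac14\}$,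 with probability at least $1-2\delta$, one has $\operatorname{err}(\check h)-\operatorname{err}(h^\star)\le\epsilon+\zeta_0$ and the number of queried labels is at most $$K_3\,\theta d\,\max\{1,c\}^{\frac2{1+\beta}}\,\epsilon^{-\frac2{1+\beta}}\,\log^2\!\Big(\frac{2\theta d\max\{1,c\}}{\epsilon}\Big)\log\!\Big(\frac{2\theta d\max\{1,c\}}{\epsilon\delta}\Big)=\tilde O\big(\epsilon^{-2/(1+\beta)}\big).$$ (Probability at least $1-2\delta$ means that the outer probability of the complementary event is at most $2\delta$.) -/

import Mathlib

open MeasureTheory ProbabilityTheory Filter Topology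

/-! Binary labels are Booleans: `true` stands for `+1` and `false` for `-1`. In the square loss the
label is coded as `1` / `0`, so that its conditional mean is the conditional probability of `+1`.
A classifier with an abstention option is a map `X → Option Bool`, with `none` for abstention. -/

namespace ActiveLearning

noncomputable section

variable {X : Type*}

/-! ### Complexity of a class of regression functions -/

/-- The thresholded class `{(x, ζ) ↦ 𝟙(f x > ζ) : f ∈ F}` shatters the finite set `s`. -/
def PseudoShatters (F : Set (X → ℝ)) (s : Finset (X × ℝ)) : Prop :=
  ∀ t ⊆ s, ∃ f ∈ F, ∀ p ∈ s, (p.2 < f p.1 ↔ p ∈ t)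

/-- Pseudo dimension: the VC dimension of the class of threshold functions. -/
def pdim (F : Set (X → ℝ)) : ℕ∞ :=
  ⨆ (s : Finset (X × ℝ)) (_ : PseudoShatters F s), (s.card : ℕ∞)

/-- Value function disagreement coefficient of `F` at `fs`: the maximum of `1` and the supremum of
`(γ² / ε²) · μ {x | ∃ f ∈ F, |f x - fs x| > γ, ‖f - fs‖_{L²(μ)} ≤ ε}` over all probability
measures `μ` and all `γ > γ₀`, `ε > ε₀`. -/
def disagreementCoeff [MeasurableSpace X] (F : Set (X → ℝ)) (fs : X → ℝ) (γ₀ ε₀ : ℝ) : ENNReal :=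
  (⨆ (μ : Measure X) (_ : IsProbabilityMeasure μ) (γ : ℝ) (_ : γ₀ < γ) (ε : ℝ) (_ : ε₀ < ε),
    ENNReal.ofReal (γ ^ 2 / ε ^ 2) *
      μ {x | ∃ f ∈ F, γ < |f x - fs x| ∧ √(∫ u, (f u - fs u) ^ 2 ∂μ) ≤ ε}) ⊔ 1

/-- `sup` of the disagreement coefficient over `fs ∈ F` and over all scales `ι > 0`. -/
def supDisagreementCoeff [MeasurableSpace X] (F : Set (X → ℝ)) (γ₀ : ℝ) : ENNReal :=
  ⨆ (fs : X → ℝ) (_ : fs ∈ F) (ι : ℝ) (_ : 0 < ι), disagreementCoeff F fs γ₀ ι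

/-- Pointwise separability: some countable subclass is sequentially dense in `F` for pointwise
convergence. -/
def PointwiseSeparable (F : Set (X → ℝ)) : Prop :=
  ∃ F₀ ⊆ F, F₀.Countable ∧ ∀ f ∈ F, ∃ u : ℕ → X → ℝ, (∀ n, u n ∈ F₀) ∧
    ∀ x, Tendsto (fun n => u n x) atTop (𝓝 (f x))

/-! ### Regression oracle and confidence bounds -/

/-- Square loss of `f` on a list of labelled examples. -/
def sqLoss (f : X → ℝ) (S : List (X × Bool)) : ℝ :=
  (S.map fun p => (f p.1 - (if p.2 then 1 else 0)) ^ 2).sum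

/-- `oracle` returns, for any finite data set, a minimizer over `F` of the square loss. -/
def IsRegressionOracle (F : Set (X → ℝ)) (oracle : List (X × Bool) → X → ℝ) : Prop :=
  ∀ S, oracle S ∈ F ∧ ∀ f ∈ F, sqLoss (oracle S) S ≤ sqLoss f S

/-- Regression functions whose loss exceeds the minimal one by at most `r`. -/
def activeSet (F : Set (X → ℝ)) (oracle : List (X × Bool) → X → ℝ) (r : ℝ)
    (S : List (X × Bool)) : Set (X → ℝ) :=
  {f ∈ F | sqLoss f S ≤ sqLoss (oracle S) S + r}

/-- Lower confidence bound `inf_{f ∈ G} f x`. -/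
def lcb (G : Set (X → ℝ)) (x : X) : ℝ := sInf ((fun f : X → ℝ => f x) '' G)

/-- Upper confidence bound `sup_{f ∈ G} f x`. -/
def ucb (G : Set (X → ℝ)) (x : X) : ℝ := sSup ((fun f : X → ℝ => f x) '' G)

/-- The confidence bounds are jointly measurable in the labelled data and the query point. -/
def MeasurableConfidenceBounds [MeasurableSpace X] (F : Set (X → ℝ))
    (oracle : List (X × Bool) → X → ℝ) : Prop :=
  ∀ (n : ℕ) (r : ℝ), 0 ≤ r →
    Measurable (fun p : (Fin n → X × Bool) × X =>
      lcb (activeSet F oracle r (List.ofFn p.1)) p.2) ∧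
    Measurable (fun p : (Fin n → X × Bool) × X =>
      ucb (activeSet F oracle r (List.ofFn p.1)) p.2)

/-! ### The active learning algorithm -/

/-- Last time step of epoch `m`: `τ_0 = 0` and `τ_m = 2 ^ m` for `m ≥ 1`. -/
def epochEnd (m : ℕ) : ℕ := if m = 0 then 0 else 2 ^ m

/-- Number of epochs `M = ⌈log₂ T⌉`. -/
def numEpochs (T : ℝ) : ℕ := ⌈Real.logb 2 T⌉₊

/-- The active set `F_m` of epoch `m`, built from the labelled data `S` gathered before that epoch,
with radius `β_m = (M - m + 1) C`. -/
def epochActiveSet (F : Set (X → ℝ)) (oracle : List (X × Bool) → X → ℝ) (T C : ℝ) (m : ℕ)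
    (S : List (X × Bool)) : Set (X → ℝ) :=
  activeSet F oracle (((numEpochs T : ℝ) - m + 1) * C) S

open Classical in
/-- The classifier of epoch `m`: abstain if `[lcb x, ucb x] ⊆ [1/2 - γ, 1/2 + γ]`, otherwise predict
the sign of `2 f̂_m x - 1`, where the tie `f̂_m x = 1/2` is resolved to `+1` iff `ucb x > 1/2`. -/
def epochClassifier (F : Set (X → ℝ)) (oracle : List (X × Bool) → X → ℝ) (γ T C : ℝ) (m : ℕ)
    (S : List (X × Bool)) (x : X) : Option Bool :=
  let G := epochActiveSet F oracle T C m S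
  if Set.Icc (lcb G x) (ucb G x) ⊆ Set.Icc (1 / 2 - γ) (1 / 2 + γ) then none
  else some (decide (1 / 2 < oracle S x ∨ (oracle S x = 1 / 2 ∧ 1 / 2 < ucb G x)))

/-- The query rule of epoch `m`: `1/2 ∈ (lcb x, ucb x)` and the classifier does not abstain. -/
def epochQuery (F : Set (X → ℝ)) (oracle : List (X × Bool) → X → ℝ) (γ T C : ℝ) (m : ℕ)
    (S : List (X × Bool)) (x : X) : Prop :=
  1 / 2 ∈ Set.Ioo (lcb (epochActiveSet F oracle T C m S) x)
      (ucb (epochActiveSet F oracle T C m S) x) ∧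
    epochClassifier F oracle γ T C m S x ≠ none

open Classical in
/-- Labelled data gathered in epochs `1, …, k` along the stream `z 1, z 2, …` of examples: the
label of an example is revealed, and the example stored, only if the query rule asks for it. -/
def queriedData (F : Set (X → ℝ)) (oracle : List (X × Bool) → X → ℝ) (γ T C : ℝ)
    (z : ℕ → X × Bool) : ℕ → List (X × Bool)
  | 0 => []
  | k + 1 =>
    let S := queriedData F oracle γ T C z k
    S ++ ((List.range' (epochEnd k + 1) (epochEnd (k + 1) - epochEnd k)).map z).filter
      (fun p => decide (epochQuery F oracle γ T C (k + 1) S p.1))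

/-- The classifier returned by the algorithm, that of the last epoch `M`. -/
def output (F : Set (X → ℝ)) (oracle : List (X × Bool) → X → ℝ) (γ T C : ℝ)
    (z : ℕ → X × Bool) : X → Option Bool :=
  epochClassifier F oracle γ T C (numEpochs T)
    (queriedData F oracle γ T C z (numEpochs T - 1))

/-- The number of labels queried by the algorithm: it samples in epochs `1, …, M - 1`. -/
def labelCount (F : Set (X → ℝ)) (oracle : List (X × Bool) → X → ℝ) (γ T C : ℝ)
    (z : ℕ → X × Bool) : ℕ :=
  (queriedData F oracle γ T C z (numEpochs T - 1)).length

/-- `T = K · (θ d / (ε γ)) · log (θ d / (ε γ δ))`. -/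
def horizon (K θ : ℝ) (d : ℕ) (ε γ δ : ℝ) : ℝ :=
  K * (θ * d / (ε * γ)) * Real.log (θ * d / (ε * γ * δ))

/-- `C_δ = K · d · log (T / δ)`. -/
def confRadius (K : ℝ) (d : ℕ) (T δ : ℝ) : ℝ := K * d * Real.log (T / δ)

/-! ### Errors and noise conditions -/

variable [MeasurableSpace X]

/-- Conditional probability of the label `+1`. -/
def condProb (D : Measure (X × Bool)) [IsFiniteMeasure D] (x : X) : ℝ :=
  (D.condKernel x).real {true}

open Classical in
/-- The Bayes classifier. -/
def bayes (D : Measure (X × Bool)) [IsFiniteMeasure D] (x : X) : Bool :=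
  decide (1 / 2 ≤ condProb D x)

/-- Error of a deterministic classifier. -/
def err (D : Measure (X × Bool)) (h : X → Bool) : ℝ := D.real {p | h p.1 ≠ p.2}

/-- The law of a fair coin. -/
def fairCoin : Measure Bool := (PMF.uniformOfFintype Bool).toMeasure

/-- Randomization over the abstention region: predict the outcome `b` of a coin where `h` abstains. -/
def randomize (h : X → Option Bool) (b : Bool) (x : X) : Bool := (h x).getD b

/-- Standard excess error of the randomized version of `h`; its error is the probability of a
mistake under a fresh example and an independent fair coin. -/
def randExcessErr (D : Measure (X × Bool)) [IsFiniteMeasure D] (h : X → Option Bool) : ℝ :=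
  (D.prod fairCoin).real {p | randomize h p.2 p.1.1 ≠ p.1.2} - err D (bayes D)

/-- Noise-seeking Massart condition. -/
def NoiseSeekingMassart (D : Measure (X × Bool)) [IsFiniteMeasure D] (ζ₀ τ₀ : ℝ) : Prop :=
  0 ≤ ζ₀ ∧ ζ₀ < τ₀ ∧ τ₀ ≤ 1 / 2 ∧
    D.fst {x | ζ₀ < |condProb D x - 1 / 2| ∧ |condProb D x - 1 / 2| ≤ τ₀} = 0

/-- Noise-seeking Tsybakov condition. -/
def NoiseSeekingTsybakov (D : Measure (X × Bool)) [IsFiniteMeasure D] (ζ₀ β c : ℝ) : Prop :=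
  0 ≤ ζ₀ ∧ ζ₀ < 1 / 2 ∧ 0 ≤ β ∧ 0 < c ∧ ∀ τ, ζ₀ < τ →
    D.fst.real {x | ζ₀ < |condProb D x - 1 / 2| ∧ |condProb D x - 1 / 2| ≤ τ} ≤ c * τ ^ β

end

end ActiveLearning

/-! Let `h` be the member of `F` equal to the conditional probability of `+1`. Whether a label is
queried depends only on past data and on the covariate. Hence, given the past, the queried excess
square loss of `f` over `h` has mean equal to the squared distance of `f` and `h` weighted by the
query indicator (`integral_excessLoss`), and second moment at most four times that. An exponential
supermartingale then shows that the excess loss queried in any window of time is at least half the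
accumulated weighted distance, up to a logarithmic term (`lintegral_exp_excessLoss_le_one`,
`measure_le_sum_le`).

To make this uniform over `F`, a union bound needs a finite net fixed in advance, since the
adaptively queried losses cannot be symmetrized. The covariates are i.i.d., however, and
symmetrizing them alone suffices: `exists_ghost_sample` yields a deterministic sample, and the few
patterns of the class on it (Sauer–Shelah) give a net which with high probability is close to the
class both on the data and in the mean (`exists_net`). The outcome is `measure_not_uniform_le`.

On the event `UniformlyConcentrated` the rest is deterministic. The function `h` stays in every
active set, and the active sets are nested because the radius drops by `C` per epoch, which pays for
the deviations; so the query regions decrease. An active function in epoch `k + 1` is therefore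
within squared distance of order `(M - k) C / 2 ^ k` of `h` on the current region. Every point of
that region sees an active function more than `γ / 2` away from `h`, so conditioning the marginal
law on the region and using the disagreement coefficient bounds its probability by a multiple of `θ
(M - k) C / (γ² 2 ^ k)`.

Error: abstaining costs the margin, and the margin is then at most `γ`, which the noise condition
controls; all other mistakes lie in the last query region and cost order `θ C / (γ T)`. Labels:
epoch `k + 1` has `2 ^ k` examples for `k ≥ 1`, so it queries about `θ (M - k) C / γ²` labels. Only
the last epochs, about `log (θ d / (ε γ))` of them, are counted in this way; all earlier time steps
together are negligible (`measure_not_guarantee_le`). -/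

namespace ActiveLearning

variable {X : Type*}

/-! ### Traces of a class of bounded pseudo dimension -/

/-- `f x` and `g x` lie on the same side of each of the thresholds `0, 1/n, …, (n-1)/n`. -/
def Agree (n : ℕ) (f g : X → ℝ) (x : X) : Prop :=
  ∀ j < n, ((j : ℝ) / n < f x ↔ (j : ℝ) / n < g x)

lemma Agree.symm {n : ℕ} {f g : X → ℝ} {x : X} (h : Agree n f g x) : Agree n g f x :=
  fun j hj => (h j hj).symm

lemma Agree.trans {n : ℕ} {f g h : X → ℝ} {x : X} (h₁ : Agree n f g x) (h₂ : Agree n g h x) :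
    Agree n f h x :=
  fun j hj => (h₁ j hj).trans (h₂ j hj)

/-- A larger gap would leave room for the threshold `⌈n * g x⌉ / n` between the two values; it is an
admissible threshold because `n * g x + 1 < n * f x ≤ n`. -/
lemma Agree.sub_le {n : ℕ} (hn : 0 < n) {f g : X → ℝ} {x : X} (h : Agree n f g x)
    (hf : f x ≤ 1) (hg : 0 ≤ g x) : f x - g x ≤ 1 / n := by
  by_contra! hlt
  have hn' : (0 : ℝ) < n := by exact_mod_cast hn
  have h1 : (⌈n * g x⌉₊ : ℝ) < n * g x + 1 := Nat.ceil_lt_add_one (by positivity)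
  have h2 : n * g x ≤ (⌈n * g x⌉₊ : ℝ) := Nat.le_ceil _
  have h3 : n * g x + 1 < n * f x := by
    rw [div_lt_iff₀ hn'] at hlt
    nlinarith
  have h4 : ⌈n * g x⌉₊ < n := by
    have : (⌈n * g x⌉₊ : ℝ) < n := by nlinarith
    exact_mod_cast this
  have h5 := (h _ h4).1 (by rw [div_lt_iff₀ hn']; linarith)
  rw [div_lt_iff₀ hn'] at h5
  linarith

lemma Agree.abs_sub_le {n : ℕ} (hn : 0 < n) {f g : X → ℝ} {x : X} (h : Agree n f g x)
    (hf : f x ∈ Set.Icc (0 : ℝ) 1) (hg : g x ∈ Set.Icc (0 : ℝ) 1) : |f x - g x| ≤ 1 / n :=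
  abs_sub_le_iff.2 ⟨h.sub_le hn hf.2 hg.1, h.symm.sub_le hn hg.2 hf.1⟩

lemma sum_range_choose_le (n d : ℕ) : ∑ k ∈ Finset.range (d + 1), n.choose k ≤ (n + 1) ^ d := by
  induction d with
  | zero => simp
  | succ d ih =>
    rw [Finset.sum_range_succ]
    have h1 : n.choose (d + 1) ≤ n * (n + 1) ^ d :=
      (Nat.choose_le_pow n (d + 1)).trans (by
        rw [pow_succ']
        exact Nat.mul_le_mul_left _ (Nat.pow_le_pow_left (Nat.le_succ n) d))
    calc _ ≤ (n + 1) ^ d + n * (n + 1) ^ d := add_le_add ih h1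
      _ = (n + 1) ^ (d + 1) := by ring

open Classical in
/-- Subsets of `s` cut out by the thresholded class. -/
noncomputable def traces (F : Set (X → ℝ)) (s : Finset (X × ℝ)) : Finset (Finset (X × ℝ)) :=
  s.powerset.filter fun t => ∃ f ∈ F, ∀ p ∈ s, (p.2 < f p.1 ↔ p ∈ t)

/-- Pajor's form of Sauer–Shelah: a family has at most as many members as it shatters sets, and a
set shattered by the traces is pseudo-shattered by `F`, so it has at most `d` points. -/
lemma card_traces_le {F : Set (X → ℝ)} {d : ℕ} (hF : pdim F ≤ d) (s : Finset (X × ℝ)) :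
    (traces F s).card ≤ (s.card + 1) ^ d := by
  classical
  refine ((traces F s).card_le_card_shatterer.trans ?_).trans (sum_range_choose_le s.card d)
  have hsub : (traces F s).shatterer ⊆
      (Finset.range (d + 1)).biUnion fun k => s.powersetCard k := by
    intro t ht
    rw [Finset.mem_shatterer] at ht
    have hts : t ⊆ s := by
      obtain ⟨u, hu, htu⟩ := ht.exists_superset
      exact htu.trans (Finset.mem_powerset.1 (Finset.mem_filter.1 hu).1)
    have hsh : PseudoShatters F t := by
      intro r hr
      obtain ⟨u, hu, hur⟩ := ht hr
      obtain ⟨f, hf, hfu⟩ := (Finset.mem_filter.1 hu).2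
      refine ⟨f, hf, fun p hp => ?_⟩
      rw [hfu p (hts hp), ← hur, Finset.mem_inter]
      exact ⟨fun h => ⟨hp, h⟩, fun h => h.2⟩
    have hcard : (t.card : ℕ∞) ≤ d :=
      (le_iSup₂ (f := fun (s : Finset (X × ℝ)) (_ : PseudoShatters F s) => (s.card : ℕ∞))
        t hsh).trans hF
    have hcard' : t.card ≤ d := by exact_mod_cast hcard
    exact Finset.mem_biUnion.2 ⟨t.card, by simpa using Nat.lt_succ_of_le hcard',
      Finset.mem_powersetCard.2 ⟨hts, rfl⟩⟩
  refine (Finset.card_le_card hsub).trans (Finset.card_biUnion_le.trans ?_)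
  simp

/-- A class of bounded pseudo dimension has few discretized patterns on finitely many points. -/
lemma exists_finset_agree {F : Set (X → ℝ)} {d : ℕ} (hF : pdim F ≤ d) (s : Finset X) (n : ℕ) :
    ∃ H : Finset (X → ℝ), ↑H ⊆ F ∧ H.card ≤ (s.card * n + 1) ^ d ∧
      ∀ f ∈ F, ∃ g ∈ H, ∀ x ∈ s, Agree n f g x := by
  classical
  -- One trace on this grid records the side of every threshold at every point of `s`, so functions
  -- with equal traces agree on `s`.
  set S : Finset (X × ℝ) := s ×ˢ (Finset.range n).image (fun j : ℕ => (j : ℝ) / n) with hS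
  have hmem : ∀ t ∈ traces F S, ∃ f ∈ F, ∀ p ∈ S, (p.2 < f p.1 ↔ p ∈ t) :=
    fun t ht => (Finset.mem_filter.1 ht).2
  choose! r hrF hr using hmem
  refine ⟨(traces F S).image r, ?_, ?_, ?_⟩
  · intro f hf
    obtain ⟨t, ht, rfl⟩ := Finset.mem_image.1 (Finset.mem_coe.1 hf)
    exact hrF t ht
  · refine Finset.card_image_le.trans ((card_traces_le hF S).trans ?_)
    refine Nat.pow_le_pow_left (Nat.succ_le_succ ?_) d
    rw [hS, Finset.card_product]
    exact Nat.mul_le_mul_left _ (Finset.card_image_le.trans (by simp))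
  · intro f hf
    set t := S.filter (fun p => p.2 < f p.1) with ht
    have htr : t ∈ traces F S := by
      refine Finset.mem_filter.2 ⟨Finset.mem_powerset.2 (Finset.filter_subset _ _), f, hf, ?_⟩
      intro p hp
      simp [ht, hp]
    refine ⟨r t, Finset.mem_image_of_mem _ htr, fun x hx j hj => ?_⟩
    have hp : (x, (j : ℝ) / n) ∈ S :=
      Finset.mk_mem_product hx (Finset.mem_image_of_mem _ (Finset.mem_range.2 hj))
    rw [hr t htr _ hp]
    simp [ht, hp]

/-! ### Symmetrization -/

/-- Exchange the two components of `v i` for the indices selected by `σ`. -/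
def swapAt {ι : Type*} (σ : ι → Bool) (v : ι → X × X) (i : ι) : X × X :=
  if σ i then (v i).swap else v i

open Classical in
/-- Two members of `F` agree on all second components of `v` and disagree on at least `k` first
components. -/
def BadPair {ι : Type*} [Fintype ι] (F : Set (X → ℝ)) (n k : ℕ) (v : ι → X × X) : Prop :=
  ∃ f ∈ F, ∃ g ∈ F, (∀ i, Agree n f g (v i).2) ∧
    k ≤ (Finset.univ.filter fun i => ¬ Agree n f g (v i).1).card

-- At an index where the pair disagrees on either component, agreement of the swapped second
-- component forces the value of `σ`. A nonempty event has at least `k` such indices, so at most a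
-- fraction `2 ^ (-k)` of the swaps survives.
open Classical in
lemma card_swap_pair_le {ι : Type*} [Fintype ι] (f g : X → ℝ) (n k : ℕ) (v : ι → X × X) :
    (Finset.univ.filter fun σ : ι → Bool => (∀ i, Agree n f g (swapAt σ v i).2) ∧
      k ≤ (Finset.univ.filter fun i => ¬ Agree n f g (swapAt σ v i).1).card).card * 2 ^ k
      ≤ 2 ^ Fintype.card ι := by
  set B := Finset.univ.filter fun σ : ι → Bool => (∀ i, Agree n f g (swapAt σ v i).2) ∧
      k ≤ (Finset.univ.filter fun i => ¬ Agree n f g (swapAt σ v i).1).card with hB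
  set E := Finset.univ.filter fun i => ¬ Agree n f g (v i).1 ∨ ¬ Agree n f g (v i).2 with hE
  rcases B.eq_empty_or_nonempty with h0 | ⟨σ₀, hσ₀⟩
  · simp [h0]
  have hkE : k ≤ E.card := by
    refine (Finset.mem_filter.1 hσ₀).2.2.trans (Finset.card_le_card fun i hi => ?_)
    have hi' := (Finset.mem_filter.1 hi).2
    refine Finset.mem_filter.2 ⟨Finset.mem_univ _, ?_⟩
    unfold swapAt at hi'
    split_ifs at hi' with h
    · exact Or.inr hi'
    · exact Or.inl hi'
  have hsub : B ⊆ Fintype.piFinset fun i =>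
      if i ∈ E then {decide (¬ Agree n f g (v i).2)} else Finset.univ := by
    intro σ hσ
    have hσ' := (Finset.mem_filter.1 hσ).2.1
    refine Fintype.mem_piFinset.2 fun i => ?_
    split_ifs with hi
    · have h1 := hσ' i
      have h2 := (Finset.mem_filter.1 hi).2
      unfold swapAt at h1
      rw [Finset.mem_singleton]
      cases hσi : σ i <;> simp_all
    · exact Finset.mem_univ _
  have hcard := Finset.card_le_card hsub
  rw [Fintype.card_piFinset] at hcard
  have hprod : ∏ i, (if i ∈ E then ({decide (¬ Agree n f g (v i).2)} : Finset Bool)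
      else Finset.univ).card = 2 ^ (Fintype.card ι - E.card) := by
    have : ∀ i, (if i ∈ E then ({decide (¬ Agree n f g (v i).2)} : Finset Bool)
      else Finset.univ).card = if i ∈ E then 1 else 2 := by
      intro i; split_ifs <;> simp
    simp_rw [this]
    rw [Finset.prod_ite]
    simp only [Finset.prod_const_one, one_mul, Finset.prod_const]
    congr 1
    rw [Finset.filter_not, Finset.filter_mem_eq_inter, Finset.univ_inter, Finset.card_sdiff]
    simp
  rw [hprod] at hcard
  calc B.card * 2 ^ k ≤ 2 ^ (Fintype.card ι - E.card) * 2 ^ E.card :=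
        Nat.mul_le_mul hcard (Nat.pow_le_pow_right (by norm_num) hkE)
    _ = 2 ^ Fintype.card ι := by
        rw [← pow_add, Nat.sub_add_cancel (Finset.card_le_univ E)]

-- Union bound over pairs. The points occurring in `v` are the same for every swap, so a single net
-- on them serves all `σ`, and replacing `f`, `g` by representatives changes no agreement. The
-- exponent `2 * d` counts pairs of representatives.
open Classical in
lemma card_swap_le {ι : Type*} [Fintype ι] {F : Set (X → ℝ)} {d : ℕ} (hF : pdim F ≤ d)
    (n k : ℕ) (v : ι → X × X) :
    (Finset.univ.filter fun σ : ι → Bool => BadPair F n k (swapAt σ v)).card * 2 ^ k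
      ≤ (2 * Fintype.card ι * n + 1) ^ (2 * d) * 2 ^ Fintype.card ι := by
  set s : Finset X := Finset.univ.image (fun i => (v i).1) ∪ Finset.univ.image (fun i => (v i).2)
    with hs
  have hscard : s.card ≤ 2 * Fintype.card ι := by
    refine (Finset.card_union_le _ _).trans ?_
    have h1 := Finset.card_image_le (s := (Finset.univ : Finset ι)) (f := fun i => (v i).1)
    have h2 := Finset.card_image_le (s := (Finset.univ : Finset ι)) (f := fun i => (v i).2)
    rw [Finset.card_univ] at h1 h2
    omega
  obtain ⟨H, -, hHc, hH⟩ := exists_finset_agree hF s n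
  have h1s : ∀ i, (v i).1 ∈ s := fun i => by simp [hs]
  have h2s : ∀ i, (v i).2 ∈ s := fun i => by simp [hs]
  have hsw : ∀ σ i, (swapAt σ v i).1 ∈ s ∧ (swapAt σ v i).2 ∈ s := by
    intro σ i
    unfold swapAt
    split_ifs
    · exact ⟨h2s i, h1s i⟩
    · exact ⟨h1s i, h2s i⟩
  have hsub : (Finset.univ.filter fun σ : ι → Bool => BadPair F n k (swapAt σ v)) ⊆
      (H ×ˢ H).biUnion fun p => Finset.univ.filter fun σ : ι → Bool =>
        (∀ i, Agree n p.1 p.2 (swapAt σ v i).2) ∧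
        k ≤ (Finset.univ.filter fun i => ¬ Agree n p.1 p.2 (swapAt σ v i).1).card := by
    intro σ hσ
    obtain ⟨f, hf, g, hg, h1, h2⟩ := (Finset.mem_filter.1 hσ).2
    obtain ⟨f', hf', hff⟩ := hH f hf
    obtain ⟨g', hg', hgg⟩ := hH g hg
    refine Finset.mem_biUnion.2 ⟨(f', g'), Finset.mk_mem_product hf' hg',
      Finset.mem_filter.2 ⟨Finset.mem_univ _, fun i => ?_, h2.trans (Finset.card_le_card ?_)⟩⟩
    · exact ((hff _ (hsw σ i).2).symm.trans (h1 i)).trans (hgg _ (hsw σ i).2)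
    · intro i hi
      refine Finset.mem_filter.2 ⟨Finset.mem_univ _, fun h => (Finset.mem_filter.1 hi).2 ?_⟩
      exact ((hff _ (hsw σ i).1).trans h).trans (hgg _ (hsw σ i).1).symm
  calc _ ≤ (∑ p ∈ H ×ˢ H, (Finset.univ.filter fun σ : ι → Bool =>
        (∀ i, Agree n p.1 p.2 (swapAt σ v i).2) ∧
        k ≤ (Finset.univ.filter fun i => ¬ Agree n p.1 p.2 (swapAt σ v i).1).card).card) * 2 ^ k :=
        Nat.mul_le_mul_right _ ((Finset.card_le_card hsub).trans Finset.card_biUnion_le)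
    _ ≤ ∑ p ∈ H ×ˢ H, 2 ^ Fintype.card ι := by
        rw [Finset.sum_mul]
        exact Finset.sum_le_sum fun p _ => card_swap_pair_le p.1 p.2 n k v
    _ = (H.card * H.card) * 2 ^ Fintype.card ι := by
        rw [Finset.sum_const, Finset.card_product, smul_eq_mul]
    _ ≤ _ := by
        refine Nat.mul_le_mul_right _ ?_
        have : H.card ≤ (2 * Fintype.card ι * n + 1) ^ d :=
          hHc.trans (Nat.pow_le_pow_left (Nat.succ_le_succ (Nat.mul_le_mul_right _ hscard)) d)
        calc H.card * H.card ≤ _ := Nat.mul_le_mul this this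
          _ = _ := by rw [← pow_add, two_mul d]

variable [MeasurableSpace X]

lemma measurableSet_agree (n : ℕ) {f g : X → ℝ} (hf : Measurable f) (hg : Measurable g) :
    MeasurableSet {x | Agree n f g x} := by
  have : {x | Agree n f g x} = ⋂ j ∈ Finset.range n,
      {x | (j : ℝ) / n < f x ↔ (j : ℝ) / n < g x} := by
    ext x; simp [Agree]
  rw [this]
  refine Finset.measurableSet_biInter _ fun j _ => ?_
  exact (measurableSet_lt measurable_const hf).iff (measurableSet_lt measurable_const hg)

lemma measurable_card_filter {ι Ω : Type*} [Fintype ι] [MeasurableSpace Ω] (p : ι → Ω → Prop)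
    [∀ ω, DecidablePred fun i => p i ω] (hp : ∀ i, MeasurableSet {ω | p i ω}) :
    Measurable fun ω => (Finset.univ.filter fun i => p i ω).card := by
  classical
  simp_rw [Finset.card_filter]
  refine Finset.measurable_sum _ fun i _ => ?_
  exact Measurable.ite (hp i) measurable_const measurable_const

lemma measurableSet_badPair {ι : Type*} [Fintype ι] {F : Set (X → ℝ)} (hc : F.Countable)
    (hm : ∀ f ∈ F, Measurable f) (n k : ℕ) :
    MeasurableSet {v : ι → X × X | BadPair F n k v} := by
  classical
  have : {v : ι → X × X | BadPair F n k v} = ⋃ f ∈ F, ⋃ g ∈ F,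
      ((⋂ i, {v | Agree n f g (v i).2}) ∩
        {v | k ≤ (Finset.univ.filter fun i => ¬ Agree n f g (v i).1).card}) := by
    ext v; simp only [BadPair, Set.mem_ofPred_eq, Set.mem_iUnion, Set.mem_inter_iff, Set.mem_iInter,
      exists_prop]
  rw [this]
  refine MeasurableSet.biUnion hc fun f hf => MeasurableSet.biUnion hc fun g hg => ?_
  have hfg := measurableSet_agree n (hm f hf) (hm g hg)
  refine MeasurableSet.inter (MeasurableSet.iInter fun i => ?_) ?_
  · exact (measurable_snd.comp (measurable_pi_apply i)) hfg
  · refine measurableSet_le measurable_const (measurable_card_filter _ fun i => ?_)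
    exact (measurable_fst.comp (measurable_pi_apply i)) hfg.compl

lemma measurePreserving_swapAt {ι : Type*} [Fintype ι] (μ : Measure X) [IsProbabilityMeasure μ]
    (σ : ι → Bool) : MeasurePreserving (swapAt (X := X) σ)
      (Measure.pi fun _ => μ.prod μ) (Measure.pi fun _ => μ.prod μ) := by
  have h := measurePreserving_pi (fun _ : ι => μ.prod μ) (fun _ : ι => μ.prod μ)
    (f := fun i p => if σ i then p.swap else p) fun i => by
      cases hσ : σ i
      · simpa using! MeasurePreserving.id _
      · simpa using Measure.measurePreserving_swap
  exact h

/-- Symmetrization bound for the probability that two members of the class agree on a ghost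
sample but disagree on many points of the sample. -/
lemma measure_badPair_le {ι : Type*} [Fintype ι] {F : Set (X → ℝ)} (hc : F.Countable)
    (hm : ∀ f ∈ F, Measurable f) {d : ℕ} (hF : pdim F ≤ d) (n k : ℕ)
    (μ : Measure X) [IsProbabilityMeasure μ] :
    (Measure.pi fun _ : ι => μ.prod μ) {v | BadPair F n k v} ≤
      (((2 * Fintype.card ι * n + 1) ^ (2 * d) : ℕ) : ENNReal) / 2 ^ k := by
  classical
  set ν := Measure.pi fun _ : ι => μ.prod μ
  set B := {v : ι → X × X | BadPair F n k v}
  have hB : MeasurableSet B := measurableSet_badPair hc hm n k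
  -- Swaps preserve the product law, so the probability of `B` is its average over all swaps; for
  -- each fixed `v` that average is the count bounded in `card_swap_le`.
  have h1 : ∑ σ : ι → Bool, ν (swapAt σ ⁻¹' B) = 2 ^ Fintype.card ι * ν B := by
    have h0 : ∀ σ : ι → Bool, ν (swapAt σ ⁻¹' B) = ν B := fun σ =>
      (measurePreserving_swapAt μ σ).measure_preimage hB.nullMeasurableSet
    simp [h0]
  have h2 : ∑ σ : ι → Bool, ν (swapAt σ ⁻¹' B) =
      ∫⁻ v, ((Finset.univ.filter fun σ : ι → Bool => BadPair F n k (swapAt σ v)).card : ENNReal)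
        ∂ν := by
    have h3 : ∀ σ : ι → Bool, ν (swapAt σ ⁻¹' B) =
        ∫⁻ v, (if BadPair F n k (swapAt σ v) then 1 else 0 : ENNReal) ∂ν := by
      intro σ
      rw [← lintegral_indicator_one ((measurePreserving_swapAt μ σ).measurable hB)]
      refine lintegral_congr fun v => ?_
      simp [Set.indicator, B]
    simp_rw [h3]
    rw [← lintegral_finsetSum _ fun σ _ => ?_]
    · exact lintegral_congr fun v => by rw [Finset.sum_boole]
    · exact Measurable.ite ((measurePreserving_swapAt μ σ).measurable hB) measurable_const
        measurable_const
  have h4 : ∀ v : ι → X × X,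
      ((Finset.univ.filter fun σ : ι → Bool => BadPair F n k (swapAt σ v)).card : ENNReal) ≤
      2 ^ Fintype.card ι * ((((2 * Fintype.card ι * n + 1) ^ (2 * d) : ℕ) : ENNReal) / 2 ^ k) := by
    intro v
    rw [← mul_div_assoc, ENNReal.le_div_iff_mul_le (by simp) (by simp), mul_comm (2 ^ _)]
    exact_mod_cast card_swap_le hF n k v
  have h5 : 2 ^ Fintype.card ι * ν B ≤
      2 ^ Fintype.card ι * ((((2 * Fintype.card ι * n + 1) ^ (2 * d) : ℕ) : ENNReal) / 2 ^ k) := by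
    rw [← h1, h2]
    refine (lintegral_mono h4).trans ?_
    simp [ν]
  exact (ENNReal.mul_le_mul_iff_right (by simp) (by simp)).1 h5

open Classical in
/-- There is a ghost sample such that, with high probability, members of the class that agree on
it disagree on few points of an independent sample. -/
lemma exists_ghost_sample {ι : Type*} [Fintype ι] {F : Set (X → ℝ)} (hc : F.Countable)
    (hm : ∀ f ∈ F, Measurable f) {d : ℕ} (hF : pdim F ≤ d) (n k : ℕ)
    (μ : Measure X) [IsProbabilityMeasure μ] :
    ∃ y : ι → X, (Measure.pi fun _ : ι => μ) {x | ∃ f ∈ F, ∃ g ∈ F, (∀ i, Agree n f g (y i)) ∧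
        k ≤ (Finset.univ.filter fun i => ¬ Agree n f g (x i)).card} ≤
      (((2 * Fintype.card ι * n + 1) ^ (2 * d) : ℕ) : ENNReal) / 2 ^ k := by
  have hB : MeasurableSet {v : ι → X × X | BadPair F n k v} := measurableSet_badPair hc hm n k
  have hmp := measurePreserving_arrowProdEquivProdArrow X X ι (fun _ => μ) (fun _ => μ)
  have hmp' := MeasurePreserving.symm _ hmp
  have h1 := hmp'.measure_preimage hB.nullMeasurableSet
  rw [Measure.prod_apply_symm (hmp'.measurable hB)] at h1
  have h2 := measure_badPair_le (ι := ι) hc hm hF n k μ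
  rw [← h1] at h2
  -- By Fubini the bound is an average over the ghost sample, so some fixed ghost sample does at
  -- least as well as the average.
  by_contra! hcon
  obtain ⟨y, hy⟩ := exists_le_lintegral (μ := Measure.pi fun _ : ι => μ)
    (f := fun y => (Measure.pi fun _ : ι => μ) ((fun x => (x, y)) ⁻¹'
      ((MeasurableEquiv.arrowProdEquivProdArrow X X ι).symm ⁻¹'
        {v : ι → X × X | BadPair F n k v})))
    (measurable_measure_prodMk_right (hmp'.measurable hB)).aemeasurable
  exact absurd (hy.trans h2) (not_le.2 (hcon y))

end ActiveLearning

namespace ActiveLearning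

/-! ### Exponential supermartingales along an independent stream -/

section Stream

variable {α Ω : Type*}

/-- A function of the stream that at time `t` only looks at the entries before `t`. -/
def Predictable {β : Type*} (W : ℕ → (ℕ → α) → β) : Prop :=
  ∀ t z z', (∀ i < t, z i = z' i) → W t z = W t z'

/-- The past of a stream before time `t`, continued by a constant. -/
def past (a₀ : α) (t : ℕ) (z : ℕ → α) (i : ℕ) : α := if i < t then z i else a₀

lemma Predictable.past_eq {β : Type*} {W : ℕ → (ℕ → α) → β} (hW : Predictable W) (a₀ : α) {t n : ℕ}
    (h : t ≤ n) (z : ℕ → α) : W t (past a₀ n z) = W t z :=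
  hW t _ _ fun i hi => by simp [past, hi.trans_le h]

variable [MeasurableSpace α] [MeasurableSpace Ω]

lemma measurable_past (a₀ : α) (t : ℕ) : Measurable (past a₀ t) := by
  refine measurable_pi_lambda _ fun i => ?_
  unfold past
  split_ifs
  · exact measurable_pi_apply i
  · exact measurable_const

variable {P : Measure Ω} {Z : ℕ → Ω → α}

/-- The truncated stream is a function of the entries before `t`. Filling with a constant keeps it
in the space of full streams, so a predictable rule can be evaluated on it without changing its
value. -/
lemma indepFun_past (hZ : ∀ t, Measurable (Z t)) (hi : iIndepFun Z P) (a₀ : α) (t : ℕ) :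
    IndepFun (fun ω => past a₀ t (fun i => Z i ω)) (Z t) P := by
  have h := hi.indepFun_finset (Finset.range t) {t} (by simp) hZ
  let φ : (Finset.range t → α) → ℕ → α := fun u i =>
    if hi : i < t then u ⟨i, Finset.mem_range.2 hi⟩ else a₀
  have hφ : Measurable φ := by
    refine measurable_pi_lambda _ fun i => ?_
    simp only [φ]
    split_ifs
    · exact measurable_pi_apply _
    · exact measurable_const
  let ψ : (({t} : Finset ℕ) → α) → α := fun u => u ⟨t, Finset.mem_singleton_self t⟩
  have h2 := h.comp hφ (measurable_pi_apply _ : Measurable ψ)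
  have e1 : (fun ω => past a₀ t (fun i => Z i ω)) = φ ∘ fun ω (i : Finset.range t) => Z i ω := by
    funext ω i
    simp [past, φ]
  rw [e1]
  exact h2

variable [IsProbabilityMeasure P] {D : Measure α} [IsProbabilityMeasure D]

/-- Supermartingale property without filtrations: the last example is independent of the truncated
past, so it can be integrated out first, at the cost of a factor at most one. -/
lemma lintegral_exp_sum_le_one (hZ : ∀ t, Measurable (Z t)) (hi : iIndepFun Z P)
    (hD : ∀ t, P.map (Z t) = D) {W : ℕ → (ℕ → α) → α → ℝ}
    (hm : ∀ t, Measurable (Function.uncurry (W t))) (hp : Predictable W)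
    (hW : ∀ t z, ∫⁻ a, ENNReal.ofReal (Real.exp (W t z a)) ∂D ≤ 1) (n : ℕ) :
    ∫⁻ ω, ENNReal.ofReal (Real.exp (∑ t ∈ Finset.range n, W t (fun i => Z i ω) (Z t ω))) ∂P
      ≤ 1 := by
  induction n with
  | zero => simp
  | succ n ih =>
    obtain ⟨ω₀⟩ : Nonempty Ω := nonempty_of_isProbabilityMeasure P
    set a₀ := Z 0 ω₀
    have hZm : Measurable fun ω => fun i => Z i ω := measurable_pi_lambda _ hZ
    set U : Ω → ℕ → α := fun ω => past a₀ n (fun i => Z i ω) with hU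
    have hUm : Measurable U := (measurable_past a₀ n).comp hZm
    let G : (ℕ → α) → ENNReal := fun z =>
      ENNReal.ofReal (Real.exp (∑ t ∈ Finset.range n, W t z (z t)))
    have hG : Measurable G := by
      refine (Real.measurable_exp.comp (Finset.measurable_sum _ fun t _ => ?_)).ennreal_ofReal
      exact (hm t).comp (measurable_id.prodMk (measurable_pi_apply t))
    let K : (ℕ → α) × α → ENNReal := fun p => ENNReal.ofReal (Real.exp (W n p.1 p.2))
    have hK : Measurable K := (Real.measurable_exp.comp (hm n)).ennreal_ofReal
    have hGU : ∀ ω, G (U ω) = ENNReal.ofReal (Real.exp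
        (∑ t ∈ Finset.range n, W t (fun i => Z i ω) (Z t ω))) := by
      intro ω
      simp only [G, hU]
      congr 2
      refine Finset.sum_congr rfl fun t ht => ?_
      have ht' := Finset.mem_range.1 ht
      rw [hp.past_eq a₀ ht'.le]
      simp [past, ht']
    have h1 : ∀ ω, ENNReal.ofReal (Real.exp
        (∑ t ∈ Finset.range (n + 1), W t (fun i => Z i ω) (Z t ω))) =
        (fun p : (ℕ → α) × α => G p.1 * K p) (U ω, Z n ω) := by
      intro ω
      simp only [hGU]
      rw [Finset.sum_range_succ, Real.exp_add, ENNReal.ofReal_mul (Real.exp_pos _).le]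
      simp only [K, hU, hp.past_eq a₀ le_rfl]
    simp_rw [h1]
    have hprod := (indepFun_iff_map_prod_eq_prod_map_map hUm.aemeasurable (hZ n).aemeasurable).1
      (indepFun_past hZ hi a₀ n)
    rw [hD n] at hprod
    have hGK : Measurable fun p : (ℕ → α) × α => G p.1 * K p :=
      (hG.comp measurable_fst).mul hK
    rw [← lintegral_map hGK (hUm.prodMk (hZ n)), hprod, lintegral_prod _ hGK.aemeasurable]
    calc _ ≤ ∫⁻ z, G z ∂(P.map U) := by
          refine lintegral_mono fun z => ?_
          simp only
          rw [lintegral_const_mul (G z) (f := fun y => K (z, y)) (hK.comp measurable_prodMk_left)]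
          exact mul_le_of_le_one_right' (hW n z)
      _ = ∫⁻ ω, G (U ω) ∂P := lintegral_map hG hUm
      _ ≤ 1 := by simp_rw [hGU]; exact ih

/-- Markov's inequality for the exponential of the sum. Increments outside `I` are set to zero,
which keeps the moment bound since `exp 0 = 1`. -/
lemma measure_le_sum_le (hZ : ∀ t, Measurable (Z t)) (hi : iIndepFun Z P)
    (hD : ∀ t, P.map (Z t) = D) {W : ℕ → (ℕ → α) → α → ℝ}
    (hm : ∀ t, Measurable (Function.uncurry (W t))) (hp : Predictable W)
    (hW : ∀ t z, ∫⁻ a, ENNReal.ofReal (Real.exp (W t z a)) ∂D ≤ 1) (I : Finset ℕ) (u : ℝ) :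
    P {ω | u ≤ ∑ t ∈ I, W t (fun i => Z i ω) (Z t ω)} ≤ ENNReal.ofReal (Real.exp (-u)) := by
  obtain ⟨n, hn⟩ : ∃ n, I ⊆ Finset.range n := I.exists_nat_subset_range
  let W' : ℕ → (ℕ → α) → α → ℝ := fun t z a => if t ∈ I then W t z a else 0
  have hm' : ∀ t, Measurable (Function.uncurry (W' t)) := by
    intro t
    by_cases ht : t ∈ I
    · simpa [W', ht, Function.uncurry_def] using hm t
    · simp [W', ht, Function.uncurry_def]
  have hp' : Predictable W' := by
    intro t z z' h
    simp only [W', hp t z z' h]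
  have h := lintegral_exp_sum_le_one hZ hi hD hm' hp' (fun t z => by
    by_cases ht : t ∈ I
    · simpa [W', ht] using hW t z
    · simp [W', ht]) n
  have hsum : ∀ ω, ∑ t ∈ Finset.range n, W' t (fun i => Z i ω) (Z t ω) =
      ∑ t ∈ I, W t (fun i => Z i ω) (Z t ω) := by
    intro ω
    simp only [W']
    rw [← Finset.sum_filter, Finset.filter_mem_eq_inter, Finset.inter_eq_right.2 hn]
  simp_rw [hsum] at h
  have hmeas : Measurable fun ω => ENNReal.ofReal (Real.exp
      (∑ t ∈ I, W t (fun i => Z i ω) (Z t ω))) := by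
    refine (Real.measurable_exp.comp (Finset.measurable_sum _ fun t _ => ?_)).ennreal_ofReal
    exact (hm t).comp ((measurable_pi_lambda _ hZ).prodMk (hZ t))
  have h2 := mul_meas_ge_le_lintegral (μ := P) hmeas (ENNReal.ofReal (Real.exp u))
  have h3 : ENNReal.ofReal (Real.exp u) *
      P {ω | u ≤ ∑ t ∈ I, W t (fun i => Z i ω) (Z t ω)} ≤ 1 := by
    refine (le_trans ?_ h2).trans h
    gcongr with ω
    intro hω
    exact ENNReal.ofReal_le_ofReal (Real.exp_le_exp.2 hω)
  rw [Real.exp_neg, ENNReal.ofReal_inv_of_pos (Real.exp_pos u), ← one_div]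
  exact (ENNReal.le_div_iff_mul_le (Or.inl (by simp [Real.exp_pos])) (Or.inl (by simp))).2
    (by rwa [mul_comm])

/-- The sum of the values of a predictable `[0,1]`-valued rule is controlled by the sum of its
conditional means. -/
lemma measure_sum_indicator_le (hZ : ∀ t, Measurable (Z t)) (hi : iIndepFun Z P)
    (hD : ∀ t, P.map (Z t) = D) {q : ℕ → (ℕ → α) → α → ℝ}
    (hm : ∀ t, Measurable (Function.uncurry (q t))) (hp : Predictable q)
    (hq : ∀ t z a, q t z a ∈ Set.Icc (0 : ℝ) 1) (I : Finset ℕ) (u : ℝ) :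
    P {ω | u ≤ ∑ t ∈ I, (q t (fun i => Z i ω) (Z t ω) - 2 * ∫ a, q t (fun i => Z i ω) a ∂D)} ≤
      ENNReal.ofReal (Real.exp (-u)) := by
  refine measure_le_sum_le (W := fun t z a => q t z a - 2 * ∫ a, q t z a ∂D) hZ hi hD ?_ ?_ ?_ I u
  · intro t
    have h1 : Measurable fun z => ∫ a, q t z a ∂D :=
      ((hm t).stronglyMeasurable.integral_prod_right).measurable
    exact (hm t).sub ((h1.const_mul 2).comp measurable_fst)
  · intro t z z' h
    simp only [hp t z z' h]
  · intro t z
    have hqm : Measurable (q t z) := (hm t).comp measurable_prodMk_left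
    have hint : Integrable (q t z) D :=
      Integrable.of_bound hqm.aestronglyMeasurable 1 (ae_of_all _ fun a => by
        rw [Real.norm_eq_abs, abs_of_nonneg (hq t z a).1]; exact (hq t z a).2)
    have hpos : 0 ≤ ∫ a, q t z a ∂D := integral_nonneg fun a => (hq t z a).1
    set p := ∫ a, q t z a ∂D with hpdef
    -- On `[0, 1]` one has `exp q ≤ 1 + q + q² ≤ 1 + 2 q`; the moment is then at most `(1 + 2 p) exp
    -- (-2 p) ≤ 1`. This is the source of the factor 2 before the conditional means.
    have h1 : ∀ a, Real.exp (q t z a - 2 * p) ≤ (1 + 2 * q t z a) * Real.exp (-(2 * p)) := by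
      intro a
      rw [sub_eq_add_neg, Real.exp_add]
      refine mul_le_mul_of_nonneg_right ?_ (Real.exp_pos _).le
      have := Real.abs_exp_sub_one_sub_id_le (x := q t z a)
        (by rw [abs_of_nonneg (hq t z a).1]; exact (hq t z a).2)
      have h2 := (abs_le.1 this).2
      nlinarith [(hq t z a).1, (hq t z a).2]
    have hint2 : Integrable (fun a => (1 + 2 * q t z a) * Real.exp (-(2 * p))) D :=
      ((integrable_const _).add (hint.const_mul 2)).mul_const _
    calc _ ≤ ∫⁻ a, ENNReal.ofReal ((1 + 2 * q t z a) * Real.exp (-(2 * p))) ∂D :=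
          lintegral_mono fun a => ENNReal.ofReal_le_ofReal (h1 a)
      _ = ENNReal.ofReal (∫ a, (1 + 2 * q t z a) * Real.exp (-(2 * p)) ∂D) :=
          (ofReal_integral_eq_lintegral_ofReal hint2 (ae_of_all _ fun a =>
            mul_nonneg (by linarith [(hq t z a).1]) (Real.exp_pos _).le)).symm
      _ = ENNReal.ofReal ((1 + 2 * p) * Real.exp (-(2 * p))) := by
          rw [integral_mul_const, integral_add (integrable_const _) (hint.const_mul 2),
            integral_const_mul]
          simp [hpdef]
      _ ≤ 1 := by
          rw [← ENNReal.ofReal_one]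
          refine ENNReal.ofReal_le_ofReal ?_
          rw [Real.exp_neg, ← div_eq_mul_inv, div_le_one (Real.exp_pos _)]
          linarith [Real.add_one_le_exp (2 * p)]

end Stream

end ActiveLearning

namespace ActiveLearning

/-! ### Excess square loss of one example -/

section Loss

variable {X : Type*}

/-- Numerical code `1` / `0` of a label. -/
def labelValue (b : Bool) : ℝ := if b then 1 else 0

lemma labelValue_mem (b : Bool) : labelValue b ∈ Set.Icc (0 : ℝ) 1 := by
  cases b <;> simp [labelValue]

/-- Excess of the square loss of `f` over that of `g` on one labelled example. -/
def excessLoss (f g : X → ℝ) (p : X × Bool) : ℝ :=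
  (f p.1 - labelValue p.2) ^ 2 - (g p.1 - labelValue p.2) ^ 2

lemma abs_excessLoss_sub_le {f g h : X → ℝ} {p : X × Bool} (hf : f p.1 ∈ Set.Icc (0 : ℝ) 1)
    (hg : g p.1 ∈ Set.Icc (0 : ℝ) 1) :
    |excessLoss f h p - excessLoss g h p| ≤ 2 * |f p.1 - g p.1| := by
  have h1 : excessLoss f h p - excessLoss g h p =
      (f p.1 - g p.1) * (f p.1 + g p.1 - 2 * labelValue p.2) := by
    simp only [excessLoss]; ring
  have hl := labelValue_mem p.2
  rw [h1, abs_mul, mul_comm]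
  refine mul_le_mul_of_nonneg_right ?_ (abs_nonneg _)
  rw [abs_le]
  constructor <;> linarith [hf.1, hf.2, hg.1, hg.2, hl.1, hl.2]

lemma abs_excessLoss_le {f h : X → ℝ} {p : X × Bool} (hf : f p.1 ∈ Set.Icc (0 : ℝ) 1)
    (hh : h p.1 ∈ Set.Icc (0 : ℝ) 1) : |excessLoss f h p| ≤ 2 * |f p.1 - h p.1| := by
  have h1 := abs_excessLoss_sub_le (h := h) hf hh
  have h2 : excessLoss h h p = 0 := by simp [excessLoss]
  rwa [h2, sub_zero] at h1

lemma abs_excessLoss_le_one {f h : X → ℝ} {p : X × Bool} (hf : f p.1 ∈ Set.Icc (0 : ℝ) 1)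
    (hh : h p.1 ∈ Set.Icc (0 : ℝ) 1) : |excessLoss f h p| ≤ 1 := by
  have hl := labelValue_mem p.2
  simp only [excessLoss]
  have h1 : (f p.1 - labelValue p.2) ^ 2 ≤ 1 := by
    rw [sq_le_one_iff_abs_le_one, abs_le]
    constructor <;> linarith [hf.1, hf.2, hl.1, hl.2]
  have h2 : (h p.1 - labelValue p.2) ^ 2 ≤ 1 := by
    rw [sq_le_one_iff_abs_le_one, abs_le]
    constructor <;> linarith [hh.1, hh.2, hl.1, hl.2]
  rw [abs_le]
  constructor <;> nlinarith [sq_nonneg (f p.1 - labelValue p.2), sq_nonneg (h p.1 - labelValue p.2)]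

variable [MeasurableSpace X]

lemma measurable_labelValue : Measurable labelValue := measurable_of_countable _

lemma measurable_excessLoss {f g : X → ℝ} (hf : Measurable f) (hg : Measurable g) :
    Measurable (excessLoss f g) := by
  have hl : Measurable fun p : X × Bool => labelValue p.2 :=
    measurable_labelValue.comp measurable_snd
  exact (((hf.comp measurable_fst).sub hl).pow_const 2).sub
    (((hg.comp measurable_fst).sub hl).pow_const 2)

lemma integrable_of_abs_le {μ : Measure X} [IsFiniteMeasure μ] {φ : X → ℝ} (hφ : Measurable φ)
    {c : ℝ} (hc : ∀ x, |φ x| ≤ c) : Integrable φ μ :=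
  Integrable.of_bound hφ.aestronglyMeasurable c (ae_of_all _ hc)

variable {D : Measure (X × Bool)}

lemma integral_fst {φ : X → ℝ} (hφ : Measurable φ) :
    ∫ p, φ p.1 ∂D = ∫ x, φ x ∂D.fst :=
  (integral_map measurable_fst.aemeasurable hφ.aestronglyMeasurable).symm

/-- Weighted squared `L²` distance under the marginal law of the covariate. -/
noncomputable def wdist (D : Measure (X × Bool)) (w f g : X → ℝ) : ℝ :=
  ∫ x, w x * (f x - g x) ^ 2 ∂D.fst

lemma wdist_nonneg {w f g : X → ℝ} (hw : ∀ x, w x ∈ Set.Icc (0 : ℝ) 1) : 0 ≤ wdist D w f g :=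
  integral_nonneg fun x => mul_nonneg (hw x).1 (sq_nonneg _)

lemma abs_mul_sq_le_one {w a b : ℝ} (hw : w ∈ Set.Icc (0 : ℝ) 1) (ha : a ∈ Set.Icc (0 : ℝ) 1)
    (hb : b ∈ Set.Icc (0 : ℝ) 1) : |w * (a - b) ^ 2| ≤ 1 := by
  rw [abs_of_nonneg (mul_nonneg hw.1 (sq_nonneg _))]
  refine mul_le_one₀ hw.2 (sq_nonneg _) ?_
  rw [sq_le_one_iff_abs_le_one, abs_le]
  constructor <;> linarith [ha.1, ha.2, hb.1, hb.2]

variable [IsProbabilityMeasure D]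

lemma integral_mul_labelValue {φ : X → ℝ} (hφ : Measurable φ) {c : ℝ} (hc : ∀ x, |φ x| ≤ c) :
    ∫ p, φ p.1 * labelValue p.2 ∂D = ∫ x, φ x * condProb D x ∂D.fst := by
  have hint : Integrable (fun p : X × Bool => φ p.1 * labelValue p.2) D := by
    refine integrable_of_abs_le ((hφ.comp measurable_fst).mul
      (measurable_labelValue.comp measurable_snd)) (c := c) fun p => ?_
    have hl := labelValue_mem p.2
    rw [abs_mul, abs_of_nonneg hl.1]
    exact (mul_le_of_le_one_right (abs_nonneg _) hl.2).trans (hc p.1)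
  rw [← Measure.integral_condKernel hint]
  refine integral_congr_ae (ae_of_all _ fun x => ?_)
  simp only [integral_const_mul]
  congr 1
  have : labelValue = Set.indicator {true} 1 := by
    funext b; cases b <;> simp [labelValue]
  rw [this, integral_indicator_one (measurableSet_singleton _)]
  rfl

lemma measurable_condProb : Measurable (condProb D) :=
  (D.condKernel.measurable_coe (measurableSet_singleton true)).ennreal_toReal

lemma condProb_mem (x : X) : condProb D x ∈ Set.Icc (0 : ℝ) 1 :=
  ⟨measureReal_nonneg, measureReal_le_one⟩

lemma abs_wdist_sub_le {w f g h : X → ℝ} (hwm : Measurable w) (hw : ∀ x, w x ∈ Set.Icc (0 : ℝ) 1)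
    (hfm : Measurable f) (hf : ∀ x, f x ∈ Set.Icc (0 : ℝ) 1)
    (hgm : Measurable g) (hg : ∀ x, g x ∈ Set.Icc (0 : ℝ) 1)
    (hhm : Measurable h) (hh : ∀ x, h x ∈ Set.Icc (0 : ℝ) 1) :
    |wdist D w f h - wdist D w g h| ≤ 2 * ∫ x, |f x - g x| ∂D.fst := by
  unfold wdist
  rw [← integral_sub, ← integral_const_mul]
  · refine (abs_integral_le_integral_abs).trans ?_
    refine integral_mono_of_nonneg (ae_of_all _ fun _ => abs_nonneg _)
      ((integrable_of_abs_le (c := 1) ((hfm.sub hgm).abs) fun x => ?_).const_mul 2)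
      (ae_of_all _ fun x => ?_)
    · rw [abs_abs, Pi.sub_apply, abs_le]
      constructor <;> linarith [(hf x).1, (hf x).2, (hg x).1, (hg x).2]
    · have h1 : w x * (f x - h x) ^ 2 - w x * (g x - h x) ^ 2 =
          (w x * (f x + g x - 2 * h x)) * (f x - g x) := by ring
      simp only
      rw [h1, abs_mul]
      refine mul_le_mul_of_nonneg_right ?_ (abs_nonneg _)
      rw [abs_mul, abs_of_nonneg (hw x).1]
      have h2 : |f x + g x - 2 * h x| ≤ 2 := by
        rw [abs_le]
        constructor <;> linarith [(hf x).1, (hf x).2, (hg x).1, (hg x).2, (hh x).1, (hh x).2]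
      calc _ ≤ 1 * 2 := mul_le_mul (hw x).2 h2 (abs_nonneg _) zero_le_one
        _ = 2 := by norm_num
  · exact integrable_of_abs_le (hwm.mul ((hfm.sub hhm).pow_const 2))
      fun x => abs_mul_sq_le_one (hw x) (hf x) (hh x)
  · exact integrable_of_abs_le (hwm.mul ((hgm.sub hhm).pow_const 2))
      fun x => abs_mul_sq_le_one (hw x) (hg x) (hh x)

/-- Since `h` is the conditional mean of the label and the weight depends on the covariate only, the
cross term between `f - h` and the label noise integrates to zero. -/
lemma integral_excessLoss {w f h : X → ℝ} (hwm : Measurable w) (hw : ∀ x, w x ∈ Set.Icc (0 : ℝ) 1)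
    (hfm : Measurable f) (hf : ∀ x, f x ∈ Set.Icc (0 : ℝ) 1)
    (hhm : Measurable h) (hh : ∀ x, h x ∈ Set.Icc (0 : ℝ) 1) (heq : h =ᵐ[D.fst] condProb D) :
    ∫ p, w p.1 * excessLoss f h p ∂D = wdist D w f h := by
  have h1 : ∀ p : X × Bool, w p.1 * excessLoss f h p =
      w p.1 * (f p.1 - h p.1) * (f p.1 + h p.1) -
        2 * ((w p.1 * (f p.1 - h p.1)) * labelValue p.2) := by
    intro p; simp only [excessLoss]; ring
  have hd : ∀ x, |f x - h x| ≤ 1 := fun x => by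
    rw [abs_le]; constructor <;> linarith [(hf x).1, (hf x).2, (hh x).1, (hh x).2]
  have hwd : ∀ x, |w x * (f x - h x)| ≤ 1 := fun x => by
    rw [abs_mul, abs_of_nonneg (hw x).1]
    exact mul_le_one₀ (hw x).2 (abs_nonneg _) (hd x)
  have hwdm : Measurable fun x => w x * (f x - h x) := hwm.mul (hfm.sub hhm)
  have hb2 : ∀ x, |w x * (f x - h x) * (f x + h x)| ≤ 2 := fun x => by
    rw [abs_mul]
    have h3 : |f x + h x| ≤ 2 := by
      rw [abs_le]; constructor <;> linarith [(hf x).1, (hf x).2, (hh x).1, (hh x).2]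
    calc _ ≤ 1 * 2 := mul_le_mul (hwd x) h3 (abs_nonneg _) zero_le_one
      _ = 2 := by norm_num
  have hm2 : Measurable fun x => w x * (f x - h x) * (f x + h x) := hwdm.mul (hfm.add hhm)
  have hl : ∀ p : X × Bool, |w p.1 * (f p.1 - h p.1) * labelValue p.2| ≤ 1 := fun p => by
    have hl := labelValue_mem p.2
    rw [abs_mul, abs_of_nonneg hl.1]
    exact (mul_le_of_le_one_right (abs_nonneg _) hl.2).trans (hwd p.1)
  have hlm : Measurable fun p : X × Bool => w p.1 * (f p.1 - h p.1) * labelValue p.2 :=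
    (hwdm.comp measurable_fst).mul (measurable_labelValue.comp measurable_snd)
  have hint1 : Integrable (fun p : X × Bool => w p.1 * (f p.1 - h p.1) * (f p.1 + h p.1)) D :=
    integrable_of_abs_le (hm2.comp measurable_fst) fun p => hb2 p.1
  have hint2 : Integrable (fun p : X × Bool => w p.1 * (f p.1 - h p.1) * labelValue p.2) D :=
    integrable_of_abs_le hlm hl
  simp_rw [h1]
  rw [integral_sub hint1 (hint2.const_mul 2), integral_const_mul,
    integral_mul_labelValue hwdm hwd, integral_fst hm2]
  have h4 : ∫ x, w x * (f x - h x) * condProb D x ∂D.fst =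
      ∫ x, w x * (f x - h x) * h x ∂D.fst := by
    refine integral_congr_ae ?_
    filter_upwards [heq] with x hx
    rw [hx]
  have hb5 : ∀ x, |w x * (f x - h x) * h x| ≤ 1 := fun x => by
    rw [abs_mul, abs_of_nonneg (hh x).1]
    exact (mul_le_of_le_one_right (abs_nonneg _) (hh x).2).trans (hwd x)
  have hi5 : Integrable (fun x => 2 * (w x * (f x - h x) * h x)) D.fst :=
    (integrable_of_abs_le (hwdm.mul hhm) hb5).const_mul 2
  rw [h4, ← integral_const_mul, ← integral_sub (integrable_of_abs_le hm2 hb2) hi5]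
  refine integral_congr_ae (ae_of_all _ fun x => ?_)
  simp only
  ring

/-- Bernstein's argument: the second moment of the weighted excess loss is at most four times its
mean. With `s` one eighth of that loss, `exp (-s) ≤ 1 - s + s²` has mean at most `1 - v / 8 + v / 16
≤ exp (-v / 16)`, where `v` is the weighted squared distance. -/
lemma lintegral_exp_excessLoss_le_one {w f h : X → ℝ} (hwm : Measurable w)
    (hw : ∀ x, w x ∈ Set.Icc (0 : ℝ) 1)
    (hfm : Measurable f) (hf : ∀ x, f x ∈ Set.Icc (0 : ℝ) 1)
    (hhm : Measurable h) (hh : ∀ x, h x ∈ Set.Icc (0 : ℝ) 1) (heq : h =ᵐ[D.fst] condProb D) :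
    ∫⁻ p, ENNReal.ofReal (Real.exp (wdist D w f h / 16 - w p.1 * excessLoss f h p / 8)) ∂D ≤ 1 := by
  set v := wdist D w f h with hv
  set g : X × Bool → ℝ := fun p =>
    1 - w p.1 * excessLoss f h p / 8 + w p.1 * (f p.1 - h p.1) ^ 2 / 16 with hg
  have hpt : ∀ p, Real.exp (v / 16 - w p.1 * excessLoss f h p / 8) ≤ g p * Real.exp (v / 16) := by
    intro p
    have hw1 := hw p.1
    have he1 := abs_excessLoss_le_one (hf p.1) (hh p.1)
    have he2 := abs_excessLoss_le (hf p.1) (hh p.1)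
    have he3 : excessLoss f h p ^ 2 ≤ 4 * (f p.1 - h p.1) ^ 2 := by
      have := mul_self_le_mul_self (abs_nonneg _) he2
      rw [abs_mul_abs_self] at this
      have h2 := sq_abs (f p.1 - h p.1)
      nlinarith
    have hs : |-(w p.1 * excessLoss f h p / 8)| ≤ 1 := by
      rw [abs_neg, abs_div, abs_mul, abs_of_nonneg hw1.1]
      have : w p.1 * |excessLoss f h p| ≤ 1 := mul_le_one₀ hw1.2 (abs_nonneg _) he1
      norm_num
      linarith
    have h1 := (abs_le.1 (Real.abs_exp_sub_one_sub_id_le hs)).2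
    rw [sub_eq_add_neg, Real.exp_add, mul_comm]
    refine mul_le_mul_of_nonneg_right ?_ (Real.exp_pos _).le
    have h2 : (-(w p.1 * excessLoss f h p / 8)) ^ 2 ≤ w p.1 * (f p.1 - h p.1) ^ 2 / 16 := by
      have h3 : w p.1 ^ 2 ≤ w p.1 := by nlinarith [hw1.1, hw1.2]
      have h4 : w p.1 ^ 2 * excessLoss f h p ^ 2 ≤ w p.1 * (4 * (f p.1 - h p.1) ^ 2) :=
        mul_le_mul h3 he3 (sq_nonneg _) hw1.1
      nlinarith
    simp only [hg]
    linarith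
  have hme : Measurable fun p : X × Bool => w p.1 * excessLoss f h p :=
    (hwm.comp measurable_fst).mul (measurable_excessLoss hfm hhm)
  have hbe : ∀ p : X × Bool, |w p.1 * excessLoss f h p| ≤ 1 := fun p => by
    rw [abs_mul, abs_of_nonneg (hw p.1).1]
    exact mul_le_one₀ (hw p.1).2 (abs_nonneg _) (abs_excessLoss_le_one (hf p.1) (hh p.1))
  have hmd : Measurable fun x => w x * (f x - h x) ^ 2 := hwm.mul ((hfm.sub hhm).pow_const 2)
  have hi1 : Integrable (fun p : X × Bool => w p.1 * excessLoss f h p) D :=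
    integrable_of_abs_le hme hbe
  have hi2 : Integrable (fun p : X × Bool => w p.1 * (f p.1 - h p.1) ^ 2) D :=
    integrable_of_abs_le (hmd.comp measurable_fst)
      fun p => abs_mul_sq_le_one (hw p.1) (hf p.1) (hh p.1)
  have hig : Integrable g D := ((integrable_const _).sub (hi1.div_const 8)).add (hi2.div_const 16)
  have hgint : ∫ p, g p ∂D = 1 - v / 16 := by
    simp only [hg]
    have hi3 : Integrable (fun p : X × Bool => 1 - w p.1 * excessLoss f h p / 8) D :=
      (integrable_const _).sub (hi1.div_const 8)
    rw [integral_add hi3 (hi2.div_const 16), integral_sub (integrable_const _) (hi1.div_const 8), integral_div, integral_div,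
      integral_excessLoss hwm hw hfm hf hhm hh heq, integral_fst hmd]
    have : ∫ x, w x * (f x - h x) ^ 2 ∂D.fst = v := rfl
    rw [this, ← hv]
    simp
    ring
  calc _ ≤ ∫⁻ p, ENNReal.ofReal (g p * Real.exp (v / 16)) ∂D :=
        lintegral_mono fun p => ENNReal.ofReal_le_ofReal (hpt p)
    _ = ENNReal.ofReal (∫ p, g p * Real.exp (v / 16) ∂D) :=
        (ofReal_integral_eq_lintegral_ofReal (hig.mul_const _) (ae_of_all _ fun p =>
          (Real.exp_pos _).le.trans (hpt p))).symm
    _ ≤ 1 := by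
        rw [integral_mul_const, hgint, ← ENNReal.ofReal_one]
        refine ENNReal.ofReal_le_ofReal ?_
        have h1 := Real.add_one_le_exp (-(v / 16))
        calc (1 - v / 16) * Real.exp (v / 16) ≤ Real.exp (-(v / 16)) * Real.exp (v / 16) :=
              mul_le_mul_of_nonneg_right (by linarith) (Real.exp_pos _).le
          _ = 1 := by rw [← Real.exp_add]; simp

end Loss

end ActiveLearning

namespace ActiveLearning

/-! ### Uniform concentration of the excess loss -/

section Concentration

variable {X Ω : Type*}

lemma pdim_mono {F G : Set (X → ℝ)} (h : F ⊆ G) : pdim F ≤ pdim G := by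
  refine iSup₂_le fun s hs => ?_
  refine le_iSup₂ (f := fun (s : Finset (X × ℝ)) (_ : PseudoShatters G s) => (s.card : ℕ∞)) s ?_
  intro t ht
  obtain ⟨f, hf, hft⟩ := hs t ht
  exact ⟨f, h hf, hft⟩

open Classical in
lemma abs_sub_le_add_ite {n : ℕ} (hn : 0 < n) {f g : X → ℝ} (x : X)
    (hf : f x ∈ Set.Icc (0 : ℝ) 1) (hg : g x ∈ Set.Icc (0 : ℝ) 1) :
    |f x - g x| ≤ 1 / n + if Agree n f g x then 0 else 1 := by
  split_ifs with h
  · simpa using h.abs_sub_le hn hf hg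
  · have : (0 : ℝ) ≤ 1 / n := by positivity
    have h2 : |f x - g x| ≤ 1 := by
      rw [abs_le]; constructor <;> linarith [hf.1, hf.2, hg.1, hg.2]
    linarith

lemma card_filter_univ_coe (I : Finset ℕ) (p : ℕ → Prop) [DecidablePred p]
    [DecidablePred fun i : I => p i] :
    (Finset.univ.filter fun i : I => p i).card = (I.filter p).card := by
  rw [Finset.card_filter, Finset.card_filter, ← Finset.sum_coe_sort I]
  congr! 2

variable [MeasurableSpace X] [MeasurableSpace Ω] {P : Measure Ω} [IsProbabilityMeasure P]
  {D : Measure (X × Bool)} {Z : ℕ → Ω → X × Bool}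

lemma map_sample (hZ : ∀ t, Measurable (Z t)) (hi : iIndepFun Z P) (hD : ∀ t, P.map (Z t) = D)
    (I : Finset ℕ) :
    P.map (fun ω (i : I) => (Z i ω).1) = Measure.pi fun _ => D.fst := by
  have h1 : iIndepFun (fun i : I => Prod.fst ∘ Z i) P :=
    (hi.precomp Subtype.val_injective).comp (fun _ => Prod.fst) fun _ => measurable_fst
  have h2 := (iIndepFun_iff_map_fun_eq_pi_map
    (fun i : I => (measurable_fst.comp (hZ i)).aemeasurable)).1 h1
  have h3 : ∀ i : I, P.map (Prod.fst ∘ Z i) = D.fst := fun i => by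
    rw [← Measure.map_map measurable_fst (hZ i), hD]
    rfl
  simp_rw [h3] at h2
  exact h2

variable [IsProbabilityMeasure D]

open Classical in
/-- A set that is hit rarely with substantial probability has small measure. -/
lemma card_mul_measureReal_le (hZ : ∀ t, Measurable (Z t)) (hi : iIndepFun Z P)
    (hD : ∀ t, P.map (Z t) = D) {A : Set X} (hA : MeasurableSet A) (I : Finset ℕ) (k : ℕ)
    (h : P {ω | k ≤ (I.filter fun t => (Z t ω).1 ∈ A).card} ≤ ENNReal.ofReal (1 / 2)) :
    I.card * D.fst.real A ≤ 2 * (k + 1) := by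
  set p := D.fst.real A with hp
  have hp0 : 0 ≤ p := measureReal_nonneg
  have hl2 : 0 < Real.log 2 := Real.log_pos (by norm_num)
  have hl2' : Real.log 2 ≤ 1 := by linarith [Real.log_two_lt_d9]
  have hAm : Measurable fun a : X × Bool => A.indicator (1 : X → ℝ) a.1 :=
    (measurable_one.indicator hA).comp measurable_fst
  have hi1 : Integrable (fun a : X × Bool => A.indicator (1 : X → ℝ) a.1) D :=
    integrable_of_abs_le hAm (c := 1) fun a => by by_cases ha : a.1 ∈ A <;> simp [ha]
  have hint : ∫ a : X × Bool, A.indicator (1 : X → ℝ) a.1 ∂D = p := by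
    rw [integral_fst (measurable_one.indicator hA), integral_indicator_one hA]
  -- The exponent `log 2` turns the exponential of minus the indicator into `1 - 1_A / 2`, whose
  -- mean `1 - p / 2` is at most `exp (-p / 2)`.
  have hW : ∀ (t : ℕ) (z : ℕ → X × Bool), ∫⁻ a : X × Bool, ENNReal.ofReal (Real.exp
      (p / 2 - Real.log 2 * A.indicator (1 : X → ℝ) a.1)) ∂D ≤ 1 := by
    intro _ _
    have h1 : ∀ a : X × Bool, Real.exp (p / 2 - Real.log 2 * A.indicator (1 : X → ℝ) a.1) =
        Real.exp (p / 2) * (1 - A.indicator (1 : X → ℝ) a.1 / 2) := by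
      intro a
      rw [sub_eq_add_neg, Real.exp_add]
      congr 1
      by_cases ha : a.1 ∈ A
      · simp [ha, Real.exp_neg, Real.exp_log]
        norm_num
      · simp [ha]
    simp_rw [h1]
    have hi2 : Integrable (fun a : X × Bool => Real.exp (p / 2) *
      (1 - A.indicator (1 : X → ℝ) a.1 / 2)) D :=
      ((integrable_const _).sub (hi1.div_const 2)).const_mul _
    rw [← ofReal_integral_eq_lintegral_ofReal hi2 (ae_of_all _ fun a => by
      exact (Real.exp_pos _).le.trans (h1 a).le), integral_const_mul,
      integral_sub (integrable_const _) (hi1.div_const 2), integral_div, hint,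
      ← ENNReal.ofReal_one]
    refine ENNReal.ofReal_le_ofReal ?_
    have h2 := Real.add_one_le_exp (-(p / 2))
    calc Real.exp (p / 2) * (∫ _ : X × Bool, (1 : ℝ) ∂D - p / 2)
        ≤ Real.exp (p / 2) * Real.exp (-(p / 2)) := by
          refine mul_le_mul_of_nonneg_left ?_ (Real.exp_pos _).le
          simp
          linarith
      _ = 1 := by rw [← Real.exp_add]; simp
  set u := I.card * p / 2 - k * Real.log 2 with hu
  have hch := measure_le_sum_le (P := P) (D := D)
    (W := fun _ _ a => p / 2 - Real.log 2 * A.indicator (1 : X → ℝ) a.1) hZ hi hD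
    (fun t => ((hAm.const_mul (Real.log 2)).const_sub (p / 2)).comp measurable_snd)
    (fun _ _ _ _ => rfl) hW I u
  -- Having at least `k` hits has probability at most one half and the lower deviation at most `exp
  -- (-u)`. As the two events cover everything, `u ≤ log 2`, and this bounds `I.card * p`.
  have hcov : (Set.univ : Set Ω) ⊆ {ω | k ≤ (I.filter fun t => (Z t ω).1 ∈ A).card} ∪
      {ω | u ≤ ∑ t ∈ I, (p / 2 - Real.log 2 * A.indicator (1 : X → ℝ) (Z t ω).1)} := by
    intro ω _
    by_cases hω : k ≤ (I.filter fun t => (Z t ω).1 ∈ A).card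
    · exact Or.inl hω
    · right
      change u ≤ _
      have h1 : ∑ t ∈ I, A.indicator (1 : X → ℝ) (Z t ω).1 =
          ((I.filter fun t => (Z t ω).1 ∈ A).card : ℝ) := by
        rw [Finset.card_filter]
        push_cast
        refine Finset.sum_congr rfl fun t _ => ?_
        simp [Set.indicator]
      rw [Finset.sum_sub_distrib, ← Finset.mul_sum, h1, Finset.sum_const, nsmul_eq_mul, hu]
      have h2 : ((I.filter fun t => (Z t ω).1 ∈ A).card : ℝ) ≤ k := by
        exact_mod_cast (not_le.1 hω).le
      nlinarith
  have h1 : (1 : ENNReal) ≤ ENNReal.ofReal (1 / 2) + ENNReal.ofReal (Real.exp (-u)) := by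
    calc (1 : ENNReal) = P Set.univ := measure_univ.symm
      _ ≤ _ := (measure_mono hcov).trans (measure_union_le _ _)
      _ ≤ _ := add_le_add h hch
  rw [← ENNReal.ofReal_add (by norm_num) (Real.exp_pos _).le, ← ENNReal.ofReal_one,
    ENNReal.ofReal_le_ofReal_iff (by positivity)] at h1
  have h2 : Real.log (1 / 2) ≤ -u := by
    rw [Real.log_le_iff_le_exp (by norm_num)]
    linarith
  rw [one_div, Real.log_inv] at h2
  have h3 : I.card * p ≤ 2 * ((k + 1) * Real.log 2) := by
    rw [hu] at h2
    linarith
  have h4 : ((k : ℝ) + 1) * Real.log 2 ≤ k + 1 := mul_le_of_le_one_right (by positivity) hl2'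
  linarith

/-- A small deterministic net that, with high probability, approximates the class on the sample
and in the mean. -/
lemma exists_net (hZ : ∀ t, Measurable (Z t)) (hi : iIndepFun Z P) (hD : ∀ t, P.map (Z t) = D)
    {F : Set (X → ℝ)} (hc : F.Countable)
    (hF : ∀ f ∈ F, Measurable f ∧ ∀ x, f x ∈ Set.Icc (0 : ℝ) 1) {d : ℕ} (hd : pdim F ≤ d)
    (I : Finset ℕ) {n : ℕ} (hn : 0 < n) (k : ℕ) {δ : ℝ} (hδ : δ ≤ 1 / 2)
    (hk : (((2 * I.card * n + 1) ^ (2 * d) : ℕ) : ENNReal) / 2 ^ k ≤ ENNReal.ofReal δ) :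
    ∃ H : Finset (X → ℝ), ↑H ⊆ F ∧ H.card ≤ (I.card * n + 1) ^ d ∧
      P {ω | ¬ ∀ f ∈ F, ∃ g ∈ H, ∑ t ∈ I, |f (Z t ω).1 - g (Z t ω).1| ≤ I.card / n + k ∧
        I.card * ∫ x, |f x - g x| ∂D.fst ≤ I.card / n + 2 * (k + 1)} ≤ ENNReal.ofReal δ := by
  classical
  obtain ⟨y, hy⟩ := exists_ghost_sample (ι := I) hc (fun f hf => (hF f hf).1) hd n k D.fst
  rw [Fintype.card_coe] at hy
  replace hy := hy.trans hk
  rw [← map_sample hZ hi hD I] at hy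
  have hXm : Measurable fun ω (i : I) => (Z i ω).1 :=
    measurable_pi_lambda _ fun i => measurable_fst.comp (hZ i)
  replace hy := (Measure.le_map_apply hXm.aemeasurable _).trans hy
  set s : Finset X := Finset.univ.image y with hs
  obtain ⟨H, hHF, hHc, hH⟩ := exists_finset_agree hd s n
  refine ⟨H, hHF, hHc.trans (Nat.pow_le_pow_left (Nat.succ_le_succ (Nat.mul_le_mul_right _
    (Finset.card_image_le.trans (by simp)))) d), (measure_mono ?_).trans hy⟩
  -- Closeness in the mean is read off the same sample event: if `f` and `g` agree on the ghost
  -- sample, their disagreement set is hit at least `k` times with probability at most `δ ≤ 1 / 2`,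
  -- so its mass is small. No second symmetrization is needed.
  have hpop : ∀ f ∈ F, ∀ g ∈ F, (∀ i, Agree n f g (y i)) →
      I.card * ∫ x, |f x - g x| ∂D.fst ≤ I.card / n + 2 * (k + 1) := by
    intro f hf g hg hfg
    have hA : MeasurableSet {x | Agree n f g x}ᶜ :=
      (measurableSet_agree n (hF f hf).1 (hF g hg).1).compl
    have h1 := card_mul_measureReal_le hZ hi hD hA I k
      (((measure_mono fun ω hω => ?_).trans hy).trans (ENNReal.ofReal_le_ofReal hδ))
    · have h2 : ∫ x, |f x - g x| ∂D.fst ≤ 1 / n + D.fst.real {x | Agree n f g x}ᶜ := by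
        have hi2 : Integrable (({x | Agree n f g x}ᶜ).indicator (1 : X → ℝ)) D.fst :=
          (integrable_const (1 : ℝ)).indicator hA
        have h3 : ∫ x, |f x - g x| ∂D.fst ≤
            ∫ x, (1 / n + ({x | Agree n f g x}ᶜ).indicator (1 : X → ℝ) x) ∂D.fst := by
          refine integral_mono (integrable_of_abs_le (c := 1)
            ((hF f hf).1.sub (hF g hg).1).abs fun x => ?_) ((integrable_const _).add hi2) fun x => ?_
          · rw [abs_abs, abs_le]
            constructor <;> linarith [((hF f hf).2 x).1, ((hF f hf).2 x).2, ((hF g hg).2 x).1,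
              ((hF g hg).2 x).2]
          · refine (abs_sub_le_add_ite hn x ((hF f hf).2 x) ((hF g hg).2 x)).trans ?_
            by_cases hx : Agree n f g x <;> simp [hx]
        rw [integral_add (integrable_const _) hi2, integral_indicator_one hA] at h3
        simpa using h3
      calc (I.card : ℝ) * ∫ x, |f x - g x| ∂D.fst
          ≤ I.card * (1 / n + D.fst.real {x | Agree n f g x}ᶜ) := by gcongr
        _ = I.card / n + I.card * D.fst.real {x | Agree n f g x}ᶜ := by ring
        _ ≤ _ := by linarith
    · refine ⟨f, hf, g, hg, hfg, ?_⟩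
      have h2 := card_filter_univ_coe I fun t => ¬ Agree n f g (Z t ω).1
      refine le_of_le_of_eq hω (Eq.trans ?_ h2.symm)
      congr 1
      ext t
      simp
  intro ω hω
  by_contra hcon
  refine hω fun f hf => ?_
  obtain ⟨g, hgH, hfg⟩ := hH f hf
  have hg : g ∈ F := hHF hgH
  have hfg' : ∀ i, Agree n f g (y i) := fun i => hfg _ (by simp [hs])
  refine ⟨g, hgH, ?_, hpop f hf g hg hfg'⟩
  have hcount : (I.filter fun t => ¬ Agree n f g (Z t ω).1).card < k := by
    by_contra! hk'
    refine hcon ⟨f, hf, g, hg, hfg', ?_⟩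
    have h2 := card_filter_univ_coe I fun t => ¬ Agree n f g (Z t ω).1
    exact le_of_le_of_eq hk' h2.symm
  calc ∑ t ∈ I, |f (Z t ω).1 - g (Z t ω).1|
      ≤ ∑ t ∈ I, (1 / (n : ℝ) + if Agree n f g (Z t ω).1 then 0 else 1) :=
        Finset.sum_le_sum fun t _ => abs_sub_le_add_ite hn _ ((hF f hf).2 _) ((hF g hg).2 _)
    _ = I.card / n + (I.filter fun t => ¬ Agree n f g (Z t ω).1).card := by
        rw [Finset.sum_add_distrib, Finset.sum_const, nsmul_eq_mul, Finset.card_filter]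
        push_cast
        congr 1
        · ring
        · exact Finset.sum_congr rfl fun t _ => by by_cases h : Agree n f g (Z t ω).1 <;> simp [h]
    _ ≤ _ := by
        have : ((I.filter fun t => ¬ Agree n f g (Z t ω).1).card : ℝ) ≤ k := by
          exact_mod_cast hcount.le
        linarith

variable {q : ℕ → (ℕ → X × Bool) → X → ℝ} {h : X → ℝ}

lemma measure_excessLoss_le (hZ : ∀ t, Measurable (Z t)) (hi : iIndepFun Z P)
    (hD : ∀ t, P.map (Z t) = D)
    (hqm : ∀ t, Measurable (Function.uncurry (q t))) (hqp : Predictable q)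
    (hq : ∀ t z x, q t z x ∈ Set.Icc (0 : ℝ) 1)
    (hhm : Measurable h) (hh : ∀ x, h x ∈ Set.Icc (0 : ℝ) 1) (heq : h =ᵐ[D.fst] condProb D)
    {f : X → ℝ} (hfm : Measurable f) (hf : ∀ x, f x ∈ Set.Icc (0 : ℝ) 1) (I : Finset ℕ) (u : ℝ) :
    P {ω | u ≤ ∑ t ∈ I, (wdist D (q t fun i => Z i ω) f h / 16 -
      q t (fun i => Z i ω) (Z t ω).1 * excessLoss f h (Z t ω) / 8)} ≤
      ENNReal.ofReal (Real.exp (-u)) := by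
  refine measure_le_sum_le (D := D) (W := fun t z a => wdist D (q t z) f h / 16 -
    q t z a.1 * excessLoss f h a / 8) hZ hi hD ?_ ?_ ?_ I u
  · intro t
    have h1 : Measurable fun z => wdist D (q t z) f h := by
      have : Measurable fun p : (ℕ → X × Bool) × X => q t p.1 p.2 * (f p.2 - h p.2) ^ 2 :=
        (hqm t).mul (((hfm.sub hhm).pow_const 2).comp measurable_snd)
      exact this.stronglyMeasurable.integral_prod_right.measurable
    have h2 : Measurable fun p : (ℕ → X × Bool) × (X × Bool) => q t p.1 p.2.1 :=
      (hqm t).comp (measurable_fst.prodMk (measurable_fst.comp measurable_snd))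
    exact ((h1.comp measurable_fst).div_const 16).sub
      ((h2.mul ((measurable_excessLoss hfm hhm).comp measurable_snd)).div_const 8)
  · intro t z z' hz
    simp only [hqp t z z' hz]
  · intro t z
    exact lintegral_exp_excessLoss_le_one ((hqm t).comp measurable_prodMk_left) (hq t z)
      hfm hf hhm hh heq

end Concentration

end ActiveLearning

namespace ActiveLearning

/-! ### Deviation bound for the whole class and all time windows. -/

section Uniform

variable {X Ω : Type*} [MeasurableSpace X] [MeasurableSpace Ω] {P : Measure Ω}
  [IsProbabilityMeasure P] {D : Measure (X × Bool)} [IsProbabilityMeasure D]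
  {Z : ℕ → Ω → X × Bool} {q : ℕ → (ℕ → X × Bool) → X → ℝ} {h : X → ℝ}

/-- Lower deviations of the queried excess loss, uniformly over the class and over windows of
time. -/
lemma measure_not_uniform_le (hZ : ∀ t, Measurable (Z t)) (hi : iIndepFun Z P)
    (hD : ∀ t, P.map (Z t) = D)
    (hqm : ∀ t, Measurable (Function.uncurry (q t))) (hqp : Predictable q)
    (hq : ∀ t z x, q t z x ∈ Set.Icc (0 : ℝ) 1)
    (hhm : Measurable h) (hh : ∀ x, h x ∈ Set.Icc (0 : ℝ) 1) (heq : h =ᵐ[D.fst] condProb D)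
    {F : Set (X → ℝ)} (hF : ∀ f ∈ F, Measurable f ∧ ∀ x, f x ∈ Set.Icc (0 : ℝ) 1)
    (hsep : PointwiseSeparable F) {d : ℕ} (hd : pdim F ≤ d) {N : ℕ} (hN : 0 < N) (k : ℕ)
    {δ : ℝ} (hδ : δ ≤ 1 / 2)
    (hk : (((2 * N * N + 1) ^ (2 * d) : ℕ) : ENNReal) / 2 ^ k ≤ ENNReal.ofReal δ) (u : ℝ) :
    P {ω | ¬ ∀ f ∈ F, ∀ a b, b ≤ N →
      (∑ t ∈ Finset.Ioc a b, wdist D (q t fun i => Z i ω) f h) / 2 ≤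
      ∑ t ∈ Finset.Ioc a b, q t (fun i => Z i ω) (Z t ω).1 * excessLoss f h (Z t ω) +
        (8 * u + 4 * k + 5)} ≤
      ENNReal.ofReal δ +
        (((N * N + 1) ^ d * (N + 1) ^ 2 : ℕ) : ENNReal) * ENNReal.ofReal (Real.exp (-u)) := by
  classical
  obtain ⟨F₀, hF₀, hc, hdense⟩ := hsep
  have hIN : (Finset.Ioc 0 N).card = N := by simp
  -- One net for the full horizon serves every window, because the absolute approximation errors
  -- over a window are part of those over the horizon.
  obtain ⟨H, hHF, hHc, hH⟩ := exists_net hZ hi hD hc (fun f hf => hF f (hF₀ hf))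
    ((pdim_mono hF₀).trans hd) (Finset.Ioc 0 N) hN k hδ (by rwa [hIN])
  rw [hIN] at hHc hH
  set J : Finset ((X → ℝ) × (ℕ × ℕ)) :=
    H ×ˢ (Finset.range (N + 1) ×ˢ Finset.range (N + 1)) with hJ
  have hJc : J.card ≤ (N * N + 1) ^ d * (N + 1) ^ 2 := by
    rw [hJ, Finset.card_product, Finset.card_product, Finset.card_range, sq]
    exact Nat.mul_le_mul_right _ hHc
  set B : (X → ℝ) × (ℕ × ℕ) → Set Ω := fun j => {ω | u ≤ ∑ t ∈ Finset.Ioc j.2.1 j.2.2,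
    (wdist D (q t fun i => Z i ω) j.1 h / 16 -
      q t (fun i => Z i ω) (Z t ω).1 * excessLoss j.1 h (Z t ω) / 8)} with hB
  have hBle : P (⋃ j ∈ J, B j) ≤
      (((N * N + 1) ^ d * (N + 1) ^ 2 : ℕ) : ENNReal) * ENNReal.ofReal (Real.exp (-u)) := by
    refine (measure_biUnion_finset_le _ _).trans ?_
    calc ∑ j ∈ J, P (B j) ≤ ∑ j ∈ J, ENNReal.ofReal (Real.exp (-u)) := by
          refine Finset.sum_le_sum fun j hj => ?_
          have hjF : j.1 ∈ F := hF₀ (hHF (Finset.mem_product.1 hj).1)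
          exact measure_excessLoss_le hZ hi hD hqm hqp hq hhm hh heq (hF _ hjF).1 (hF _ hjF).2 _ u
      _ = (J.card : ENNReal) * ENNReal.ofReal (Real.exp (-u)) := by
          rw [Finset.sum_const, nsmul_eq_mul]
      _ ≤ _ := by
          gcongr
  refine (measure_mono ?_).trans ((measure_union_le _ _).trans (add_le_add hH hBle))
  intro ω hω
  by_contra hcon
  simp only [Set.mem_union, not_or, Set.mem_ofPred_eq, not_not, Set.mem_iUnion, not_exists] at hcon
  obtain ⟨hnet, hdev⟩ := hcon
  refine hω fun f hf a b hb => ?_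
  have hqmz : ∀ t, Measurable (q t fun i => Z i ω) := fun t => (hqm t).comp measurable_prodMk_left
  have hmain : ∀ f ∈ F₀, (∑ t ∈ Finset.Ioc a b, wdist D (q t fun i => Z i ω) f h) / 2 ≤
      ∑ t ∈ Finset.Ioc a b, q t (fun i => Z i ω) (Z t ω).1 * excessLoss f h (Z t ω) +
        (8 * u + 4 * k + 5) := by
    intro f hf
    obtain ⟨g, hgH, hsum, hint⟩ := hnet f hf
    have hfF := hF f (hF₀ hf)
    have hgF := hF g (hF₀ (hHF hgH))
    have hNN : (N : ℝ) / N = 1 := div_self (by positivity)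
    rw [hNN] at hsum hint
    have hsub : Finset.Ioc a b ⊆ Finset.Ioc 0 N := fun t ht => by
      rw [Finset.mem_Ioc] at ht ⊢; omega
    rcases lt_or_ge b a with hab | hab
    -- The window is empty and only nonnegativity of the slack is at stake. An empty sum that fails
    -- to reach `u` shows that `u` is positive.
    · have h1 := hdev (g, (0, 0)) (by simp [hJ, hgH])
      have hu : 0 < u := by simpa [hB] using h1
      rw [Finset.Ioc_eq_empty_of_le hab.le]
      simp
      positivity
    have h1 := hdev (g, (a, b)) (by
      simp only [hJ, Finset.mem_product, Finset.mem_range]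
      exact ⟨hgH, by omega, by omega⟩)
    simp only [hB, Set.mem_ofPred_eq, not_le] at h1
    rw [Finset.sum_sub_distrib, ← Finset.sum_div, ← Finset.sum_div] at h1
    have h2 : |∑ t ∈ Finset.Ioc a b, q t (fun i => Z i ω) (Z t ω).1 * excessLoss f h (Z t ω) -
        ∑ t ∈ Finset.Ioc a b, q t (fun i => Z i ω) (Z t ω).1 * excessLoss g h (Z t ω)| ≤
        2 * (1 + k) := by
      rw [← Finset.sum_sub_distrib]
      calc _ ≤ ∑ t ∈ Finset.Ioc a b, |q t (fun i => Z i ω) (Z t ω).1 * excessLoss f h (Z t ω) -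
            q t (fun i => Z i ω) (Z t ω).1 * excessLoss g h (Z t ω)| :=
            Finset.abs_sum_le_sum_abs _ _
        _ ≤ ∑ t ∈ Finset.Ioc a b, 2 * |f (Z t ω).1 - g (Z t ω).1| := by
            refine Finset.sum_le_sum fun t _ => ?_
            have hq1 := hq t (fun i => Z i ω) (Z t ω).1
            rw [← mul_sub, abs_mul, abs_of_nonneg hq1.1]
            exact (mul_le_of_le_one_left (abs_nonneg _) hq1.2).trans
              (abs_excessLoss_sub_le (hfF.2 _) (hgF.2 _))
        _ ≤ ∑ t ∈ Finset.Ioc 0 N, 2 * |f (Z t ω).1 - g (Z t ω).1| :=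
            Finset.sum_le_sum_of_subset_of_nonneg hsub fun _ _ _ => by positivity
        _ ≤ _ := by rw [← Finset.mul_sum]; linarith
    have h3 : |∑ t ∈ Finset.Ioc a b, wdist D (q t fun i => Z i ω) f h -
        ∑ t ∈ Finset.Ioc a b, wdist D (q t fun i => Z i ω) g h| ≤ 2 * (1 + 2 * (k + 1)) := by
      rw [← Finset.sum_sub_distrib]
      have hnn : 0 ≤ ∫ x, |f x - g x| ∂D.fst := integral_nonneg fun _ => abs_nonneg _
      calc _ ≤ ∑ t ∈ Finset.Ioc a b, |wdist D (q t fun i => Z i ω) f h -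
            wdist D (q t fun i => Z i ω) g h| := Finset.abs_sum_le_sum_abs _ _
        _ ≤ ∑ t ∈ Finset.Ioc a b, 2 * ∫ x, |f x - g x| ∂D.fst :=
            Finset.sum_le_sum fun t _ =>
              abs_wdist_sub_le (hqmz t) (hq t _) hfF.1 hfF.2 hgF.1 hgF.2 hhm hh
        _ ≤ ∑ t ∈ Finset.Ioc 0 N, 2 * ∫ x, |f x - g x| ∂D.fst :=
            Finset.sum_le_sum_of_subset_of_nonneg hsub fun _ _ _ => by positivity
        _ ≤ _ := by
            rw [Finset.sum_const, hIN, nsmul_eq_mul]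
            linarith
    -- Slack: `8 u` from the deviation of `g`, `2 (1 + k)` from the data, and half of `2 (1 + 2 (k +
    -- 1))` from the means, in total `8 u + 4 k + 5`.
    have h2' := (abs_le.1 h2).1
    have h3' := (abs_le.1 h3).2
    linarith
  -- For fixed data both sides are continuous under pointwise limits, by dominated convergence for
  -- the distances, so the bound passes from the countable subclass to `F`.
  obtain ⟨v, hv, hlim⟩ := hdense f hf
  have hl1 : Tendsto (fun n => (∑ t ∈ Finset.Ioc a b, wdist D (q t fun i => Z i ω) (v n) h) / 2)
      atTop (𝓝 ((∑ t ∈ Finset.Ioc a b, wdist D (q t fun i => Z i ω) f h) / 2)) := by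
    refine (tendsto_finsetSum _ fun t _ => ?_).div_const 2
    refine tendsto_integral_of_dominated_convergence (fun _ => (1 : ℝ)) (fun n => ?_)
      (integrable_const _) (fun n => ae_of_all _ fun x => ?_) (ae_of_all _ fun x => ?_)
    · exact ((hqmz t).mul (((hF _ (hF₀ (hv n))).1.sub hhm).pow_const 2)).aestronglyMeasurable
    · exact abs_mul_sq_le_one (hq t _ x) ((hF _ (hF₀ (hv n))).2 x) (hh x)
    · exact (((hlim x).sub_const _).pow 2).const_mul _
  have hl2 : Tendsto (fun n => ∑ t ∈ Finset.Ioc a b,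
      q t (fun i => Z i ω) (Z t ω).1 * excessLoss (v n) h (Z t ω) + (8 * u + 4 * k + 5)) atTop
      (𝓝 (∑ t ∈ Finset.Ioc a b, q t (fun i => Z i ω) (Z t ω).1 * excessLoss f h (Z t ω) +
        (8 * u + 4 * k + 5))) := by
    refine (tendsto_finsetSum _ fun t _ => ?_).add_const _
    exact ((((hlim _).sub_const _).pow 2).sub_const _).const_mul _
  exact le_of_tendsto_of_tendsto' hl1 hl2 fun n => hmain _ (hv n)

end Uniform

end ActiveLearning

namespace ActiveLearning

/-! ### Random lists -/

section RandomList

variable {α Ω : Type*} [MeasurableSpace α] [MeasurableSpace Ω]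

/-- A list-valued map whose restrictions to fixed length are measurable. -/
def MeasurableList (L : Ω → List α) : Prop :=
  ∀ n, MeasurableSet {ω | (L ω).length = n} ∧
    ∃ v : Ω → Fin n → α, Measurable v ∧ ∀ ω, (L ω).length = n → L ω = List.ofFn (v ω)

lemma MeasurableList.nil [Nonempty α] : MeasurableList fun _ : Ω => ([] : List α) := by
  intro n
  refine ⟨MeasurableSet.const _, fun _ _ => Classical.arbitrary α, measurable_const, ?_⟩
  intro ω h
  have hn : n = 0 := by simpa using h.symm
  subst hn
  simp

open Classical in
lemma MeasurableList.append_ite {L : Ω → List α} (hL : MeasurableList L) {a : Ω → α}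
    (ha : Measurable a) {s : Set Ω} (hs : MeasurableSet s) :
    MeasurableList fun ω => L ω ++ if ω ∈ s then [a ω] else [] := by
  intro n
  have hset : {ω | (L ω ++ if ω ∈ s then [a ω] else []).length = n} =
      (s ∩ {ω | (L ω).length + 1 = n}) ∪ (sᶜ ∩ {ω | (L ω).length = n}) := by
    ext ω
    by_cases h : ω ∈ s <;> simp [h]
  rw [hset]
  cases n with
  | zero =>
    refine ⟨?_, fun _ => Fin.elim0, measurable_const, ?_⟩
    · simpa using hs.compl.inter (hL 0).1
    · intro ω hω
      simpa using hω
  | succ m =>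
    obtain ⟨h1, v, hv, hLv⟩ := hL m
    obtain ⟨h2, w, hw, hLw⟩ := hL (m + 1)
    refine ⟨(hs.inter (by simpa using h1)).union (hs.compl.inter h2),
      fun ω => if ω ∈ s then Fin.snoc (v ω) (a ω) else w ω, ?_, ?_⟩
    · refine Measurable.ite hs (measurable_pi_lambda _ fun i => ?_) hw
      refine Fin.lastCases ?_ (fun j => ?_) i
      · simpa using ha
      · simpa using! (measurable_pi_apply j).comp hv
    · intro ω hω
      by_cases h : ω ∈ s
      · simp only [h, if_true] at hω ⊢
        rw [hLv ω (by simpa using hω), List.ofFn_succ']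
        simp
      · simp only [h, if_false, List.append_nil] at hω ⊢
        exact hLw ω hω

lemma MeasurableList.append_filter {L : Ω → List α} (hL : MeasurableList L) {a : ℕ → Ω → α}
    (ha : ∀ i, Measurable (a i)) {p : Ω → α → Prop} [∀ ω, DecidablePred (p ω)]
    (hp : ∀ i, MeasurableSet {ω | p ω (a i ω)}) (l : List ℕ) :
    MeasurableList fun ω => L ω ++ (l.map fun i => a i ω).filter fun x => decide (p ω x) := by
  classical
  induction l generalizing L with
  | nil => simpa using hL
  | cons i l ih =>
    have h1 := ih (hL.append_ite (ha i) (hp i))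
    convert h1 using 2 with ω
    by_cases h : p ω (a i ω) <;> simp [h]

/-- The confidence bounds are assumed measurable for data of fixed length; cutting along the
countably many possible lengths extends this to data sets of random length. -/
lemma MeasurableList.measurable_comp {β : Type*} [MeasurableSpace β] {L : Ω → List α}
    (hL : MeasurableList L) {Φ : List α → β → ℝ}
    (hΦ : ∀ n, Measurable fun p : (Fin n → α) × β => Φ (List.ofFn p.1) p.2) :
    Measurable fun p : Ω × β => Φ (L p.1) p.2 := by
  choose hlen v hv hLv using hL
  intro A hA
  have : (fun p : Ω × β => Φ (L p.1) p.2) ⁻¹' A = ⋃ n, (Prod.fst ⁻¹' {ω | (L ω).length = n}) ∩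
      (fun p : Ω × β => Φ (List.ofFn (v n p.1)) p.2) ⁻¹' A := by
    ext p
    simp only [Set.mem_preimage, Set.mem_iUnion, Set.mem_inter_iff, Set.mem_ofPred_eq]
    constructor
    · intro h
      exact ⟨_, rfl, by rwa [← hLv _ p.1 rfl]⟩
    · rintro ⟨n, hn, h⟩
      rwa [hLv n p.1 hn]
  rw [this]
  refine MeasurableSet.iUnion fun n => (measurable_fst (hlen n)).inter ?_
  exact (hΦ n).comp (((hv n).comp measurable_fst).prodMk measurable_snd) hA

end RandomList

/-! ### Measurability of the algorithm -/

section Algorithm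

variable {X : Type*} {F : Set (X → ℝ)} {ro : List (X × Bool) → X → ℝ} {γ T C : ℝ}

lemma epochClassifier_eq_none_iff {m : ℕ} {S : List (X × Bool)} {x : X} :
    epochClassifier F ro γ T C m S x = none ↔
      Set.Icc (lcb (epochActiveSet F ro T C m S) x) (ucb (epochActiveSet F ro T C m S) x) ⊆
        Set.Icc (1 / 2 - γ) (1 / 2 + γ) := by
  unfold epochClassifier
  simp only
  split_ifs with h
  · exact iff_of_true rfl h
  · exact iff_of_false (by simp) h

/-- Crossed bounds `b ω < a ω` give an empty interval, which lies in every interval and has to be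
counted. -/
lemma measurableSet_Icc_subset {Ω : Type*} [MeasurableSpace Ω] {a b : Ω → ℝ} (ha : Measurable a)
    (hb : Measurable b) (c d : ℝ) : MeasurableSet {ω | Set.Icc (a ω) (b ω) ⊆ Set.Icc c d} := by
  have : {ω | Set.Icc (a ω) (b ω) ⊆ Set.Icc c d} =
      {ω | b ω < a ω} ∪ ({ω | c ≤ a ω} ∩ {ω | b ω ≤ d}) := by
    ext ω
    by_cases h : a ω ≤ b ω
    · simp [Set.Icc_subset_Icc_iff h, not_lt.2 h]
    · simp [not_le.1 h]
  rw [this]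
  exact (measurableSet_lt hb ha).union
    ((measurableSet_le measurable_const ha).inter (measurableSet_le hb measurable_const))

lemma epochEnd_mono : Monotone epochEnd := by
  refine monotone_nat_of_le_succ fun k => ?_
  unfold epochEnd
  split_ifs with h1
  · simp
  · simp_all
  · simp_all
  · exact Nat.pow_le_pow_right (by norm_num) (Nat.le_succ k)

/-- Index of the epoch before the one that contains time `t`. -/
def epochIndex (t : ℕ) : ℕ := Nat.clog 2 t - 1

lemma epochIndex_eq {k t : ℕ} (ht : t ∈ Finset.Ioc (epochEnd k) (epochEnd (k + 1))) :
    epochIndex t = k := by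
  rw [Finset.mem_Ioc] at ht
  have h2 : t ≤ 2 ^ (k + 1) := by simpa [epochEnd] using ht.2
  have h3 : Nat.clog 2 t ≤ k + 1 := Nat.clog_le_of_le_pow h2
  unfold epochIndex
  -- The first epoch consists of the times 1 and 2, where `Nat.clog 2` is 0 and 1; truncated
  -- subtraction sends both to 0.
  rcases Nat.eq_zero_or_pos k with rfl | hk
  · omega
  · have h1 : 2 ^ k < t := by simpa [epochEnd, hk.ne'] using ht.1
    have h4 : k < Nat.clog 2 t := (Nat.lt_clog_iff_pow_lt (by norm_num)).2 h1
    omega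

lemma epochEnd_epochIndex_lt {t : ℕ} (ht : 0 < t) : epochEnd (epochIndex t) < t := by
  unfold epochEnd
  split_ifs with h
  · exact ht
  · unfold epochIndex at h ⊢
    have h1 : 1 < t := by
      by_contra! hle
      have : Nat.clog 2 t = 0 := Nat.clog_of_right_le_one hle 2
      omega
    exact Nat.pow_pred_clog_lt_self (by norm_num) h1

lemma queriedData_congr {z z' : ℕ → X × Bool} {k : ℕ} (h : ∀ i ≤ epochEnd k, z i = z' i) :
    queriedData F ro γ T C z k = queriedData F ro γ T C z' k := by
  induction k with
  | zero => rfl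
  | succ k ih =>
    have hle := epochEnd_mono (Nat.le_succ k)
    have h1 := ih fun i hi => h i (hi.trans hle)
    have h2 : (List.range' (epochEnd k + 1) (epochEnd (k + 1) - epochEnd k)).map z =
        (List.range' (epochEnd k + 1) (epochEnd (k + 1) - epochEnd k)).map z' := by
      refine List.map_congr_left fun i hi => h i ?_
      rw [List.mem_range'_1] at hi
      simp only [Nat.succ_eq_add_one] at hle
      omega
    unfold queriedData
    simp only
    rw [h1, h2]

open Classical in
/-- Indicator that the label of an example with covariate `x` at time `t` is queried. -/
noncomputable def queryInd (F : Set (X → ℝ)) (ro : List (X × Bool) → X → ℝ) (γ T C : ℝ) (t : ℕ)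
    (z : ℕ → X × Bool) (x : X) : ℝ :=
  if epochIndex t < numEpochs T ∧ epochQuery F ro γ T C (epochIndex t + 1)
    (queriedData F ro γ T C z (epochIndex t)) x then 1 else 0

lemma queryInd_mem (t : ℕ) (z : ℕ → X × Bool) (x : X) :
    queryInd F ro γ T C t z x ∈ Set.Icc (0 : ℝ) 1 := by
  unfold queryInd
  split_ifs <;> simp

/-- The rule is frozen during an epoch and was built from data gathered strictly before the epoch
began. Time 0 has epoch index 0, for which there is no data at all. -/
lemma predictable_queryInd : Predictable (queryInd F ro γ T C) := by
  intro t z z' h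
  have h1 : queriedData F ro γ T C z (epochIndex t) =
      queriedData F ro γ T C z' (epochIndex t) := by
    rcases Nat.eq_zero_or_pos t with rfl | ht
    · simp [epochIndex, queriedData]
    · exact queriedData_congr fun i hi => h i (hi.trans_lt (epochEnd_epochIndex_lt ht))
  funext x
  unfold queryInd
  rw [h1]

lemma sum_map_filter (l : List ℕ) (z : ℕ → X × Bool) (p : X × Bool → Prop) [DecidablePred p]
    (φ : X × Bool → ℝ) : (((l.map z).filter fun x => decide (p x)).map φ).sum =
      (l.map fun i => (if p (z i) then 1 else 0) * φ (z i)).sum := by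
  induction l with
  | nil => simp
  | cons i l ih => by_cases h : p (z i) <;> simp [h, ih]

lemma sum_range'_eq (a n : ℕ) (φ : ℕ → ℝ) :
    ((List.range' (a + 1) n).map φ).sum = ∑ t ∈ Finset.Ioc a (a + n), φ t := by
  induction n with
  | zero => simp
  | succ n ih =>
    rw [List.range'_1_concat, List.map_append, List.sum_append, ih, ← add_assoc,
      Finset.sum_Ioc_succ_top (by omega)]
    simp [add_right_comm]

/-- Sums over the queried data are sums over time weighted by the query indicator. -/
lemma sum_queriedData (z : ℕ → X × Bool) (φ : X × Bool → ℝ) {k : ℕ} (hk : k ≤ numEpochs T) :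
    ((queriedData F ro γ T C z k).map φ).sum =
      ∑ t ∈ Finset.Ioc 0 (epochEnd k), queryInd F ro γ T C t z (z t).1 * φ (z t) := by
  classical
  induction k with
  | zero => simp [queriedData, epochEnd]
  | succ k ih =>
    have hle := epochEnd_mono (Nat.le_succ k)
    rw [← Finset.sum_Ioc_consecutive _ (Nat.zero_le _) hle, ← ih (by omega)]
    simp only [queriedData, List.map_append, List.sum_append]
    rw [sum_map_filter, sum_range'_eq, Nat.add_sub_cancel' hle]
    congr 1
    refine Finset.sum_congr rfl fun t ht => ?_
    rw [queryInd, epochIndex_eq ht]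
    have : k < numEpochs T := hk
    simp [this]

/-- Bridge between the losses compared by the algorithm and the weighted sums over time controlled
by the supermartingale. -/
lemma sqLoss_queriedData_sub (z : ℕ → X × Bool) (f g : X → ℝ) {k : ℕ} (hk : k ≤ numEpochs T) :
    sqLoss f (queriedData F ro γ T C z k) - sqLoss g (queriedData F ro γ T C z k) =
      ∑ t ∈ Finset.Ioc 0 (epochEnd k),
        queryInd F ro γ T C t z (z t).1 * excessLoss f g (z t) := by
  unfold sqLoss
  rw [sum_queriedData z _ hk, sum_queriedData z _ hk, ← Finset.sum_sub_distrib]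
  refine Finset.sum_congr rfl fun t _ => ?_
  simp only [excessLoss, labelValue]
  ring

lemma length_queriedData (z : ℕ → X × Bool) {k : ℕ} (hk : k ≤ numEpochs T) :
    ((queriedData F ro γ T C z k).length : ℝ) =
      ∑ t ∈ Finset.Ioc 0 (epochEnd k), queryInd F ro γ T C t z (z t).1 := by
  have := sum_queriedData (F := F) (ro := ro) (γ := γ) (C := C) z (fun _ => 1) hk
  simpa using this

variable [MeasurableSpace X]

lemma measurableSet_epochQuery {Ω : Type*} [MeasurableSpace Ω]
    (hmb : MeasurableConfidenceBounds F ro) {L : Ω → List (X × Bool)} (hL : MeasurableList L)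
    {m : ℕ} (hr : 0 ≤ ((numEpochs T : ℝ) - m + 1) * C) :
    MeasurableSet {p : Ω × X | epochQuery F ro γ T C m (L p.1) p.2} := by
  have hl : Measurable fun p : Ω × X => lcb (epochActiveSet F ro T C m (L p.1)) p.2 :=
    hL.measurable_comp (Φ := fun S x => lcb (epochActiveSet F ro T C m S) x)
      fun n => (hmb n _ hr).1
  have hu : Measurable fun p : Ω × X => ucb (epochActiveSet F ro T C m (L p.1)) p.2 :=
    hL.measurable_comp (Φ := fun S x => ucb (epochActiveSet F ro T C m S) x)
      fun n => (hmb n _ hr).2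
  have : {p : Ω × X | epochQuery F ro γ T C m (L p.1) p.2} =
      ({p | lcb (epochActiveSet F ro T C m (L p.1)) p.2 < 1 / 2} ∩
        {p | 1 / 2 < ucb (epochActiveSet F ro T C m (L p.1)) p.2}) ∩
      {p | Set.Icc (lcb (epochActiveSet F ro T C m (L p.1)) p.2)
        (ucb (epochActiveSet F ro T C m (L p.1)) p.2) ⊆ Set.Icc (1 / 2 - γ) (1 / 2 + γ)}ᶜ := by
    ext p
    simp only [epochQuery, ne_eq, epochClassifier_eq_none_iff, Set.mem_ofPred_eq,
      Set.mem_inter_iff, Set.mem_compl_iff, Set.mem_Ioo]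
  rw [this]
  exact ((measurableSet_lt hl measurable_const).inter (measurableSet_lt measurable_const hu)).inter
    (measurableSet_Icc_subset hl hu _ _).compl

lemma radius_nonneg {M k : ℕ} (hC : 0 ≤ C) (hk : k < M) :
    0 ≤ ((M : ℝ) - (k + 1 : ℕ) + 1) * C := by
  refine mul_nonneg ?_ hC
  have : ((k + 1 : ℕ) : ℝ) ≤ M := by exact_mod_cast hk
  linarith

/-- Induction over epochs: measurable data make the next query rule measurable, and filtering the
next block by it gives measurable data again. -/
lemma measurableList_queriedData [Nonempty X] (hmb : MeasurableConfidenceBounds F ro)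
    (hC : 0 ≤ C) {k : ℕ} (hk : k ≤ numEpochs T) :
    MeasurableList fun z : ℕ → X × Bool => queriedData F ro γ T C z k := by
  classical
  induction k with
  | zero => exact MeasurableList.nil
  | succ k ih =>
    have hL := ih (by omega)
    have hq := measurableSet_epochQuery (γ := γ) hmb hL (radius_nonneg (k := k) hC hk)
    have hp : ∀ i, MeasurableSet {z : ℕ → X × Bool | epochQuery F ro γ T C (k + 1)
        (queriedData F ro γ T C z k) (z i).1} := by
      intro i
      have hm : Measurable fun z : ℕ → X × Bool => (z, (z i).1) :=
        measurable_id.prodMk (measurable_fst.comp (measurable_pi_apply i))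
      exact hm hq
    exact hL.append_filter (a := fun i z => z i) (fun i => measurable_pi_apply i)
      (p := fun z x => epochQuery F ro γ T C (k + 1) (queriedData F ro γ T C z k) x.1)
      hp _

lemma measurable_queryInd [Nonempty X] (hmb : MeasurableConfidenceBounds F ro) (hC : 0 ≤ C)
    (t : ℕ) : Measurable (Function.uncurry (queryInd F ro γ T C t)) := by
  classical
  by_cases ht : epochIndex t < numEpochs T
  · have hq := measurableSet_epochQuery (γ := γ) hmb
      (measurableList_queriedData (γ := γ) hmb hC ht.le) (radius_nonneg hC ht)
    have : Function.uncurry (queryInd F ro γ T C t) = fun p =>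
        if epochQuery F ro γ T C (epochIndex t + 1)
          (queriedData F ro γ T C p.1 (epochIndex t)) p.2 then 1 else 0 := by
      funext p
      simp [queryInd, Function.uncurry, ht]
    rw [this]
    exact Measurable.ite hq measurable_const measurable_const
  · have : Function.uncurry (queryInd F ro γ T C t) = fun _ => 0 := by
      funext p
      simp [queryInd, Function.uncurry, ht]
    rw [this]
    exact measurable_const

end Algorithm

end ActiveLearning

namespace ActiveLearning

/-! ### Use of the disagreement coefficient -/

section Disagreement

variable {X : Type*} [MeasurableSpace X] {F : Set (X → ℝ)} {D : Measure (X × Bool)}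
  [IsProbabilityMeasure D]

lemma one_le_of_supDisagreementCoeff_le {γ₀ θ : ℝ} (hne : F.Nonempty)
    (hθ : supDisagreementCoeff F γ₀ ≤ ENNReal.ofReal θ) : 1 ≤ θ := by
  obtain ⟨f, hf⟩ := hne
  have h1 : (1 : ENNReal) ≤ supDisagreementCoeff F γ₀ := by
    unfold supDisagreementCoeff
    refine le_trans ?_ (le_iSup₂ (f := fun (fs : X → ℝ) (_ : fs ∈ F) =>
      ⨆ (ι : ℝ) (_ : 0 < ι), disagreementCoeff F fs γ₀ ι) f hf)
    refine le_trans ?_ (le_iSup₂ (f := fun (ι : ℝ) (_ : 0 < ι) =>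
      disagreementCoeff F f γ₀ ι) 1 one_pos)
    exact le_sup_right
  exact ENNReal.one_le_ofReal.1 (h1.trans hθ)

lemma disagreement_le {γ₀ θ : ℝ} (hθ : supDisagreementCoeff F γ₀ ≤ ENNReal.ofReal θ) {h : X → ℝ}
    (hh : h ∈ F) (μ : Measure X) [hμ : IsProbabilityMeasure μ] {g e : ℝ} (hg : γ₀ < g)
    (he : 0 < e) :
    ENNReal.ofReal (g ^ 2 / e ^ 2) *
      μ {x | ∃ f ∈ F, g < |f x - h x| ∧ √(∫ u, (f u - h u) ^ 2 ∂μ) ≤ e} ≤ ENNReal.ofReal θ := by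
  refine le_trans ?_ hθ
  unfold supDisagreementCoeff
  refine le_trans ?_ (le_iSup₂ (f := fun (fs : X → ℝ) (_ : fs ∈ F) =>
    ⨆ (ι : ℝ) (_ : 0 < ι), disagreementCoeff F fs γ₀ ι) h hh)
  -- The coefficient at scale `ι` admits only radii strictly above `ι`; the choice `e / 2` lets the
  -- radius `e` itself in.
  refine le_trans ?_ (le_iSup₂ (f := fun (ι : ℝ) (_ : 0 < ι) =>
    disagreementCoeff F h γ₀ ι) (e / 2) (by positivity))
  unfold disagreementCoeff
  refine le_trans ?_ le_sup_left
  refine le_trans ?_ (le_iSup₂ (f := fun (μ : Measure X) (_ : IsProbabilityMeasure μ) =>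
    ⨆ (γ : ℝ) (_ : γ₀ < γ) (ε : ℝ) (_ : e / 2 < ε), ENNReal.ofReal (γ ^ 2 / ε ^ 2) *
      μ {x | ∃ f ∈ F, γ < |f x - h x| ∧ √(∫ u, (f u - h u) ^ 2 ∂μ) ≤ ε}) μ hμ)
  refine le_trans ?_ (le_iSup₂ (f := fun (γ : ℝ) (_ : γ₀ < γ) =>
    ⨆ (ε : ℝ) (_ : e / 2 < ε), ENNReal.ofReal (γ ^ 2 / ε ^ 2) *
      μ {x | ∃ f ∈ F, γ < |f x - h x| ∧ √(∫ u, (f u - h u) ^ 2 ∂μ) ≤ ε}) g hg)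
  exact le_iSup₂ (f := fun (ε : ℝ) (_ : e / 2 < ε) => ENNReal.ofReal (g ^ 2 / ε ^ 2) *
      μ {x | ∃ f ∈ F, g < |f x - h x| ∧ √(∫ u, (f u - h u) ^ 2 ∂μ) ≤ ε}) e (by linarith)

/-- A region on which the class is wide compared with its `L²` radius has small probability. -/
lemma measureReal_le_of_disagreement {γ θ V : ℝ} (hγ : 0 < γ)
    (hθ : supDisagreementCoeff F (γ / 2) ≤ ENNReal.ofReal θ) {h : X → ℝ} (hh : h ∈ F) {R : Set X}
    (hR : MeasurableSet R) (hV : 0 < V)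
    (hw : ∀ x ∈ R, ∃ f ∈ F, γ / 2 < |f x - h x| ∧ wdist D (R.indicator 1) f h ≤ V) :
    D.fst.real R ≤ 4 * θ * V / γ ^ 2 := by
  have hθ1 := one_le_of_supDisagreementCoeff_le ⟨h, hh⟩ hθ
  set p := D.fst.real R with hp
  rcases (measureReal_nonneg : 0 ≤ D.fst.real R).eq_or_lt with h0 | hpos
  · rw [hp, ← h0]; positivity
  have hR0 : D.fst R ≠ 0 := fun h => by simp [Measure.real, h] at hpos
  -- Under the marginal conditioned on `R` the squared radius becomes `V / p`, while `R` has mass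
  -- one. The disagreement inequality then reads `1 ≤ 4 θ V / (γ² p)`, which is the claim.
  set μ := D.fst[|R] with hμ
  have : IsProbabilityMeasure μ := cond_isProbabilityMeasure hR0
  have hμR : μ R = 1 := cond_apply_self hR0 (measure_ne_top _ _)
  have hint : ∀ f : X → ℝ, ∫ u, (f u - h u) ^ 2 ∂μ = wdist D (R.indicator 1) f h / p := by
    intro f
    rw [hμ, ProbabilityTheory.cond, integral_smul_measure, ENNReal.toReal_inv, smul_eq_mul,
      ← integral_indicator hR, inv_mul_eq_div]
    congr 1
    refine integral_congr_ae (ae_of_all _ fun x => ?_)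
    by_cases hx : x ∈ R <;> simp [hx]
  set e := √(V / p) with he
  have hVp : 0 < V / p := div_pos hV hpos
  have hepos : 0 < e := Real.sqrt_pos.2 hVp
  have he2 : e ^ 2 = V / p := Real.sq_sqrt hVp.le
  -- The coefficient covers only widths strictly above `γ / 2`, so the set of width `γ / 2` is
  -- exhausted from inside.
  set S : ℕ → Set X := fun n => {x | ∃ f ∈ F, γ / 2 + 1 / ((n : ℝ) + 1) < |f x - h x| ∧
    √(∫ u, (f u - h u) ^ 2 ∂μ) ≤ e} with hS
  have hmono : Monotone S := by
    intro m n hmn x hx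
    obtain ⟨f, hf, h1, h2⟩ := hx
    refine ⟨f, hf, lt_of_le_of_lt ?_ h1, h2⟩
    gcongr
  have hsub : R ⊆ ⋃ n, S n := by
    intro x hx
    obtain ⟨f, hf, h1, h2⟩ := hw x hx
    obtain ⟨n, hn⟩ := exists_nat_one_div_lt (sub_pos.2 h1)
    refine Set.mem_iUnion.2 ⟨n, f, hf, by linarith, ?_⟩
    rw [hint, he]
    exact Real.sqrt_le_sqrt (by gcongr)
  have hSn : ∀ n, μ (S n) ≤ ENNReal.ofReal (4 * θ * V / γ ^ 2 / p) := by
    intro n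
    have hn : (0 : ℝ) < 1 / ((n : ℝ) + 1) := by positivity
    have h1 := disagreement_le hθ hh μ (g := γ / 2 + 1 / ((n : ℝ) + 1)) (e := e) (by linarith) hepos
    have h2 : ENNReal.ofReal ((γ / 2) ^ 2 / e ^ 2) * μ (S n) ≤ ENNReal.ofReal θ := by
      refine le_trans ?_ h1
      gcongr
      linarith
    have hc : 0 < (γ / 2) ^ 2 / e ^ 2 := by positivity
    have h3 : μ (S n) ≤ ENNReal.ofReal θ / ENNReal.ofReal ((γ / 2) ^ 2 / e ^ 2) :=
      (ENNReal.le_div_iff_mul_le (Or.inl (by simpa using hc)) (Or.inl (by simp))).2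
        (by rwa [mul_comm])
    refine h3.trans ?_
    rw [← ENNReal.ofReal_div_of_pos hc]
    refine ENNReal.ofReal_le_ofReal (le_of_eq ?_)
    rw [he2]
    field_simp
    ring
  have h1 : (1 : ENNReal) ≤ ENNReal.ofReal (4 * θ * V / γ ^ 2 / p) := by
    rw [← hμR]
    refine (measure_mono hsub).trans ?_
    rw [hmono.measure_iUnion]
    exact iSup_le hSn
  have h2 := ENNReal.one_le_ofReal.1 h1
  rwa [one_le_div hpos] at h2

end Disagreement

/-! ### Consequences of uniform concentration -/

section Bounds

variable {X : Type*} {G : Set (X → ℝ)} {x : X}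

lemma bddBelow_eval (hG : ∀ f ∈ G, ∀ x, f x ∈ Set.Icc (0 : ℝ) 1) :
    BddBelow ((fun f : X → ℝ => f x) '' G) :=
  ⟨0, by rintro _ ⟨f, hf, rfl⟩; exact (hG f hf x).1⟩

lemma bddAbove_eval (hG : ∀ f ∈ G, ∀ x, f x ∈ Set.Icc (0 : ℝ) 1) :
    BddAbove ((fun f : X → ℝ => f x) '' G) :=
  ⟨1, by rintro _ ⟨f, hf, rfl⟩; exact (hG f hf x).2⟩

lemma lcb_le (hG : ∀ f ∈ G, ∀ x, f x ∈ Set.Icc (0 : ℝ) 1) {f : X → ℝ} (hf : f ∈ G) :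
    lcb G x ≤ f x :=
  csInf_le (bddBelow_eval hG) ⟨f, hf, rfl⟩

lemma le_ucb (hG : ∀ f ∈ G, ∀ x, f x ∈ Set.Icc (0 : ℝ) 1) {f : X → ℝ} (hf : f ∈ G) :
    f x ≤ ucb G x :=
  le_csSup (bddAbove_eval hG) ⟨f, hf, rfl⟩

lemma lcb_anti {G' : Set (X → ℝ)} (hG : ∀ f ∈ G, ∀ x, f x ∈ Set.Icc (0 : ℝ) 1)
    (hne : G'.Nonempty) (h : G' ⊆ G) : lcb G x ≤ lcb G' x :=
  csInf_le_csInf (bddBelow_eval hG) (hne.image _) (Set.image_mono h)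

lemma ucb_mono {G' : Set (X → ℝ)} (hG : ∀ f ∈ G, ∀ x, f x ∈ Set.Icc (0 : ℝ) 1)
    (hne : G'.Nonempty) (h : G' ⊆ G) : ucb G' x ≤ ucb G x :=
  csSup_le_csSup (bddAbove_eval hG) (hne.image _) (Set.image_mono h)

/-- If the confidence interval contains `1/2` in its interior but is not within `γ` of `1/2`, then
some member of the class is more than `γ/2` away from any given one. -/
lemma exists_far {γ : ℝ} (hG : ∀ f ∈ G, ∀ x, f x ∈ Set.Icc (0 : ℝ) 1) {h : X → ℝ} (hh : h ∈ G)
    (hmem : (1 / 2 : ℝ) ∈ Set.Ioo (lcb G x) (ucb G x))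
    (hsub : ¬ Set.Icc (lcb G x) (ucb G x) ⊆ Set.Icc (1 / 2 - γ) (1 / 2 + γ)) :
    ∃ f ∈ G, γ / 2 < |f x - h x| := by
  have h1 : lcb G x ≤ ucb G x := (lcb_le hG hh).trans (le_ucb hG hh)
  rw [Set.Icc_subset_Icc_iff h1, not_and_or, not_le, not_le] at hsub
  have hwide : γ < ucb G x - lcb G x := by
    rcases hsub with h2 | h2 <;> linarith [hmem.1, hmem.2]
  have hne : ((fun f : X → ℝ => f x) '' G).Nonempty := ⟨h x, h, hh, rfl⟩
  -- The interval is longer than `γ`, so one of its ends is more than `γ / 2` from `h x`; the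
  -- supremum or infimum is then approached by a member of `G`.
  by_cases h3 : h x + γ / 2 < ucb G x
  · obtain ⟨_, ⟨f, hf, rfl⟩, hlt⟩ := exists_lt_of_lt_csSup hne h3
    exact ⟨f, hf, lt_of_lt_of_le (by simp only at hlt; linarith) (le_abs_self _)⟩
  · have h4 : lcb G x < h x - γ / 2 := by linarith
    obtain ⟨_, ⟨f, hf, rfl⟩, hlt⟩ := exists_lt_of_csInf_lt hne h4
    exact ⟨f, hf, lt_of_lt_of_le (by simp only at hlt; linarith) (neg_le_abs _)⟩

end Bounds

end ActiveLearning

namespace ActiveLearning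

/-! ### Deterministic behaviour of the algorithm on the concentration event. -/

section Good

variable {X : Type*} {F : Set (X → ℝ)} {ro : List (X × Bool) → X → ℝ}
  {γ T C θ : ℝ} {h : X → ℝ} {z : ℕ → X × Bool}

/-- The active set of epoch `k + 1` along the stream `z`. -/
def streamActiveSet (F : Set (X → ℝ)) (ro : List (X × Bool) → X → ℝ) (γ T C : ℝ)
    (z : ℕ → X × Bool) (k : ℕ) : Set (X → ℝ) :=
  epochActiveSet F ro T C (k + 1) (queriedData F ro γ T C z k)

/-- The query region of epoch `k + 1` along the stream `z`. -/
def queryRegion (F : Set (X → ℝ)) (ro : List (X × Bool) → X → ℝ) (γ T C : ℝ)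
    (z : ℕ → X × Bool) (k : ℕ) : Set X :=
  {x | epochQuery F ro γ T C (k + 1) (queriedData F ro γ T C z k) x}

/-- Data of `k` epochs are used in epoch `k + 1`, so the radius is `(M - (k + 1) + 1) C = (M - k)
C`. -/
lemma mem_streamActiveSet {k : ℕ} {f : X → ℝ} : f ∈ streamActiveSet F ro γ T C z k ↔
    f ∈ F ∧ sqLoss f (queriedData F ro γ T C z k) ≤
      sqLoss (ro (queriedData F ro γ T C z k)) (queriedData F ro γ T C z k) +
        ((numEpochs T : ℝ) - k) * C := by
  unfold streamActiveSet epochActiveSet activeSet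
  rw [Set.mem_ofPred_eq]
  push_cast
  ring_nf

lemma oracle_mem_streamActiveSet (ho : IsRegressionOracle F ro) (hC : 0 ≤ C) {k : ℕ}
    (hk : k < numEpochs T) :
    ro (queriedData F ro γ T C z k) ∈ streamActiveSet F ro γ T C z k := by
  have hk' : (k : ℝ) ≤ numEpochs T := by exact_mod_cast hk.le
  exact mem_streamActiveSet.2 ⟨(ho _).1, by
    linarith [mul_nonneg (sub_nonneg.2 hk') hC]⟩

lemma queryInd_eq_indicator {t k : ℕ} (ht : epochIndex t = k) (hk : k < numEpochs T) :
    queryInd F ro γ T C t z = (queryRegion F ro γ T C z k).indicator 1 := by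
  funext x
  subst ht
  by_cases hx : x ∈ queryRegion F ro γ T C z (epochIndex t)
  · rw [Set.indicator_of_mem hx, queryInd, if_pos ⟨hk, hx⟩, Pi.one_apply]
  · rw [Set.indicator_of_notMem hx, queryInd, if_neg fun h => hx h.2]

lemma epochIndex_lt {t k : ℕ} (ht : t ∈ Finset.Ioc 0 (epochEnd k)) : epochIndex t < k := by
  rw [Finset.mem_Ioc] at ht
  by_contra! hle
  have h1 := epochEnd_epochIndex_lt ht.1
  have h2 := epochEnd_mono hle
  omega

variable [MeasurableSpace X] {D : Measure (X × Bool)}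

/-- The lower deviations of the queried excess loss along the stream `z` are at most `C / 2`. -/
def UniformlyConcentrated (D : Measure (X × Bool)) (F : Set (X → ℝ))
    (ro : List (X × Bool) → X → ℝ) (γ T C : ℝ) (h : X → ℝ) (z : ℕ → X × Bool) : Prop :=
  ∀ f ∈ F, ∀ a b, b ≤ epochEnd (numEpochs T - 1) →
    (∑ t ∈ Finset.Ioc a b, wdist D (queryInd F ro γ T C t z) f h) / 2 ≤
      ∑ t ∈ Finset.Ioc a b, queryInd F ro γ T C t z (z t).1 * excessLoss f h (z t) + C / 2

lemma streamActiveSet_mem_Icc (hF : ∀ f ∈ F, Measurable f ∧ ∀ x, f x ∈ Set.Icc (0 : ℝ) 1) {k : ℕ} :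
    ∀ f ∈ streamActiveSet F ro γ T C z k, ∀ x, f x ∈ Set.Icc (0 : ℝ) 1 :=
  fun f hf => (hF f (mem_streamActiveSet.1 hf).1).2

lemma epochEnd_le_of_lt {k : ℕ} (hk : k < numEpochs T) : epochEnd k ≤ epochEnd (numEpochs T - 1) :=
  epochEnd_mono (by omega)

lemma sum_wdist_nonneg (a b : ℕ) (f : X → ℝ) :
    0 ≤ ∑ t ∈ Finset.Ioc a b, wdist D (queryInd F ro γ T C t z) f h :=
  Finset.sum_nonneg fun t _ => wdist_nonneg (queryInd_mem t z)

namespace UniformlyConcentrated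

variable (hz : UniformlyConcentrated D F ro γ T C h z)

include hz

lemma sqLoss_le {k : ℕ} (hk : k < numEpochs T) {f : X → ℝ} (hf : f ∈ F) :
    sqLoss h (queriedData F ro γ T C z k) ≤
      sqLoss f (queriedData F ro γ T C z k) + C / 2 := by
  have h1 := hz f hf 0 (epochEnd k) (epochEnd_le_of_lt hk)
  rw [← sqLoss_queriedData_sub z f h hk.le] at h1
  linarith [sum_wdist_nonneg (D := D) (F := F) (ro := ro) (γ := γ) (T := T) (C := C) (h := h)
    (z := z) 0 (epochEnd k) f]

/-- The loss of `h` exceeds the minimum by at most `C / 2`, whereas the radius is never below `C`.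
-/
lemma mem_active (ho : IsRegressionOracle F ro) (hh : h ∈ F) (hC : 0 ≤ C) {k : ℕ}
    (hk : k < numEpochs T) : h ∈ streamActiveSet F ro γ T C z k := by
  refine mem_streamActiveSet.2
    ⟨hh, (hz.sqLoss_le hk (ho (queriedData F ro γ T C z k)).1).trans ?_⟩
  have hk' : (k : ℝ) + 1 ≤ numEpochs T := by exact_mod_cast hk
  nlinarith

lemma sum_wdist_le (ho : IsRegressionOracle F ro) (hh : h ∈ F) {k : ℕ}
    (hk : k < numEpochs T) {f : X → ℝ} (hf : f ∈ streamActiveSet F ro γ T C z k) :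
    ∑ t ∈ Finset.Ioc 0 (epochEnd k), wdist D (queryInd F ro γ T C t z) f h ≤
      (2 * ((numEpochs T : ℝ) - k) + 1) * C := by
  obtain ⟨hfF, hfle⟩ := mem_streamActiveSet.1 hf
  have h1 := hz f hfF 0 (epochEnd k) (epochEnd_le_of_lt hk)
  rw [← sqLoss_queriedData_sub z f h hk.le] at h1
  have h2 := (ho (queriedData F ro γ T C z k)).2 h hh
  linarith

/-- Going back one epoch costs `C / 2` for the excess loss on the dropped window and `C / 2` for
replacing `h` by the earlier minimizer. The radius is larger by exactly `C` one epoch earlier. -/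
lemma active_succ_subset (ho : IsRegressionOracle F ro) {k : ℕ}
    (hk : k + 1 < numEpochs T) (hh : h ∈ F) :
    streamActiveSet F ro γ T C z (k + 1) ⊆ streamActiveSet F ro γ T C z k := by
  intro f hf
  obtain ⟨hfF, hfle⟩ := mem_streamActiveSet.1 hf
  refine mem_streamActiveSet.2 ⟨hfF, ?_⟩
  have h1 := hz f hfF (epochEnd k) (epochEnd (k + 1)) (epochEnd_le_of_lt hk)
  have h0 := sum_wdist_nonneg (D := D) (F := F) (ro := ro) (γ := γ) (T := T) (C := C) (h := h)
    (z := z) (epochEnd k) (epochEnd (k + 1)) f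
  have h2 := sqLoss_queriedData_sub (F := F) (ro := ro) (γ := γ) (C := C) z f h hk.le
  have h3 := sqLoss_queriedData_sub (F := F) (ro := ro) (γ := γ) (C := C) z f h
    (show k ≤ numEpochs T by omega)
  rw [← Finset.sum_Ioc_consecutive _ (Nat.zero_le _) (epochEnd_mono (Nat.le_succ k)), ← h3] at h2
  simp only [Nat.succ_eq_add_one] at h2
  have h4 := hz.sqLoss_le (show k < numEpochs T by omega) (ho (queriedData F ro γ T C z k)).1
  have h5 := (ho (queriedData F ro γ T C z (k + 1))).2 h hh
  push_cast at hfle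
  linarith

lemma active_anti (ho : IsRegressionOracle F ro) (hh : h ∈ F) {j k : ℕ} (hjk : j ≤ k)
    (hk : k < numEpochs T) :
    streamActiveSet F ro γ T C z k ⊆ streamActiveSet F ro γ T C z j := by
  induction k, hjk using Nat.le_induction with
  | base => exact subset_rfl
  | succ k _ ih => exact (hz.active_succ_subset ho hk hh).trans (ih (by omega))

lemma queryRegion_anti (hF : ∀ f ∈ F, Measurable f ∧ ∀ x, f x ∈ Set.Icc (0 : ℝ) 1)
    (ho : IsRegressionOracle F ro) (hh : h ∈ F) (hC : 0 ≤ C) {j k : ℕ} (hjk : j ≤ k)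
    (hk : k < numEpochs T) :
    queryRegion F ro γ T C z k ⊆ queryRegion F ro γ T C z j := by
  intro x hx
  have hsub := hz.active_anti ho hh hjk hk
  have hne : (streamActiveSet F ro γ T C z k).Nonempty := ⟨h, hz.mem_active ho hh hC hk⟩
  have hG := streamActiveSet_mem_Icc (ro := ro) (γ := γ) (T := T) (C := C) (z := z)
    (k := j) hF
  have hl : lcb (streamActiveSet F ro γ T C z j) x ≤ lcb (streamActiveSet F ro γ T C z k) x :=
    lcb_anti hG hne hsub
  have hu : ucb (streamActiveSet F ro γ T C z k) x ≤ ucb (streamActiveSet F ro γ T C z j) x :=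
    ucb_mono hG hne hsub
  obtain ⟨hx1, hx2⟩ := hx
  refine ⟨⟨hl.trans_lt hx1.1, hx1.2.trans_le hu⟩, fun hnone => hx2 ?_⟩
  rw [epochClassifier_eq_none_iff] at hnone ⊢
  exact (Set.Icc_subset_Icc hl hu).trans hnone

lemma exists_far_of_mem_queryRegion (hF : ∀ f ∈ F, Measurable f ∧ ∀ x, f x ∈ Set.Icc (0 : ℝ) 1)
    (ho : IsRegressionOracle F ro) (hh : h ∈ F) (hC : 0 ≤ C) {k : ℕ} (hk : k < numEpochs T)
    {x : X} (hx : x ∈ queryRegion F ro γ T C z k) :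
    ∃ f ∈ streamActiveSet F ro γ T C z k, γ / 2 < |f x - h x| := by
  obtain ⟨hx1, hx2⟩ := hx
  rw [ne_eq, epochClassifier_eq_none_iff] at hx2
  exact exists_far (streamActiveSet_mem_Icc hF) (hz.mem_active ho hh hC hk) hx1 hx2

end UniformlyConcentrated

lemma measurableSet_queryRegion [Nonempty X] (hmb : MeasurableConfidenceBounds F ro)
    (hC : 0 ≤ C) {k : ℕ} (hk : k < numEpochs T) :
    MeasurableSet (queryRegion F ro γ T C z k) := by
  have h1 := measurableSet_epochQuery (γ := γ) hmb
    (measurableList_queriedData (γ := γ) hmb hC hk.le) (radius_nonneg hC hk)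
  exact measurable_prodMk_left h1

namespace UniformlyConcentrated

variable [IsProbabilityMeasure D] (hz : UniformlyConcentrated D F ro γ T C h z)

include hz

/-- The current region lies inside every earlier one, so each past time step contributes at least
the distance measured on the current region. -/
lemma epochEnd_mul_wdist_le [Nonempty X]
    (hF : ∀ f ∈ F, Measurable f ∧ ∀ x, f x ∈ Set.Icc (0 : ℝ) 1)
    (ho : IsRegressionOracle F ro) (hmb : MeasurableConfidenceBounds F ro) (hh : h ∈ F)
    (hC : 0 ≤ C) {k : ℕ} (hk : k < numEpochs T) {f : X → ℝ}
    (hf : f ∈ streamActiveSet F ro γ T C z k) :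
    epochEnd k * wdist D ((queryRegion F ro γ T C z k).indicator 1) f h ≤
      (2 * ((numEpochs T : ℝ) - k) + 1) * C := by
  refine le_trans ?_ (hz.sum_wdist_le ho hh hk hf)
  have hfF := hF f (mem_streamActiveSet.1 hf).1
  have h1 : ∀ t ∈ Finset.Ioc 0 (epochEnd k),
      wdist D ((queryRegion F ro γ T C z k).indicator 1) f h ≤
      wdist D (queryInd F ro γ T C t z) f h := by
    intro t ht
    have hj := epochIndex_lt ht
    rw [queryInd_eq_indicator rfl (hj.trans hk)]
    have hmem : ∀ (R : Set X) (x : X), R.indicator (1 : X → ℝ) x ∈ Set.Icc (0 : ℝ) 1 := by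
      intro R x; by_cases hx : x ∈ R <;> simp [hx]
    have hint : ∀ j < numEpochs T, Integrable (fun x =>
        (queryRegion F ro γ T C z j).indicator (1 : X → ℝ) x * (f x - h x) ^ 2) D.fst :=
      fun j hj => integrable_of_abs_le
        ((measurable_one.indicator (measurableSet_queryRegion hmb hC hj)).mul
          ((hfF.1.sub (hF h hh).1).pow_const 2))
        fun x => abs_mul_sq_le_one (hmem _ x) (hfF.2 x) ((hF h hh).2 x)
    refine integral_mono (hint k hk) (hint _ (hj.trans hk)) fun x => ?_
    refine mul_le_mul_of_nonneg_right ?_ (sq_nonneg _)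
    exact Set.indicator_le_indicator_of_subset (hz.queryRegion_anti hF ho hh hC hj.le hk)
      (fun _ => zero_le_one) x
  calc _ = ∑ t ∈ Finset.Ioc 0 (epochEnd k),
        wdist D ((queryRegion F ro γ T C z k).indicator 1) f h := by
        rw [Finset.sum_const, Nat.card_Ioc, nsmul_eq_mul, Nat.sub_zero]
    _ ≤ _ := Finset.sum_le_sum h1

/-- The query region of an epoch has small probability. -/
lemma epochEnd_mul_measureReal_le [Nonempty X]
    (hF : ∀ f ∈ F, Measurable f ∧ ∀ x, f x ∈ Set.Icc (0 : ℝ) 1)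
    (ho : IsRegressionOracle F ro) (hmb : MeasurableConfidenceBounds F ro) (hh : h ∈ F)
    (hC : 0 < C) (hγ : 0 < γ) (hθ : supDisagreementCoeff F (γ / 2) ≤ ENNReal.ofReal θ) {k : ℕ}
    (hk0 : 0 < k) (hk : k < numEpochs T) :
    epochEnd k * D.fst.real (queryRegion F ro γ T C z k) ≤
      4 * θ * ((2 * ((numEpochs T : ℝ) - k) + 1) * C) / γ ^ 2 := by
  have hk' : (k : ℝ) < numEpochs T := by exact_mod_cast hk
  have he : (0 : ℝ) < epochEnd k := by
    have : epochEnd k = 2 ^ k := by simp [epochEnd, hk0.ne']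
    rw [this]; positivity
  have hB : 0 < (2 * ((numEpochs T : ℝ) - k) + 1) * C := mul_pos (by linarith) hC
  have h1 := measureReal_le_of_disagreement (D := D) hγ hθ hh
    (measurableSet_queryRegion (γ := γ) (z := z) hmb hC.le hk) (div_pos hB he) fun x hx => by
      obtain ⟨f, hf, hfx⟩ := hz.exists_far_of_mem_queryRegion hF ho hh hC.le hk hx
      refine ⟨f, (mem_streamActiveSet.1 hf).1, hfx, ?_⟩
      rw [le_div_iff₀' he]
      exact hz.epochEnd_mul_wdist_le hF ho hmb hh hC.le hk hf
  calc _ ≤ (epochEnd k : ℝ) * (4 * θ * ((2 * ((numEpochs T : ℝ) - k) + 1) * C / epochEnd k) / γ ^ 2) :=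
        mul_le_mul_of_nonneg_left h1 he.le
    _ = _ := by field_simp

end UniformlyConcentrated

end Good

end ActiveLearning

namespace ActiveLearning

/-! ### Excess error of the randomized classifier -/

section ExcessError

variable {X : Type*}

/-- Conditional probability of a mistake of the prediction `b` when `+1` has probability `η`. -/
noncomputable def condRisk (b : Bool) (η : ℝ) : ℝ := labelValue b + (1 - 2 * labelValue b) * η

@[simp] lemma condRisk_true (η : ℝ) : condRisk true η = 1 - η := by simp [condRisk, labelValue]; ring

@[simp] lemma condRisk_false (η : ℝ) : condRisk false η = η := by simp [condRisk, labelValue]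

variable [MeasurableSpace X] {D : Measure (X × Bool)} [IsProbabilityMeasure D]

lemma measurable_condRisk {g : X → Bool} (hg : Measurable g) :
    Measurable fun x => condRisk (g x) (condProb D x) := by
  have hl : Measurable fun x => labelValue (g x) := measurable_labelValue.comp hg
  exact hl.add ((measurable_const.sub (hl.const_mul 2)).mul measurable_condProb)

lemma abs_condRisk_le (b : Bool) (x : X) : |condRisk b (condProb D x)| ≤ 1 := by
  have h := condProb_mem (D := D) x
  rw [abs_le]
  cases b <;> simp <;> constructor <;> linarith [h.1, h.2]

lemma err_eq_integral {g : X → Bool} (hg : Measurable g) :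
    err D g = ∫ x, condRisk (g x) (condProb D x) ∂D.fst := by
  have hl : Measurable fun x => labelValue (g x) := measurable_labelValue.comp hg
  have hlb : ∀ x, |labelValue (g x)| ≤ 1 := fun x => by
    have := labelValue_mem (g x)
    rw [abs_of_nonneg this.1]; exact this.2
  have hm : Measurable fun x => 1 - 2 * labelValue (g x) := measurable_const.sub (hl.const_mul 2)
  have hmb : ∀ x, |1 - 2 * labelValue (g x)| ≤ 1 := fun x => by
    have := labelValue_mem (g x)
    rw [abs_le]; constructor <;> linarith [this.1, this.2]
  have hS : MeasurableSet {p : X × Bool | g p.1 ≠ p.2} :=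
    (measurableSet_eq_fun (hg.comp measurable_fst) measurable_snd).compl
  have hi1 : Integrable (fun p : X × Bool => labelValue (g p.1)) D :=
    integrable_of_abs_le (hl.comp measurable_fst) fun p => hlb p.1
  have hi2 : Integrable (fun p : X × Bool => (1 - 2 * labelValue (g p.1)) * labelValue p.2) D := by
    refine integrable_of_abs_le ((hm.comp measurable_fst).mul
      (measurable_labelValue.comp measurable_snd)) (c := 1) fun p => ?_
    have hl := labelValue_mem p.2
    rw [abs_mul, abs_of_nonneg hl.1]
    exact mul_le_one₀ (hmb p.1) hl.1 hl.2
  have hi3 : Integrable (fun x => (1 - 2 * labelValue (g x)) * condProb D x) D.fst := by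
    refine integrable_of_abs_le (hm.mul measurable_condProb) (c := 1) fun x => ?_
    have hl := condProb_mem (D := D) x
    rw [abs_mul, abs_of_nonneg hl.1]
    exact mul_le_one₀ (hmb x) hl.1 hl.2
  unfold err condRisk
  rw [← integral_indicator_one hS, integral_add (integrable_of_abs_le hl hlb) hi3,
    ← integral_mul_labelValue hm hmb, ← integral_fst hl, ← integral_add hi1 hi2]
  refine integral_congr_ae (ae_of_all _ fun p => ?_)
  rcases p with ⟨x, y⟩
  cases hgx : g x <;> cases y <;> simp [hgx, labelValue]
  norm_num

lemma integrable_condRisk {g : X → Bool} (hg : Measurable g) :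
    Integrable (fun x => condRisk (g x) (condProb D x)) D.fst :=
  integrable_of_abs_le (measurable_condRisk hg) fun x => abs_condRisk_le (g x) x

instance : IsProbabilityMeasure fairCoin := by
  unfold fairCoin; infer_instance

lemma measurable_bayes : Measurable (bayes D) := by
  refine measurable_to_bool ?_
  have : bayes D ⁻¹' {true} = {x | 1 / 2 ≤ condProb D x} := by
    ext x; simp [bayes]
  rw [this]
  exact measurableSet_le measurable_const measurable_condProb

lemma prod_fairCoin_real {S : Set ((X × Bool) × Bool)} (hS : MeasurableSet S) :
    (D.prod fairCoin).real S =
      (D.real {p | (p, true) ∈ S} + D.real {p | (p, false) ∈ S}) / 2 := by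
  have hc : ∀ b, fairCoin {b} = 2⁻¹ := by
    intro b
    rw [fairCoin, PMF.toMeasure_apply_singleton _ _ (measurableSet_singleton b)]
    simp
  have h1 : (D.prod fairCoin) S = D {p | (p, true) ∈ S} * 2⁻¹ + D {p | (p, false) ∈ S} * 2⁻¹ := by
    rw [Measure.prod_apply_symm hS, lintegral_fintype, Fintype.sum_bool, hc, hc]
    rfl
  rw [Measure.real, h1, ENNReal.toReal_add (by finiteness) (by finiteness), ENNReal.toReal_mul,
    ENNReal.toReal_mul]
  simp [Measure.real]
  ring

/-- A fair coin has conditional risk `1 / 2`, so abstaining exceeds the Bayes risk by exactly the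
margin `|condProb D x - 1 / 2|`. -/
lemma randExcessErr_le {g : X → Option Bool} (hg : ∀ b, Measurable fun x => (g x).getD b)
    {B : X → ℝ} (hB : Integrable B D.fst)
    (hnone : ∀ᵐ x ∂D.fst, g x = none → |condProb D x - 1 / 2| ≤ B x)
    (hsome : ∀ᵐ x ∂D.fst, ∀ b, g x = some b →
      condRisk b (condProb D x) - condRisk (bayes D x) (condProb D x) ≤ B x) :
    randExcessErr D g ≤ ∫ x, B x ∂D.fst := by
  have hS : MeasurableSet {p : (X × Bool) × Bool | randomize g p.2 p.1.1 ≠ p.1.2} := by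
    have hr : Measurable fun p : (X × Bool) × Bool => randomize g p.2 p.1.1 := by
      have : (fun p : (X × Bool) × Bool => randomize g p.2 p.1.1) = fun p =>
          if p.2 = true then (g p.1.1).getD true else (g p.1.1).getD false := by
        funext p
        rcases p with ⟨p, b⟩
        cases b <;> simp [randomize]
      rw [this]
      exact Measurable.ite (measurable_snd (measurableSet_singleton true))
        ((hg true).comp (measurable_fst.comp measurable_fst))
        ((hg false).comp (measurable_fst.comp measurable_fst))
    exact (measurableSet_eq_fun hr (measurable_snd.comp measurable_fst)).compl
  have h1 : randExcessErr D g = (err D (fun x => (g x).getD true) +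
      err D (fun x => (g x).getD false)) / 2 - err D (bayes D) := by
    rw [randExcessErr, prod_fairCoin_real hS]
    rfl
  have hi : ∀ b, Integrable (fun x => condRisk ((g x).getD b) (condProb D x)) D.fst :=
    fun b => integrable_condRisk (hg b)
  have hib : Integrable (fun x => condRisk (bayes D x) (condProb D x)) D.fst :=
    integrable_condRisk measurable_bayes
  have his : Integrable (fun x => (condRisk ((g x).getD true) (condProb D x) +
      condRisk ((g x).getD false) (condProb D x)) / 2) D.fst :=
    ((hi true).add (hi false)).div_const 2
  rw [h1, err_eq_integral (hg true), err_eq_integral (hg false), err_eq_integral measurable_bayes,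
    ← integral_add (hi true) (hi false), ← integral_div,
    ← integral_sub his hib]
  refine integral_mono_ae (his.sub hib) hB ?_
  filter_upwards [hnone, hsome] with x h2 h3
  cases hgx : g x with
  | none =>
    refine le_trans (le_of_eq ?_) (h2 hgx)
    simp only [Option.getD_none, condRisk_true, condRisk_false]
    by_cases hη : 1 / 2 ≤ condProb D x
    · have : bayes D x = true := by simpa [bayes] using hη
      rw [this, condRisk_true, abs_of_nonneg (by linarith)]
      ring
    · have : bayes D x = false := by simpa [bayes] using hη
      rw [this, condRisk_false, abs_of_neg (by linarith)]
      ring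
  | some b =>
    refine le_trans (le_of_eq ?_) (h3 b hgx)
    simp only [Option.getD_some]
    ring

end ExcessError

/-! ### Excess error of the returned classifier. -/

section Output

variable {X : Type*} {F : Set (X → ℝ)} {ro : List (X × Bool) → X → ℝ}
  {γ T C θ : ℝ} {h : X → ℝ} {z : ℕ → X × Bool}

/-- Excess conditional risk of a prediction of the epoch classifier. -/
lemma condRisk_sub_le_of_epochClassifier (hF : ∀ f ∈ F, ∀ x, f x ∈ Set.Icc (0 : ℝ) 1)
    {m : ℕ} {S : List (X × Bool)} {x : X} {b c : Bool}
    (hh : h ∈ epochActiveSet F ro T C m S) (ho : ro S ∈ epochActiveSet F ro T C m S)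
    (hb : epochClassifier F ro γ T C m S x = some b) (hc : c = true ↔ 1 / 2 ≤ h x) :
    condRisk b (h x) - condRisk c (h x) ≤
      Set.indicator {x | epochQuery F ro γ T C m S x} (fun x => 2 * |ro S x - h x|) x := by
  set G := epochActiveSet F ro T C m S with hGdef
  have hG : ∀ f ∈ G, ∀ x, f x ∈ Set.Icc (0 : ℝ) 1 := fun f hf => hF f hf.1
  have h1 := lcb_le (x := x) hG hh
  have h2 := le_ucb (x := x) hG hh
  have h3 := lcb_le (x := x) hG ho
  have h4 := le_ucb (x := x) hG ho
  have hnn : epochClassifier F ro γ T C m S x ≠ none := by rw [hb]; simp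
  have hsub : ¬ Set.Icc (lcb G x) (ucb G x) ⊆ Set.Icc (1 / 2 - γ) (1 / 2 + γ) :=
    fun hs => hnn (epochClassifier_eq_none_iff.2 hs)
  have hbt : b = true ↔ (1 / 2 < ro S x ∨ (ro S x = 1 / 2 ∧ 1 / 2 < ucb G x)) := by
    unfold epochClassifier at hb
    simp only at hb
    rw [if_neg hsub, Option.some_inj] at hb
    rw [← hb]
    simp [hGdef]
  have hQ : (1 / 2 : ℝ) ∈ Set.Ioo (lcb G x) (ucb G x) → x ∈ {x | epochQuery F ro γ T C m S x} :=
    fun hmem => ⟨hmem, hnn⟩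
  have hpos : 0 ≤ Set.indicator {x | epochQuery F ro γ T C m S x}
      (fun x => 2 * |ro S x - h x|) x :=
    Set.indicator_nonneg (fun _ _ => by positivity) x
  cases b <;> cases c
  · simpa using hpos
  · have ho1 : ro S x ≤ 1 / 2 := by
      by_contra! hlt
      exact Bool.false_ne_true (hbt.2 (Or.inl hlt))
    have hh1 := hc.1 rfl
    simp only [condRisk_true, condRisk_false]
    by_cases hmem : (1 / 2 : ℝ) ∈ Set.Ioo (lcb G x) (ucb G x)
    · rw [Set.indicator_of_mem (hQ hmem)]
      linarith [neg_le_abs (ro S x - h x)]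
    -- Otherwise the whole confidence interval would lie at or above `1 / 2`, the fitted value would
    -- be a tie, and the tie rule would predict `+1`.
    · have hle : h x ≤ 1 / 2 := by
        by_contra! hlt
        have hu : 1 / 2 < ucb G x := hlt.trans_le h2
        have hl : 1 / 2 ≤ lcb G x := by
          by_contra! hl
          exact hmem ⟨hl, hu⟩
        have : ro S x = 1 / 2 := le_antisymm ho1 (hl.trans h3)
        exact Bool.false_ne_true (hbt.2 (Or.inr ⟨this, hu⟩))
      linarith
  · have ho1 : 1 / 2 ≤ ro S x := by
      rcases hbt.1 rfl with h5 | h5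
      · exact h5.le
      · exact h5.1.ge
    have hu : 1 / 2 < ucb G x := by
      rcases hbt.1 rfl with h5 | h5
      · exact h5.trans_le h4
      · exact h5.2
    have hh1 : h x < 1 / 2 := by
      by_contra! hle
      exact Bool.false_ne_true (hc.2 hle)
    simp only [condRisk_true, condRisk_false]
    rw [Set.indicator_of_mem (hQ ⟨h1.trans_lt hh1, hu⟩)]
    linarith [le_abs_self (ro S x - h x)]
  · simpa using hpos

variable [MeasurableSpace X] {D : Measure (X × Bool)} [IsProbabilityMeasure D]

lemma measurable_epochClassifier_getD (hF : ∀ f ∈ F, Measurable f ∧ ∀ x, f x ∈ Set.Icc (0 : ℝ) 1)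
    (ho : IsRegressionOracle F ro) (hmb : MeasurableConfidenceBounds F ro) {m : ℕ}
    (hr : 0 ≤ ((numEpochs T : ℝ) - m + 1) * C) (S : List (X × Bool)) (b : Bool) :
    Measurable fun x => (epochClassifier F ro γ T C m S x).getD b := by
  classical
  obtain ⟨n, v, hv⟩ : ∃ n, ∃ v : Fin n → X × Bool, S = List.ofFn v :=
    ⟨_, S.get, (List.ofFn_get S).symm⟩
  have hpair : Measurable fun x : X => (v, x) := measurable_prodMk_left
  have hl : Measurable fun x => lcb (epochActiveSet F ro T C m S) x := by
    rw [hv]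
    have h1 : Measurable ((fun p : (Fin n → X × Bool) × X => lcb (activeSet F ro
        (((numEpochs T : ℝ) - m + 1) * C) (List.ofFn p.1)) p.2) ∘ fun x => (v, x)) :=
      (hmb n _ hr).1.comp hpair
    simpa only [epochActiveSet, Function.comp_def] using h1
  have hu : Measurable fun x => ucb (epochActiveSet F ro T C m S) x := by
    rw [hv]
    have h1 : Measurable ((fun p : (Fin n → X × Bool) × X => ucb (activeSet F ro
        (((numEpochs T : ℝ) - m + 1) * C) (List.ofFn p.1)) p.2) ∘ fun x => (v, x)) :=
      (hmb n _ hr).2.comp hpair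
    simpa only [epochActiveSet, Function.comp_def] using h1
  have hf : Measurable (ro S) := (hF _ (ho S).1).1
  have h1 : Measurable fun x => decide (1 / 2 < ro S x ∨ (ro S x = 1 / 2 ∧
      1 / 2 < ucb (epochActiveSet F ro T C m S) x)) := by
    refine measurable_to_bool ?_
    have : (fun x => decide (1 / 2 < ro S x ∨ (ro S x = 1 / 2 ∧
      1 / 2 < ucb (epochActiveSet F ro T C m S) x))) ⁻¹' {true} =
      {x | 1 / 2 < ro S x} ∪ ({x | ro S x = 1 / 2} ∩
        {x | 1 / 2 < ucb (epochActiveSet F ro T C m S) x}) := by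
      ext x; simp
    rw [this]
    exact (measurableSet_lt measurable_const hf).union
      ((measurableSet_eq_fun hf measurable_const).inter (measurableSet_lt measurable_const hu))
  have h2 : (fun x => (epochClassifier F ro γ T C m S x).getD b) = fun x =>
      if Set.Icc (lcb (epochActiveSet F ro T C m S) x)
        (ucb (epochActiveSet F ro T C m S) x) ⊆ Set.Icc (1 / 2 - γ) (1 / 2 + γ) then b
      else decide (1 / 2 < ro S x ∨ (ro S x = 1 / 2 ∧
        1 / 2 < ucb (epochActiveSet F ro T C m S) x)) := by
    funext x
    unfold epochClassifier
    simp only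
    split_ifs <;> simp
  rw [h2]
  exact Measurable.ite (measurableSet_Icc_subset hl hu _ _) measurable_const h1

/-- Excess error of the output in terms of the mass near `1/2`. -/
lemma UniformlyConcentrated.randExcessErr_output_le [Nonempty X]
    (hz : UniformlyConcentrated D F ro γ T C h z)
    (hF : ∀ f ∈ F, Measurable f ∧ ∀ x, f x ∈ Set.Icc (0 : ℝ) 1)
    (ho : IsRegressionOracle F ro) (hmb : MeasurableConfidenceBounds F ro) (hh : h ∈ F)
    (heq : h =ᵐ[D.fst] condProb D)
    (hC : 0 < C) (hγ : 0 < γ) (hθ : supDisagreementCoeff F (γ / 2) ≤ ENNReal.ofReal θ)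
    (hM : 2 ≤ numEpochs T) :
    randExcessErr D (output F ro γ T C z) ≤
      ∫ x, Set.indicator {x | |condProb D x - 1 / 2| ≤ γ} (fun x => |condProb D x - 1 / 2|) x ∂D.fst +
        15 * θ * C / (γ * epochEnd (numEpochs T - 1)) := by
  have hθ1 := one_le_of_supDisagreementCoeff_le ⟨h, hh⟩ hθ
  obtain ⟨k, hk⟩ : ∃ k, numEpochs T = k + 1 := ⟨numEpochs T - 1, by omega⟩
  have hkM : numEpochs T - 1 = k := by omega
  have hklt : k < numEpochs T := by omega
  have hk0 : 0 < k := by omega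
  set S := queriedData F ro γ T C z k with hS
  have hout : output F ro γ T C z = epochClassifier F ro γ T C (k + 1) S := by
    unfold output; rw [hkM, hk]
  rw [hout, hkM]
  set R := queryRegion F ro γ T C z k with hR
  have hRm : MeasurableSet R := measurableSet_queryRegion hmb hC.le hklt
  have hhA : h ∈ streamActiveSet F ro γ T C z k := hz.mem_active ho hh hC.le hklt
  have hoA : ro S ∈ streamActiveSet F ro γ T C z k :=
    oracle_mem_streamActiveSet ho hC.le hklt
  have hfm := (hF _ (ho S).1).1
  have hfb := (hF _ (ho S).1).2
  have hhm := (hF h hh).1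
  have hhb := (hF h hh).2
  -- `B₁` pays for abstention, which forces a margin at most `γ` since `h` is active; `B₂` pays for
  -- wrong predictions, which cost nothing outside the query region.
  set B₁ : X → ℝ := Set.indicator {x | |condProb D x - 1 / 2| ≤ γ} fun x => |condProb D x - 1 / 2|
  set B₂ : X → ℝ := R.indicator fun x => 2 * |ro S x - h x|
  have hηm : Measurable fun x => |condProb D x - 1 / 2| := (measurable_condProb.sub_const _).abs
  have hB₁ : Integrable B₁ D.fst := by
    refine Integrable.indicator (integrable_of_abs_le hηm (c := 1) fun x => ?_)
      (measurableSet_le hηm measurable_const)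
    have := condProb_mem (D := D) x
    rw [abs_abs, abs_le]
    constructor <;> linarith [this.1, this.2]
  have hdb : ∀ x, |ro S x - h x| ≤ 1 := fun x => by
    rw [abs_le]; constructor <;> linarith [(hfb x).1, (hfb x).2, (hhb x).1, (hhb x).2]
  have hB₂ : Integrable B₂ D.fst := by
    refine Integrable.indicator (Integrable.const_mul (integrable_of_abs_le (hfm.sub hhm).abs
      (c := 1) fun x => ?_) 2) hRm
    rw [abs_abs]
    exact hdb x
  have hR1 : Integrable (R.indicator (1 : X → ℝ)) D.fst :=
    (integrable_const (1 : ℝ)).indicator hRm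
  have hR2 : Integrable (fun x => R.indicator (1 : X → ℝ) x * (ro S x - h x) ^ 2) D.fst :=
    integrable_of_abs_le ((measurable_one.indicator hRm).mul ((hfm.sub hhm).pow_const 2))
      fun x => abs_mul_sq_le_one (by by_cases hx : x ∈ R <;> simp [hx]) (hfb x) (hhb x)
  have hB₂int : ∫ x, B₂ x ∂D.fst ≤
      1 / γ * wdist D (R.indicator 1) (ro S) h + γ * D.fst.real R := by
    -- The inequality `2 a ≤ a² / γ + γ` trades the absolute error for the squared distance and the
    -- mass of the region, both of which are small.
    have h1 : ∀ x, B₂ x ≤ 1 / γ * (R.indicator (1 : X → ℝ) x * (ro S x - h x) ^ 2) +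
        γ * R.indicator (1 : X → ℝ) x := by
      intro x
      by_cases hx : x ∈ R
      · simp only [B₂, Set.indicator_of_mem hx, Pi.one_apply, one_mul, mul_one]
        rw [← sq_abs]
        have h2 := sq_nonneg (|ro S x - h x| - γ)
        rw [one_div, inv_mul_eq_div, div_add' _ _ _ hγ.ne', le_div_iff₀ hγ]
        nlinarith
      · simp [B₂, hx]
    calc ∫ x, B₂ x ∂D.fst ≤ ∫ x, (1 / γ * (R.indicator (1 : X → ℝ) x * (ro S x - h x) ^ 2) +
          γ * R.indicator (1 : X → ℝ) x) ∂D.fst :=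
          integral_mono hB₂ ((hR2.const_mul _).add (hR1.const_mul _)) h1
      _ = _ := by
        rw [integral_add (hR2.const_mul _) (hR1.const_mul _), integral_const_mul,
          integral_const_mul, integral_indicator_one hRm]
        rfl
  have hbayes : ∀ x, h x = condProb D x → (bayes D x = true ↔ 1 / 2 ≤ h x) := by
    intro x hx
    rw [hx]
    simp [bayes]
  have hmain : randExcessErr D (epochClassifier F ro γ T C (k + 1) S) ≤
      ∫ x, (B₁ x + B₂ x) ∂D.fst := by
    refine randExcessErr_le (measurable_epochClassifier_getD hF ho hmb
      (radius_nonneg hC.le hklt) S) (hB₁.add hB₂) ?_ ?_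
    · filter_upwards [heq] with x hx hnone
      have h2 : 0 ≤ B₂ x := Set.indicator_nonneg (fun _ _ => by positivity) x
      rw [epochClassifier_eq_none_iff] at hnone
      have hmem := hnone ⟨lcb_le (streamActiveSet_mem_Icc hF) hhA,
        le_ucb (streamActiveSet_mem_Icc hF) hhA⟩
      rw [hx] at hmem
      have h3 : |condProb D x - 1 / 2| ≤ γ := by
        rw [abs_le]; constructor <;> linarith [hmem.1, hmem.2]
      have h4 : B₁ x = |condProb D x - 1 / 2| := Set.indicator_of_mem (by exact h3) _
      rw [h4]
      linarith
    · filter_upwards [heq] with x hx b hb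
      have h1 : 0 ≤ B₁ x := Set.indicator_nonneg (fun _ _ => by positivity) x
      have h2 := condRisk_sub_le_of_epochClassifier (fun f hf => (hF f hf).2) hhA hoA hb
        (hbayes x hx)
      rw [hx] at h2
      refine h2.trans ?_
      exact le_add_of_nonneg_left h1
  rw [integral_add hB₁ hB₂] at hmain
  refine hmain.trans (add_le_add le_rfl (hB₂int.trans ?_))
  have he : (0 : ℝ) < epochEnd k := by
    have : epochEnd k = 2 ^ k := by simp [epochEnd, hk0.ne']
    rw [this]; positivity
  have h1 := hz.epochEnd_mul_wdist_le hF ho hmb hh hC.le hklt hoA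
  have h2 := hz.epochEnd_mul_measureReal_le hF ho hmb hh hC hγ hθ hk0 hklt
  -- In the last epoch the distance budget is only `3 C`; this is why the error bound carries no
  -- factor `M`.
  have hMk : (numEpochs T : ℝ) - k = 1 := by rw [hk]; push_cast; ring
  rw [hMk] at h1 h2
  norm_num at h1 h2
  have h3 : wdist D (R.indicator 1) (ro S) h ≤ 3 * C / epochEnd k := by
    rwa [le_div_iff₀' he]
  have h4 : D.fst.real R ≤ 4 * θ * (3 * C) / γ ^ 2 / epochEnd k := by
    rwa [le_div_iff₀' he]
  calc 1 / γ * wdist D (R.indicator 1) (ro S) h + γ * D.fst.real R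
      ≤ 1 / γ * (3 * C / epochEnd k) + γ * (4 * θ * (3 * C) / γ ^ 2 / epochEnd k) := by
        gcongr
    _ = (3 + 12 * θ) * C / (γ * epochEnd k) := by field_simp; ring
    _ ≤ 15 * θ * C / (γ * epochEnd k) := by
        gcongr
        linarith

end Output

end ActiveLearning

namespace ActiveLearning

/-! ### Noise conditions -/

section Noise

variable {X : Type*} [MeasurableSpace X] {D : Measure (X × Bool)} [IsProbabilityMeasure D]

/-- Mean margin on the region where the margin is at most `γ`. -/
noncomputable def smallMargin (D : Measure (X × Bool)) [IsFiniteMeasure D] (γ : ℝ) : ℝ :=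
  ∫ x, Set.indicator {x | |condProb D x - 1 / 2| ≤ γ} (fun x => |condProb D x - 1 / 2|) x ∂D.fst

lemma integrable_smallMargin (γ : ℝ) : Integrable (Set.indicator {x | |condProb D x - 1 / 2| ≤ γ}
    (fun x => |condProb D x - 1 / 2|)) D.fst := by
  have hηm : Measurable fun x => |condProb D x - 1 / 2| := (measurable_condProb.sub_const _).abs
  refine Integrable.indicator (integrable_of_abs_le hηm (c := 1) fun x => ?_)
    (measurableSet_le hηm measurable_const)
  have := condProb_mem (D := D) x
  rw [abs_abs, abs_le]
  constructor <;> linarith [this.1, this.2]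

/-- Margins up to `ζ` contribute at most `ζ` in the mean; the remaining ones contribute at most `γ`
times their probability. -/
lemma smallMargin_le_add {ζ γ : ℝ} (hζ : 0 ≤ ζ) (hγ : 0 ≤ γ) : smallMargin D γ ≤
    ζ + γ * D.fst.real {x | ζ < |condProb D x - 1 / 2| ∧ |condProb D x - 1 / 2| ≤ γ} := by
  set S := {x | ζ < |condProb D x - 1 / 2| ∧ |condProb D x - 1 / 2| ≤ γ} with hSdef
  have hηm : Measurable fun x => |condProb D x - 1 / 2| := (measurable_condProb.sub_const _).abs
  have hS : MeasurableSet S :=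
    (measurableSet_lt measurable_const hηm).inter (measurableSet_le hηm measurable_const)
  have hi : Integrable (S.indicator (1 : X → ℝ)) D.fst := (integrable_const (1 : ℝ)).indicator hS
  calc smallMargin D γ ≤ ∫ x, (ζ + γ * S.indicator (1 : X → ℝ) x) ∂D.fst := by
        refine integral_mono (integrable_smallMargin γ) ((integrable_const _).add (hi.const_mul _))
          fun x => ?_
        by_cases h1 : |condProb D x - 1 / 2| ≤ γ
        · rw [Set.indicator_of_mem (by exact h1)]
          by_cases h2 : ζ < |condProb D x - 1 / 2|
          · have : x ∈ S := ⟨h2, h1⟩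
            simp only [Set.indicator_of_mem this, Pi.one_apply]
            linarith
          · have : 0 ≤ γ * S.indicator (1 : X → ℝ) x :=
              mul_nonneg hγ (Set.indicator_nonneg (fun _ _ => zero_le_one) x)
            simp only
            linarith
        · rw [Set.indicator_of_notMem (by exact h1)]
          have : 0 ≤ γ * S.indicator (1 : X → ℝ) x :=
            mul_nonneg hγ (Set.indicator_nonneg (fun _ _ => zero_le_one) x)
          linarith
    _ = _ := by
        rw [integral_add (integrable_const _) (hi.const_mul _), integral_const_mul,
          integral_indicator_one hS]
        simp

lemma NoiseSeekingMassart.smallMargin_le {ζ₀ τ₀ γ : ℝ} (h : NoiseSeekingMassart D ζ₀ τ₀)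
    (hγ : 0 ≤ γ) (hγτ : γ ≤ τ₀) : smallMargin D γ ≤ ζ₀ := by
  refine (smallMargin_le_add h.1 hγ).trans ?_
  have h0 : D.fst {x | ζ₀ < |condProb D x - 1 / 2| ∧ |condProb D x - 1 / 2| ≤ γ} = 0 :=
    measure_mono_null (fun x hx => And.intro hx.1 (hx.2.trans hγτ)) h.2.2.2
  rw [Measure.real, h0]
  simp

lemma NoiseSeekingTsybakov.smallMargin_le {ζ₀ β c γ : ℝ} (h : NoiseSeekingTsybakov D ζ₀ β c)
    (hγ : 0 < γ) : smallMargin D γ ≤ ζ₀ + c * γ ^ (1 + β) := by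
  refine (smallMargin_le_add h.1 hγ.le).trans ?_
  obtain ⟨h0, -, hβ, hc, hT⟩ := h
  have hpos : 0 ≤ c * γ ^ (1 + β) := by positivity
  rcases lt_or_ge ζ₀ γ with hlt | hge
  · have h1 := mul_le_mul_of_nonneg_left (hT γ hlt) hγ.le
    have h2 : γ * (c * γ ^ β) = c * γ ^ (1 + β) := by
      rw [Real.rpow_add hγ, Real.rpow_one]; ring
    linarith
  · have : {x | ζ₀ < |condProb D x - 1 / 2| ∧ |condProb D x - 1 / 2| ≤ γ} = ∅ := by
      ext x
      simp only [Set.mem_ofPred_eq, Set.mem_empty_iff_false, iff_false, not_and, not_le]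
      intro hx
      linarith
    rw [this]
    simpa using hpos

end Noise

/-! ### Number of queried labels -/

section Labels

lemma epochEnd_of_pos {k : ℕ} (hk : 0 < k) : epochEnd k = 2 ^ k := by simp [epochEnd, hk.ne']

variable {X : Type*} [MeasurableSpace X] {F : Set (X → ℝ)}
  {ro : List (X × Bool) → X → ℝ} {γ T C θ : ℝ} {D : Measure (X × Bool)}
  [IsProbabilityMeasure D] {h : X → ℝ} {z : ℕ → X × Bool}

/-- After the first, an epoch is as long as all preceding ones together, so its mean number of
queries is the product bounded in `epochEnd_mul_measureReal_le`. The estimate `2 (M - n) + 1 ≤ 3 (M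
- j)` makes it the same for all epochs. -/
lemma UniformlyConcentrated.sum_integral_queryInd_le [Nonempty X]
    (hz : UniformlyConcentrated D F ro γ T C h z)
    (hF : ∀ f ∈ F, Measurable f ∧ ∀ x, f x ∈ Set.Icc (0 : ℝ) 1)
    (ho : IsRegressionOracle F ro) (hmb : MeasurableConfidenceBounds F ro) (hh : h ∈ F)
    (hC : 0 < C) (hγ : 0 < γ) (hθ : supDisagreementCoeff F (γ / 2) ≤ ENNReal.ofReal θ) {j : ℕ}
    (hj : 0 < j) {n : ℕ} (hjn : j ≤ n) (hn : n < numEpochs T) :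
    ∑ t ∈ Finset.Ioc (epochEnd j) (epochEnd n), ∫ p, queryInd F ro γ T C t z p.1 ∂D ≤
      ((n : ℝ) - j) * (12 * θ * ((numEpochs T : ℝ) - j) * C / γ ^ 2) := by
  have hθ1 := one_le_of_supDisagreementCoeff_le ⟨h, hh⟩ hθ
  induction n, hjn using Nat.le_induction with
  | base => simp
  | succ n hjn ih =>
    have hn' : n < numEpochs T := by omega
    rw [← Finset.sum_Ioc_consecutive _ (epochEnd_mono hjn) (epochEnd_mono (Nat.le_succ n))]
    have h1 := ih hn'
    have hRm : MeasurableSet (queryRegion F ro γ T C z n) := measurableSet_queryRegion hmb hC.le hn'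
    have h2 : ∑ t ∈ Finset.Ioc (epochEnd n) (epochEnd (n + 1)),
        ∫ p, queryInd F ro γ T C t z p.1 ∂D =
        epochEnd n * D.fst.real (queryRegion F ro γ T C z n) := by
      have h3 : ∀ t ∈ Finset.Ioc (epochEnd n) (epochEnd (n + 1)),
          ∫ p, queryInd F ro γ T C t z p.1 ∂D =
          D.fst.real (queryRegion F ro γ T C z n) := by
        intro t ht
        rw [queryInd_eq_indicator (epochIndex_eq ht) hn',
          integral_fst (measurable_one.indicator hRm), integral_indicator_one hRm]
      rw [Finset.sum_congr rfl h3, Finset.sum_const, Nat.card_Ioc, nsmul_eq_mul,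
        epochEnd_of_pos (by omega), epochEnd_of_pos (by omega), pow_succ,
        show 2 ^ n * 2 - 2 ^ n = 2 ^ n by omega]
    have h4 := hz.epochEnd_mul_measureReal_le hF ho hmb hh hC hγ hθ (by omega : 0 < n) hn'
    have h5 : 4 * θ * ((2 * ((numEpochs T : ℝ) - n) + 1) * C) / γ ^ 2 ≤
        12 * θ * ((numEpochs T : ℝ) - j) * C / γ ^ 2 := by
      have h6 : (j : ℝ) ≤ n := by exact_mod_cast hjn
      have h7 : (n : ℝ) + 1 ≤ numEpochs T := by exact_mod_cast hn'
      have h8 : (2 * ((numEpochs T : ℝ) - n) + 1) * C ≤ 3 * ((numEpochs T : ℝ) - j) * C :=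
        mul_le_mul_of_nonneg_right (by linarith) hC.le
      refine div_le_div_of_nonneg_right ?_ (by positivity)
      have h9 := mul_le_mul_of_nonneg_left h8 (by linarith : 0 ≤ 4 * θ)
      linarith
    simp only [Nat.succ_eq_add_one]
    push_cast
    linarith

/-- The first `2 ^ j` steps are charged one label each; later labels are at most twice their
conditional means plus the deviation `u`. The cut `j` is free, so the number of epochs summed need
not be `M`. -/
lemma labelCount_le [Nonempty X] (hz : UniformlyConcentrated D F ro γ T C h z)
    (hF : ∀ f ∈ F, Measurable f ∧ ∀ x, f x ∈ Set.Icc (0 : ℝ) 1)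
    (ho : IsRegressionOracle F ro) (hmb : MeasurableConfidenceBounds F ro) (hh : h ∈ F)
    (hC : 0 < C) (hγ : 0 < γ) (hθ : supDisagreementCoeff F (γ / 2) ≤ ENNReal.ofReal θ) {j : ℕ}
    (hj : 0 < j) (hjM : j < numEpochs T) {u : ℝ}
    (hu : ∑ t ∈ Finset.Ioc (epochEnd j) (epochEnd (numEpochs T - 1)),
      (queryInd F ro γ T C t z (z t).1 - 2 * ∫ p, queryInd F ro γ T C t z p.1 ∂D) ≤ u) :
    (labelCount F ro γ T C z : ℝ) ≤
      2 ^ j + 24 * θ * ((numEpochs T : ℝ) - j) ^ 2 * C / γ ^ 2 + u := by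
  have hθ1 := one_le_of_supDisagreementCoeff_le ⟨h, hh⟩ hθ
  unfold labelCount
  rw [length_queriedData z (Nat.sub_le _ _), ← Finset.sum_Ioc_consecutive _ (Nat.zero_le _)
    (epochEnd_mono (show j ≤ numEpochs T - 1 by omega))]
  have h1 : ∑ t ∈ Finset.Ioc 0 (epochEnd j), queryInd F ro γ T C t z (z t).1 ≤ 2 ^ j := by
    calc _ ≤ ∑ t ∈ Finset.Ioc 0 (epochEnd j), (1 : ℝ) :=
          Finset.sum_le_sum fun t _ => (queryInd_mem t z _).2
      _ = 2 ^ j := by simp [epochEnd_of_pos hj]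
  have h2 := hz.sum_integral_queryInd_le hF ho hmb hh hC hγ hθ hj
    (show j ≤ numEpochs T - 1 by omega) (by omega)
  rw [Finset.sum_sub_distrib, ← Finset.mul_sum] at hu
  have h3 : (((numEpochs T - 1 : ℕ) : ℝ) - j) *
      (12 * θ * ((numEpochs T : ℝ) - j) * C / γ ^ 2) ≤
      12 * θ * ((numEpochs T : ℝ) - j) ^ 2 * C / γ ^ 2 := by
    have h4 : (j : ℝ) < numEpochs T := by exact_mod_cast hjM
    have h5 : ((numEpochs T - 1 : ℕ) : ℝ) = (numEpochs T : ℝ) - 1 := by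
      rw [Nat.cast_sub (by omega)]; simp
    have h6 : 0 ≤ 12 * θ * ((numEpochs T : ℝ) - j) * C / γ ^ 2 :=
      div_nonneg (mul_nonneg (mul_nonneg (by linarith) (by linarith)) hC.le) (by positivity)
    calc _ ≤ ((numEpochs T : ℝ) - j) * (12 * θ * ((numEpochs T : ℝ) - j) * C / γ ^ 2) :=
          mul_le_mul_of_nonneg_right (by linarith) h6
      _ = _ := by ring
  have h7 : 24 * θ * ((numEpochs T : ℝ) - j) ^ 2 * C / γ ^ 2 =
      2 * (12 * θ * ((numEpochs T : ℝ) - j) ^ 2 * C / γ ^ 2) := by ring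
  linarith

end Labels

/-! ### Probability of the favourable events -/

section Events

lemma numEpochs_spec {T : ℝ} (hT : 2 < T) :
    2 ≤ numEpochs T ∧ (2 : ℝ) ^ (numEpochs T - 1) ≤ T ∧ T ≤ 2 ^ numEpochs T := by
  have hT0 : 0 < T := by linarith
  have h1 : 1 < Real.logb 2 T := by
    rw [Real.lt_logb_iff_rpow_lt (by norm_num) hT0]; simpa using hT
  have h2 : Real.logb 2 T ≤ numEpochs T := Nat.le_ceil _
  have h3 : (numEpochs T : ℝ) < Real.logb 2 T + 1 := Nat.ceil_lt_add_one (by linarith)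
  have hM : 2 ≤ numEpochs T := by
    have : (1 : ℝ) < numEpochs T := by linarith
    have : 1 < numEpochs T := by exact_mod_cast this
    omega
  refine ⟨hM, ?_, ?_⟩
  · have h4 : ((numEpochs T - 1 : ℕ) : ℝ) ≤ Real.logb 2 T := by
      rw [Nat.cast_sub (by omega)]; push_cast; linarith
    rw [Real.le_logb_iff_rpow_le (by norm_num) hT0, Real.rpow_natCast] at h4
    exact h4
  · rw [Real.logb_le_iff_le_rpow (by norm_num) hT0, Real.rpow_natCast] at h2
    exact h2

variable {X Ω : Type*} [MeasurableSpace X] [MeasurableSpace Ω] {P : Measure Ω}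
  [IsProbabilityMeasure P] {D : Measure (X × Bool)} [IsProbabilityMeasure D]
  {Z : ℕ → Ω → X × Bool} {F : Set (X → ℝ)} {ro : List (X × Bool) → X → ℝ} {γ T C : ℝ}
  {h : X → ℝ}

lemma measure_not_uniformlyConcentrated_le (hZ : ∀ t, Measurable (Z t)) (hi : iIndepFun Z P)
    (hD : ∀ t, P.map (Z t) = D) (hF : ∀ f ∈ F, Measurable f ∧ ∀ x, f x ∈ Set.Icc (0 : ℝ) 1)
    (hsep : PointwiseSeparable F) (hmb : MeasurableConfidenceBounds F ro) {d : ℕ} (hd1 : 1 ≤ d)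
    (hd : pdim F ≤ d) (hh : h ∈ F) (heq : h =ᵐ[D.fst] condProb D) {δ : ℝ} (hδ0 : 0 < δ)
    (hδ1 : δ < 1) (hT : 2 < T) (hC : C = confRadius 260 d T δ) :
    P {ω | ¬ UniformlyConcentrated D F ro γ T C h (fun t => Z t ω)} ≤ ENNReal.ofReal δ := by
  have hne : Nonempty X := by
    obtain ⟨p⟩ : Nonempty (X × Bool) := nonempty_of_isProbabilityMeasure D
    exact ⟨p.1⟩
  obtain ⟨hM, hNT, -⟩ := numEpochs_spec hT
  set N := epochEnd (numEpochs T - 1) with hN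
  have hN2 : N = 2 ^ (numEpochs T - 1) := epochEnd_of_pos (by omega)
  have hNT' : (N : ℝ) ≤ T := by rw [hN2]; push_cast; exact hNT
  have hNpos : 0 < N := by rw [hN2]; positivity
  set L := Real.log (T / δ) with hL
  have hT0 : 0 < T := by linarith
  have hTδ : T ≤ T / δ := by
    rw [le_div_iff₀ hδ0]; nlinarith
  have hTδ0 : 0 < T / δ := by positivity
  have hexp : Real.exp L = T / δ := Real.exp_log hTδ0
  have hL2 : Real.log 2 ≤ L := Real.log_le_log (by norm_num) (by linarith)
  have hl2 := Real.log_two_gt_d9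
  have hd1' : (1 : ℝ) ≤ d := by exact_mod_cast hd1
  have hL0 : 0 < L := by linarith
  have hdL : L ≤ d * L := le_mul_of_one_le_left hL0.le hd1'
  have hTexp : T ≤ Real.exp L := by rw [hexp]; exact hTδ
  have h2δ : 2 / δ ≤ Real.exp L := by
    rw [hexp]; gcongr
  have hCpos : 0 < C := by
    rw [hC]; unfold confRadius; positivity
  -- The double sample has at most `exp (8 d L)` pairs of patterns and confidence `δ / 2` costs
  -- another `exp L`, so `2 ^ k ≥ exp (9 d L)` suffices.
  set k := ⌈9 * (d * L) / Real.log 2⌉₊ with hk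
  -- The net costs `exp (3 d L)`, the two endpoints of a window `exp (4 L)`, and confidence `exp L`.
  set u := 8 * (d * L) with hu
  have hTge : (2 : ℝ) ≤ T := hT.le
  -- growth of the class on the double sample
  have hk1 : (((2 * N * N + 1) ^ (2 * d) : ℕ) : ENNReal) / 2 ^ k ≤ ENNReal.ofReal (δ / 2) := by
    have h1 : ((2 * N * N + 1 : ℕ) : ℝ) ≤ Real.exp (4 * L) := by
      have h2 : ((2 * N * N + 1 : ℕ) : ℝ) ≤ T ^ 4 := by
        push_cast
        have h3 : (N : ℝ) * N ≤ T * T := by gcongr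
        have h4 : 4 ≤ T * T := by nlinarith
        nlinarith
      refine h2.trans ?_
      rw [show 4 * L = ((4 : ℕ) : ℝ) * L by norm_num, Real.exp_nat_mul]
      gcongr
    have h2 : (((2 * N * N + 1) ^ (2 * d) : ℕ) : ℝ) * (2 / δ) ≤ 2 ^ k := by
      calc (((2 * N * N + 1) ^ (2 * d) : ℕ) : ℝ) * (2 / δ)
          ≤ Real.exp (4 * L) ^ (2 * d) * Real.exp L := by
            rw [Nat.cast_pow]
            gcongr
        _ = Real.exp (8 * (d * L) + L) := by
            rw [← Real.exp_nat_mul, ← Real.exp_add]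
            congr 1
            push_cast
            ring
        _ ≤ Real.exp (Real.log 2 * k) := by
            refine Real.exp_le_exp.2 ?_
            have h3 : 9 * (d * L) / Real.log 2 ≤ k := Nat.le_ceil _
            rw [div_le_iff₀ (by linarith)] at h3
            linarith
        _ = 2 ^ k := by
            rw [mul_comm, Real.exp_nat_mul, Real.exp_log (by norm_num)]
    rw [ENNReal.div_le_iff (by simp) (by simp)]
    have h3 : (((2 * N * N + 1) ^ (2 * d) : ℕ) : ℝ) ≤ δ / 2 * 2 ^ k := by
      rw [mul_div_assoc', div_le_iff₀ hδ0] at h2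
      linarith
    have h4 := ENNReal.ofReal_le_ofReal h3
    rwa [ENNReal.ofReal_natCast, ENNReal.ofReal_mul (by positivity),
      ENNReal.ofReal_pow (by norm_num), ENNReal.ofReal_ofNat] at h4
  have hu1 : (((N * N + 1) ^ d * (N + 1) ^ 2 : ℕ) : ENNReal) * ENNReal.ofReal (Real.exp (-u)) ≤
      ENNReal.ofReal (δ / 2) := by
    have h1 : ((N * N + 1 : ℕ) : ℝ) ≤ Real.exp (3 * L) := by
      have h2 : ((N * N + 1 : ℕ) : ℝ) ≤ T ^ 3 := by
        push_cast
        have h3 : (N : ℝ) * N ≤ T * T := by gcongr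
        have h4 : 4 ≤ T * T := by nlinarith
        nlinarith
      refine h2.trans ?_
      rw [show 3 * L = ((3 : ℕ) : ℝ) * L by norm_num, Real.exp_nat_mul]
      gcongr
    have h1' : ((N + 1 : ℕ) : ℝ) ≤ Real.exp (2 * L) := by
      have h2 : ((N + 1 : ℕ) : ℝ) ≤ T ^ 2 := by
        push_cast
        nlinarith
      refine h2.trans ?_
      rw [show 2 * L = ((2 : ℕ) : ℝ) * L by norm_num, Real.exp_nat_mul]
      gcongr
    have h2 : (((N * N + 1) ^ d * (N + 1) ^ 2 : ℕ) : ℝ) * (2 / δ) ≤ Real.exp u := by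
      calc (((N * N + 1) ^ d * (N + 1) ^ 2 : ℕ) : ℝ) * (2 / δ)
          ≤ Real.exp (3 * L) ^ d * Real.exp (2 * L) ^ 2 * Real.exp L := by
            rw [Nat.cast_mul, Nat.cast_pow, Nat.cast_pow]
            gcongr
        _ = Real.exp (3 * (d * L) + 5 * L) := by
            rw [← Real.exp_nat_mul, ← Real.exp_nat_mul, ← Real.exp_add, ← Real.exp_add]
            congr 1
            push_cast
            ring
        _ ≤ Real.exp u := Real.exp_le_exp.2 (by linarith)
    rw [← ENNReal.ofReal_natCast, ← ENNReal.ofReal_mul (by positivity)]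
    refine ENNReal.ofReal_le_ofReal ?_
    rw [Real.exp_neg, ← div_eq_mul_inv, div_le_iff₀ (Real.exp_pos u)]
    rw [mul_div_assoc', div_le_iff₀ hδ0] at h2
    linarith
  have hmain := measure_not_uniform_le hZ hi hD (measurable_queryInd (γ := γ) (T := T) hmb hCpos.le)
    predictable_queryInd queryInd_mem (hF h hh).1 (hF h hh).2 heq hF hsep hd hNpos k
    (by linarith : δ / 2 ≤ 1 / 2) hk1 u
  -- With `k ≤ 13 d L + 1` the slack is at most `116 d L + 9 ≤ 130 d L`, using `d L ≥ log 2`; hence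
  -- the constant 260.
  have hslack : 8 * u + 4 * k + 5 ≤ C / 2 := by
    have h1 : (k : ℝ) < 9 * (d * L) / Real.log 2 + 1 := Nat.ceil_lt_add_one (by positivity)
    have h2 : 9 * (d * L) / Real.log 2 ≤ 13 * (d * L) := by
      rw [div_le_iff₀ (by linarith)]
      nlinarith
    have h3 : C = 260 * (d * L) := by rw [hC]; unfold confRadius; ring
    linarith
  refine (measure_mono ?_).trans (hmain.trans ?_)
  · intro ω hω hgood
    exact hω fun f hf a b hb => (hgood f hf a b hb).trans (by linarith)
  · calc _ ≤ ENNReal.ofReal (δ / 2) + ENNReal.ofReal (δ / 2) := by gcongr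
      _ = ENNReal.ofReal δ := by
          rw [← ENNReal.ofReal_add (by positivity) (by positivity)]; congr 1; ring

lemma measure_many_labels_le (hZ : ∀ t, Measurable (Z t)) (hi : iIndepFun Z P)
    (hD : ∀ t, P.map (Z t) = D) (hmb : MeasurableConfidenceBounds F ro) (hC : 0 ≤ C)
    (I : Finset ℕ) {δ : ℝ} (hδ0 : 0 < δ) :
    P {ω | Real.log (1 / δ) ≤ ∑ t ∈ I, (queryInd F ro γ T C t (fun i => Z i ω) (Z t ω).1 -
      2 * ∫ p, queryInd F ro γ T C t (fun i => Z i ω) p.1 ∂D)} ≤ ENNReal.ofReal δ := by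
  have hne : Nonempty X := by
    obtain ⟨p⟩ : Nonempty (X × Bool) := nonempty_of_isProbabilityMeasure D
    exact ⟨p.1⟩
  have hm : ∀ t, Measurable (Function.uncurry fun (z : ℕ → X × Bool) (a : X × Bool) =>
      queryInd F ro γ T C t z a.1) := by
    intro t
    have h1 := measurable_queryInd (γ := γ) (T := T) hmb hC t
    have h2 : Measurable fun p : (ℕ → X × Bool) × (X × Bool) => (p.1, p.2.1) :=
      measurable_fst.prodMk (measurable_fst.comp measurable_snd)
    have e : (Function.uncurry fun (z : ℕ → X × Bool) (a : X × Bool) =>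
        queryInd F ro γ T C t z a.1) = Function.uncurry (queryInd F ro γ T C t) ∘
          fun p : (ℕ → X × Bool) × (X × Bool) => (p.1, p.2.1) := by
      funext p
      simp only [Function.uncurry, Function.comp_apply]
    rw [e]
    exact Measurable.comp h1 h2
  have h1 := measure_sum_indicator_le (P := P) (D := D)
    (q := fun t z a => queryInd F ro γ T C t z a.1) hZ hi hD hm
    (fun t z z' hzz => by simp only [predictable_queryInd t z z' hzz])
    (fun t z a => queryInd_mem t z a.1) I (Real.log (1 / δ))
  rwa [one_div, Real.log_inv, neg_neg, Real.exp_log hδ0, ← Real.log_inv, ← one_div] at h1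

end Events

end ActiveLearning

namespace ActiveLearning

/-! ### The guarantee in terms of `γ` -/

section Guarantee

variable {X Ω : Type*} [MeasurableSpace X] [MeasurableSpace Ω] {P : Measure Ω}
  [IsProbabilityMeasure P] {D : Measure (X × Bool)} [IsProbabilityMeasure D]
  {Z : ℕ → Ω → X × Bool} {F : Set (X → ℝ)} {ro : List (X × Bool) → X → ℝ}

set_option maxHeartbeats 1000000 in
/-- Guarantee on the randomized classifier and on the number of queried labels, for an arbitrary
abstention level `γ`. -/
lemma measure_not_guarantee_le (hZ : ∀ t, Measurable (Z t)) (hi : iIndepFun Z P)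
    (hD : ∀ t, P.map (Z t) = D) (hF : ∀ f ∈ F, Measurable f ∧ ∀ x, f x ∈ Set.Icc (0 : ℝ) 1)
    (hsep : PointwiseSeparable F) (ho : IsRegressionOracle F ro)
    (hmb : MeasurableConfidenceBounds F ro) {d : ℕ} (hd1 : 1 ≤ d) (hd : pdim F ≤ d)
    (hreal : ∃ f ∈ F, f =ᵐ[D.fst] condProb D) {ε δ : ℝ} (hε0 : 0 < ε) (hε1 : ε ≤ 1) (hδ0 : 0 < δ)
    (hδ1 : δ < 1) {γ θ : ℝ} (hγ0 : 0 < γ) (hγ1 : γ ≤ 1 / 4)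
    (hθ : supDisagreementCoeff F (γ / 2) ≤ ENNReal.ofReal θ) {T C : ℝ}
    (hT : T = horizon (2 ^ 20) θ d ε γ δ) (hC : C = confRadius 260 d T δ) :
    P {ω | ¬ (randExcessErr D (output F ro γ T C (fun t => Z t ω)) ≤
          smallMargin D γ + ε / 2 ∧
        (labelCount F ro γ T C (fun t => Z t ω) : ℝ) ≤
          3000000 * (θ * d / γ ^ 2 * Real.log (θ * d / (ε * γ)) ^ 2 *
            Real.log (θ * d / (ε * γ * δ))))} ≤ ENNReal.ofReal (2 * δ) := by
  obtain ⟨h, hh, heq⟩ := hreal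
  have hne : Nonempty X := by
    obtain ⟨p⟩ : Nonempty (X × Bool) := nonempty_of_isProbabilityMeasure D
    exact ⟨p.1⟩
  have hθ1 := one_le_of_supDisagreementCoeff_le ⟨h, hh⟩ hθ
  have hd1' : (1 : ℝ) ≤ d := by exact_mod_cast hd1
  have hθd : 1 ≤ θ * d := by nlinarith
  set A := θ * d / (ε * γ) with hA
  have hεγ : 0 < ε * γ := by positivity
  have hA4 : 4 ≤ A := by
    rw [hA, le_div_iff₀ hεγ]
    have : ε * γ ≤ 1 * (1 / 4) := by gcongr
    linarith
  have hAδ : θ * d / (ε * γ * δ) = A / δ := by rw [hA, div_div]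
  have hl2 := Real.log_two_gt_d9
  have hl2' := Real.log_two_lt_d9
  have hlog4 : 2 * Real.log 2 ≤ Real.log A := by
    have h1 : Real.log (2 ^ 2) = 2 * Real.log 2 := by rw [Real.log_pow]; norm_num
    rw [← h1]
    exact Real.log_le_log (by norm_num) (by linarith)
  have hA0 : 0 < A := by linarith
  set l := Real.log (A / δ) with hl
  have hAAδ : A ≤ A / δ := by rw [le_div_iff₀ hδ0]; nlinarith
  have hlA : Real.log A ≤ l := Real.log_le_log hA0 hAAδ
  have hl1 : 1 ≤ l := by linarith
  have hlδ : Real.log (1 / δ) ≤ l :=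
    Real.log_le_log (by positivity) (by gcongr; linarith)
  have hTA : T = 2 ^ 20 * A * l := by rw [hT, horizon, hAδ]
  have hTbig : 2 < T := by
    rw [hTA]
    have : 4 * 1 ≤ A * l := by gcongr
    linarith
  have hT0 : 0 < T := by linarith
  set L := Real.log (T / δ) with hL
  have hLl : L ≤ 16 * l := by
    have h1 : T / δ = 2 ^ 20 * ((A / δ) * l) := by rw [hTA]; ring
    have h2 : 0 < A / δ := by positivity
    rw [hL, h1, Real.log_mul (by norm_num) (by positivity), Real.log_mul h2.ne' (by positivity),
      Real.log_pow]
    have h3 : Real.log l ≤ l := (Real.log_le_sub_one_of_pos (by linarith)).trans (by linarith)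
    push_cast
    linarith
  have hTδ : T ≤ T / δ := by rw [le_div_iff₀ hδ0]; nlinarith
  have hL0 : 0 < L := Real.log_pos (by linarith)
  have hCL : C = 260 * d * L := hC
  have hC0 : 0 < C := by rw [hCL]; positivity
  have hCl : C ≤ 4160 * d * l := by
    rw [hCL]
    calc 260 * (d : ℝ) * L ≤ 260 * d * (16 * l) := by gcongr
      _ = _ := by ring
  obtain ⟨hM2, hNT, hTM⟩ := numEpochs_spec hTbig
  set M := numEpochs T with hM
  have hpow : (2 : ℝ) ^ M = 2 * 2 ^ (M - 1) := by
    rw [← pow_succ', Nat.sub_add_cancel (by omega)]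
  -- the epoch after which queries are counted through their conditional means
  set κ := ⌈Real.logb 2 A⌉₊ with hκ
  have hκA : A ≤ 2 ^ κ := by
    have h1 : Real.logb 2 A ≤ κ := Nat.le_ceil _
    rwa [Real.logb_le_iff_le_rpow (by norm_num) hA0, Real.rpow_natCast] at h1
  have hκl : (κ : ℝ) ≤ 3 * Real.log A := by
    have h0 : Real.logb 2 A = Real.log A / Real.log 2 := rfl
    have h1 : (κ : ℝ) < Real.logb 2 A + 1 :=
      Nat.ceil_lt_add_one (Real.logb_nonneg (by norm_num) (by linarith))
    have h2 : Real.logb 2 A ≤ 3 / 2 * Real.log A := by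
      rw [h0, div_le_iff₀ (by linarith)]
      nlinarith
    linarith
  have hκ1 : 1 ≤ κ := by
    by_contra! h0
    have : κ = 0 := by omega
    rw [this] at hκA
    norm_num at hκA
    linarith
  -- This cut gives `2 ^ j` of order `T / A`, hence of order `l`, and leaves at most `κ`, of order
  -- `log A`, epochs. The maximum with 1 is needed because `epochEnd 0 = 0` makes the region bound
  -- void.
  set j := max 1 (M - κ) with hj
  have hj0 : 0 < j := by omega
  have hjM : j < M := by omega
  have hMj : (M : ℝ) - j ≤ κ := by
    have : M ≤ κ + j := by omega
    have : (M : ℝ) ≤ κ + j := by exact_mod_cast this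
    linarith
  have h2j : (2 : ℝ) ^ j ≤ 2 + 2 ^ 21 * l := by
    rcases le_total (M - κ) 1 with h1 | h1
    · rw [hj, max_eq_left h1]
      have : 0 ≤ 2 ^ 21 * l := by positivity
      linarith
    · rw [hj, max_eq_right h1]
      have h2 : (2 : ℝ) ^ (M - κ) * 2 ^ κ = 2 ^ M := by
        rw [← pow_add, Nat.sub_add_cancel (by omega)]
      have h3 : (2 : ℝ) ^ (M - κ) * A ≤ 2 ^ 21 * l * A := by
        calc (2 : ℝ) ^ (M - κ) * A ≤ 2 ^ (M - κ) * 2 ^ κ := by gcongr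
          _ ≤ 2 * T := by rw [h2, hpow]; linarith
          _ = _ := by rw [hTA]; ring
      have h4 := le_of_mul_le_mul_right h3 hA0
      linarith
  have hgood := measure_not_uniformlyConcentrated_le (γ := γ) hZ hi hD hF hsep hmb hd1 hd hh heq
    hδ0 hδ1 hTbig hC
  have hlab := measure_many_labels_le (γ := γ) (T := T) hZ hi hD hmb hC0.le
    (Finset.Ioc (epochEnd j) (epochEnd (M - 1))) hδ0
  have hsum : ENNReal.ofReal (2 * δ) = ENNReal.ofReal δ + ENNReal.ofReal δ := by
    rw [← ENNReal.ofReal_add hδ0.le hδ0.le]; congr 1; ring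
  rw [hsum]
  refine (measure_mono ?_).trans ((measure_union_le _ _).trans (add_le_add hgood hlab))
  intro ω hω
  by_contra hcon
  rw [Set.mem_union, not_or] at hcon
  obtain ⟨hz', hu'⟩ := hcon
  have hz : UniformlyConcentrated D F ro γ T C h (fun t => Z t ω) := not_not.1 hz'
  rw [Set.mem_ofPred_eq, not_le] at hu'
  have hu := hu'.le
  refine hω ⟨?_, ?_⟩
  · refine (hz.randExcessErr_output_le hF ho hmb hh heq hC0 hγ0 hθ hM2).trans ?_
    refine add_le_add le_rfl ?_
    rw [← hM, epochEnd_of_pos (by omega)]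
    push_cast
    rw [div_le_iff₀ (by positivity)]
    -- The last epoch uses data from at least `T / 2` time steps. The factor `2 ^ 20` in the horizon
    -- leaves room for `15 * 4160 = 62400 ≤ 2 ^ 20 / 4`.
    have h1 : T / 2 ≤ 2 ^ (M - 1) := by linarith
    have h2 : ε * γ * T = 2 ^ 20 * (θ * d) * l := by
      rw [hTA, hA]; field_simp
    have h3 : 15 * θ * C ≤ 15 * θ * (4160 * d * l) := by gcongr
    have h4 : 0 ≤ θ * d * l := by positivity
    calc 15 * θ * C ≤ 62400 * (θ * d * l) := by linarith
      _ ≤ 2 ^ 20 / 4 * (θ * d * l) := by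
          refine mul_le_mul_of_nonneg_right (by norm_num) h4
      _ = ε / 2 * (γ * (T / 2)) := by linarith
      _ ≤ ε / 2 * (γ * 2 ^ (M - 1)) := by gcongr
  · refine (labelCount_le hz hF ho hmb hh hC0 hγ0 hθ hj0 hjM hu).trans ?_
    rw [hAδ, ← hl, ← hM]
    have hMj0 : 0 ≤ (M : ℝ) - j := by
      have : (j : ℝ) ≤ M := by exact_mod_cast hjM.le
      linarith
    have h1 : ((M : ℝ) - j) ^ 2 ≤ 9 * Real.log A ^ 2 := by
      calc ((M : ℝ) - j) ^ 2 ≤ (3 * Real.log A) ^ 2 := by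
            have := hMj.trans hκl
            gcongr
        _ = _ := by ring
    set W := θ * d / γ ^ 2 * Real.log A ^ 2 * l with hW
    have hlW : l ≤ W := by
      have h2 : 1 ≤ θ * d / γ ^ 2 := by
        rw [le_div_iff₀ (by positivity)]
        have : γ ^ 2 ≤ 1 := by nlinarith
        linarith
      have h3 : 1 ≤ Real.log A ^ 2 := by
        have : 1 ≤ Real.log A := by linarith
        nlinarith
      have h4 : 1 * 1 ≤ θ * d / γ ^ 2 * Real.log A ^ 2 := by gcongr
      rw [hW]
      nlinarith
    have h2 : 24 * θ * ((M : ℝ) - j) ^ 2 * C / γ ^ 2 ≤ 898560 * W := by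
      calc 24 * θ * ((M : ℝ) - j) ^ 2 * C / γ ^ 2
          ≤ 24 * θ * (9 * Real.log A ^ 2) * (4160 * d * l) / γ ^ 2 := by gcongr
        _ = 898560 * W := by rw [hW]; ring
    -- The early steps cost `2 + 2 ^ 21 l`, the deviation `l`, and the late epochs `898560 W`; with
    -- `1 ≤ l ≤ W` the total is below `3000000 W`.
    linarith

end Guarantee

/-! ### Change of parameters in the label bound -/

/-- Comparison of logarithmic factors: if `A ≤ B ^ r` then `log A ≤ r log B`. -/
lemma labelBound_le {a b A B δ : ℝ} {r : ℕ} (hab : a ≤ b) (ha : 0 ≤ a) (hA : 1 ≤ A)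
    (hAB : A ≤ B ^ r) (hB : 1 ≤ B) (hr : 1 ≤ r) (hδ0 : 0 < δ) (hδ1 : δ < 1) :
    a * Real.log A ^ 2 * Real.log (A / δ) ≤
      r ^ 3 * (b * Real.log B ^ 2 * Real.log (B / δ)) := by
  have hB0 : 0 < B := by linarith
  have hA0 : 0 < A := by linarith
  have hr' : (1 : ℝ) ≤ r := by exact_mod_cast hr
  have h1 : Real.log A ≤ r * Real.log B := by
    rw [← Real.log_pow]; exact Real.log_le_log hA0 hAB
  have hδl : 0 ≤ Real.log (1 / δ) := Real.log_nonneg (by rw [le_div_iff₀ hδ0]; linarith)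
  have h2 : Real.log (A / δ) ≤ r * Real.log (B / δ) := by
    have e : ∀ y : ℝ, 0 < y → Real.log (y / δ) = Real.log y + Real.log (1 / δ) := fun y hy => by
      rw [← Real.log_mul hy.ne' (by positivity), mul_one_div]
    rw [e A hA0, e B hB0]
    nlinarith
  have h3 : 0 ≤ Real.log A := Real.log_nonneg hA
  have h4 : 0 ≤ Real.log (A / δ) :=
    Real.log_nonneg (by rw [le_div_iff₀ hδ0]; linarith)
  have h5 : 0 ≤ b := ha.trans hab
  calc a * Real.log A ^ 2 * Real.log (A / δ)
      ≤ b * (r * Real.log B) ^ 2 * (r * Real.log (B / δ)) := by gcongr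
    _ = _ := by ring

end ActiveLearning

/-! ### Label bounds in terms of the noise parameters. -/

namespace ActiveLearning

/-- Label bound under Massart noise. -/
lemma massart_labelBound_le {N ε δ τ γ : ℝ} (hN : 1 ≤ N) (hε0 : 0 < ε) (hε1 : ε ≤ 1)
    (hδ0 : 0 < δ) (hδ1 : δ < 1) (hτ0 : 0 < τ) (hτ : τ ≤ 1 / 2) (hγ : γ = min τ (1 / 4)) :
    3000000 * (N / γ ^ 2 * Real.log (N / (ε * γ)) ^ 2 * Real.log (N / (ε * γ * δ))) ≤
      20000000000 * N * τ ^ (-2 : ℝ) * Real.log (N / (ε * τ)) ^ 2 *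
        Real.log (N / (ε * τ * δ)) := by
  -- Since `τ ≤ 1 / 2`, the cap at `1 / 4` loses at most a factor 2, so `τ` may replace `γ` up to
  -- constants.
  have hγτ : τ / 2 ≤ γ := by rw [hγ]; exact le_min (by linarith) (by linarith)
  have hγ4 : γ ≤ 1 / 4 := by rw [hγ]; exact min_le_right _ _
  have hγ0 : 0 < γ := by linarith
  have hN0 : 0 < N := by linarith
  have hB2 : 2 ≤ N / (ε * τ) := by
    rw [le_div_iff₀ (by positivity)]
    have : ε * τ ≤ 1 * (1 / 2) := by gcongr
    linarith
  have hA1 : 1 ≤ N / (ε * γ) := by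
    rw [le_div_iff₀ (by positivity)]
    have : ε * γ ≤ 1 * (1 / 4) := by gcongr
    linarith
  have hAB : N / (ε * γ) ≤ (N / (ε * τ)) ^ 2 := by
    calc N / (ε * γ) ≤ N / (ε * (τ / 2)) := by gcongr
      _ = 2 * (N / (ε * τ)) := by field_simp
      _ ≤ (N / (ε * τ)) ^ 2 := by nlinarith
  have hab : N / γ ^ 2 ≤ 4 * N * τ ^ (-2 : ℝ) := by
    have e : τ ^ (-2 : ℝ) = (τ ^ 2)⁻¹ := by
      rw [Real.rpow_neg hτ0.le, ← Real.rpow_natCast]; norm_num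
    calc N / γ ^ 2 ≤ N / (τ / 2) ^ 2 := by gcongr
      _ = 4 * N * τ ^ (-2 : ℝ) := by rw [e]; field_simp; norm_num
  have key := labelBound_le hab (by positivity) hA1 hAB (by linarith) one_le_two hδ0 hδ1
  rw [div_div, div_div] at key
  have hnn : 0 ≤ N * τ ^ (-2 : ℝ) * Real.log (N / (ε * τ)) ^ 2 * Real.log (N / (ε * τ * δ)) := by
    have : 0 ≤ Real.log (N / (ε * τ * δ)) := by
      refine Real.log_nonneg ?_
      rw [← div_div, le_div_iff₀ hδ0]
      linarith
    positivity
  push_cast at key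
  linarith

/-- Label bound under Tsybakov noise. -/
lemma tsybakov_labelBound_le {N ε δ β c γ : ℝ} (hN : 1 ≤ N) (hε0 : 0 < ε) (hε1 : ε ≤ 1)
    (hδ0 : 0 < δ) (hδ1 : δ < 1) (hβ : 0 ≤ β) (hc : 0 < c)
    (hγ : γ = min ((ε / (2 * c)) ^ (1 / (1 + β))) (1 / 4)) :
    3000000 * (N / γ ^ 2 * Real.log (N / (ε * γ)) ^ 2 * Real.log (N / (ε * γ * δ))) ≤
      20000000000 * N * max 1 c ^ (2 / (1 + β)) * ε ^ (-2 / (1 + β)) *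
        Real.log (2 * N * max 1 c / ε) ^ 2 * Real.log (2 * N * max 1 c / (ε * δ)) := by
  set m := max 1 c with hm
  have hm1 : 1 ≤ m := le_max_left _ _
  have hcm : c ≤ m := le_max_right _ _
  set p := 1 / (1 + β) with hp
  have hp0 : 0 < p := by positivity
  have hp1 : p ≤ 1 := by rw [hp, div_le_one (by linarith)]; linarith
  have h2p : 2 / (1 + β) = 2 * p := by rw [hp]; ring
  have hn2p : -2 / (1 + β) = -(2 * p) := by rw [hp]; ring
  clear_value p
  have hN0 : 0 < N := by linarith
  have hm0 : 0 < m := by linarith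
  -- Using `m = max 1 c` in place of `c` gives `u ≤ 1`. Hence `u ^ p ≤ 1`, so the cap at `1 / 4`
  -- costs only a factor 4, and `u ≤ u ^ p`, which bounds the argument of the logarithm
  -- polynomially.
  set u := ε / (2 * m) with hu
  have hu0 : 0 < u := by positivity
  have hu1 : u ≤ 1 := by rw [hu, div_le_one (by positivity)]; linarith
  have hup0 : 0 < u ^ p := Real.rpow_pos_of_pos hu0 p
  have hup1 : u ^ p ≤ 1 := Real.rpow_le_one hu0.le hu1 hp0.le
  have hup : u ≤ u ^ p := by
    simpa using Real.rpow_le_rpow_of_exponent_ge hu0 hu1 hp1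
  have hγu : u ^ p / 4 ≤ γ := by
    rw [hγ]
    refine le_min ?_ (by linarith)
    have : u ^ p ≤ (ε / (2 * c)) ^ p := by
      refine Real.rpow_le_rpow hu0.le ?_ hp0.le
      rw [hu]
      gcongr
    linarith
  have hγ4 : γ ≤ 1 / 4 := by rw [hγ]; exact min_le_right _ _
  have hγ0 : 0 < γ := by linarith
  have hB2 : 2 ≤ 2 * N * m / ε := by
    rw [le_div_iff₀ hε0]
    nlinarith
  have hA1 : 1 ≤ N / (ε * γ) := by
    rw [le_div_iff₀ (by positivity)]
    have : ε * γ ≤ 1 * (1 / 4) := by gcongr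
    linarith
  have hAB : N / (ε * γ) ≤ (2 * N * m / ε) ^ 3 := by
    have h1 : N / (ε * γ) ≤ 2 * (2 * N * m / ε) ^ 2 := by
      calc N / (ε * γ) ≤ N / (ε * (u / 4)) := by
            gcongr
            linarith
        _ = 8 * m * (1 * N) / ε ^ 2 := by rw [hu]; field_simp; norm_num
        _ ≤ 8 * m * (m * N * N) / ε ^ 2 := by
            gcongr
            nlinarith
        _ = 2 * (2 * N * m / ε) ^ 2 := by ring
    refine h1.trans ?_
    rw [pow_succ' _ 2]
    gcongr
  have hab : N / γ ^ 2 ≤ 64 * (N * m ^ (2 * p) * ε ^ (-(2 * p))) := by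
    have e1 : (u ^ p) ^ 2 = u ^ (2 * p) := by
      rw [← Real.rpow_mul_natCast hu0.le]; congr 1; push_cast; ring
    have e2 : u ^ (2 * p) * ((2 : ℝ) ^ (2 * p) * m ^ (2 * p)) = ε ^ (2 * p) := by
      rw [← Real.mul_rpow (by norm_num) hm0.le, ← Real.mul_rpow hu0.le (by positivity), hu,
        div_mul_cancel₀ _ (by positivity)]
    have e3 : (2 : ℝ) ^ (2 * p) ≤ 4 := by
      calc (2 : ℝ) ^ (2 * p) ≤ 2 ^ (2 : ℝ) :=
            Real.rpow_le_rpow_of_exponent_le (by norm_num) (by linarith)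
        _ = 4 := by norm_num
    have hε2 : 0 < ε ^ (2 * p) := Real.rpow_pos_of_pos hε0 _
    have hm2 : 0 < m ^ (2 * p) := Real.rpow_pos_of_pos hm0 _
    have hu2 : 0 < u ^ (2 * p) := Real.rpow_pos_of_pos hu0 _
    calc N / γ ^ 2 ≤ N / (u ^ p / 4) ^ 2 := by gcongr
      _ = 16 * N / u ^ (2 * p) := by rw [div_pow, e1]; field_simp; norm_num
      _ ≤ 64 * (N * m ^ (2 * p) * ε ^ (-(2 * p))) := by
          rw [Real.rpow_neg hε0.le, ← div_eq_mul_inv, ← mul_div_assoc,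
            div_le_div_iff₀ hu2 hε2, ← e2]
          calc 16 * N * (u ^ (2 * p) * (2 ^ (2 * p) * m ^ (2 * p)))
              ≤ 16 * N * (u ^ (2 * p) * (4 * m ^ (2 * p))) := by gcongr
            _ = _ := by ring
  have key := labelBound_le hab (by positivity) hA1 hAB (by linarith)
    (by norm_num : 1 ≤ 3) hδ0 hδ1
  rw [div_div, div_div] at key
  rw [h2p, hn2p]
  have hnn : 0 ≤ N * m ^ (2 * p) * ε ^ (-(2 * p)) * Real.log (2 * N * m / ε) ^ 2 *
      Real.log (2 * N * m / (ε * δ)) := by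
    have : 0 ≤ Real.log (2 * N * m / (ε * δ)) := by
      refine Real.log_nonneg ?_
      rw [← div_div, le_div_iff₀ hδ0]
      linarith
    positivity
  push_cast at key
  linarith

end ActiveLearning

/-! ### The two noise conditions. -/

theorem mainTheorem7 :
    ∃ K₁ K₂ K₃ : ℝ, 0 < K₁ ∧ 0 < K₂ ∧ 0 < K₃ ∧
      ∀ (X : Type*) [MeasurableSpace X] (Ω : Type*) [MeasurableSpace Ω]
        (P : Measure Ω) [IsProbabilityMeasure P]
        (D : Measure (X × Bool)) [IsProbabilityMeasure D]
        (Z : ℕ → Ω → X × Bool) (F : Set (X → ℝ)) (oracle : List (X × Bool) → X → ℝ) (d : ℕ),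
        -- independent examples with law `D`
        (∀ t, Measurable (Z t)) → iIndepFun Z P → (∀ t, P.map (Z t) = D) →
        -- the class of regression functions, of finite pseudo dimension, and its oracle
        (∀ f ∈ F, Measurable f ∧ ∀ x, f x ∈ Set.Icc (0 : ℝ) 1) →
        ActiveLearning.PointwiseSeparable F →
        ActiveLearning.IsRegressionOracle F oracle →
        ActiveLearning.MeasurableConfidenceBounds F oracle →
        1 ≤ d → ActiveLearning.pdim F ≤ d →
        -- realizability
        (∃ f ∈ F, f =ᵐ[D.fst] ActiveLearning.condProb D) →
        ∀ ε δ : ℝ, 0 < ε → ε ≤ 1 → 0 < δ → δ < 1 →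
        -- the Massart case
        (∀ ζ₀ τ₀ γ θ : ℝ, ActiveLearning.NoiseSeekingMassart D ζ₀ τ₀ →
          γ = min τ₀ (1 / 4) →
          ActiveLearning.supDisagreementCoeff F (γ / 2) ≤ ENNReal.ofReal θ →
          ∀ T C : ℝ, T = ActiveLearning.horizon K₁ θ d ε γ δ →
            C = ActiveLearning.confRadius K₂ d T δ →
            P {ω | ¬ (ActiveLearning.randExcessErr D
                  (ActiveLearning.output F oracle γ T C (fun t => Z t ω)) ≤ ε + ζ₀ ∧
                (ActiveLearning.labelCount F oracle γ T C (fun t => Z t ω) : ℝ) ≤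
                  K₃ * (θ * d) * τ₀ ^ (-2 : ℝ) * Real.log (θ * d / (ε * τ₀)) ^ 2 *
                    Real.log (θ * d / (ε * τ₀ * δ)))} ≤ ENNReal.ofReal (2 * δ)) ∧
        -- the Tsybakov case
        (∀ ζ₀ β c γ θ : ℝ, ActiveLearning.NoiseSeekingTsybakov D ζ₀ β c →
          γ = min ((ε / (2 * c)) ^ (1 / (1 + β))) (1 / 4) →
          ActiveLearning.supDisagreementCoeff F (γ / 2) ≤ ENNReal.ofReal θ →
          ∀ T C : ℝ, T = ActiveLearning.horizon K₁ θ d ε γ δ →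
            C = ActiveLearning.confRadius K₂ d T δ →
            P {ω | ¬ (ActiveLearning.randExcessErr D
                  (ActiveLearning.output F oracle γ T C (fun t => Z t ω)) ≤ ε + ζ₀ ∧
                (ActiveLearning.labelCount F oracle γ T C (fun t => Z t ω) : ℝ) ≤
                  K₃ * (θ * d) * max 1 c ^ (2 / (1 + β)) * ε ^ (-2 / (1 + β)) *
                    Real.log (2 * (θ * d) * max 1 c / ε) ^ 2 *
                    Real.log (2 * (θ * d) * max 1 c / (ε * δ)))} ≤ ENNReal.ofReal (2 * δ)) := by
  refine ⟨2 ^ 20, 260, 20000000000, by norm_num, by norm_num, by norm_num, ?_⟩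
  intro X _ Ω _ P _ D _ Z F oracle d hZ hi hD hF hsep ho hmb hd1 hd hreal ε δ hε0 hε1 hδ0 hδ1
  have hNθ : ∀ {γ₀ θ : ℝ}, ActiveLearning.supDisagreementCoeff F γ₀ ≤ ENNReal.ofReal θ →
      1 ≤ θ * d := by
    intro γ₀ θ hθ
    obtain ⟨h, hh, -⟩ := hreal
    have hθ1 := ActiveLearning.one_le_of_supDisagreementCoeff_le ⟨h, hh⟩ hθ
    have hd1' : (1 : ℝ) ≤ d := by exact_mod_cast hd1
    nlinarith
  constructor
  · intro ζ₀ τ₀ γ θ hn hγ hθ T C hT hC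
    have hτ0 : 0 < τ₀ := hn.1.trans_lt hn.2.1
    have hγ0 : 0 < γ := by rw [hγ]; exact lt_min hτ0 (by norm_num)
    have hγ4 : γ ≤ 1 / 4 := by rw [hγ]; exact min_le_right _ _
    have hγτ : γ ≤ τ₀ := by rw [hγ]; exact min_le_left _ _
    refine le_trans (measure_mono ?_) (ActiveLearning.measure_not_guarantee_le hZ hi hD hF hsep ho
      hmb hd1 hd hreal hε0 hε1 hδ0 hδ1 hγ0 hγ4 hθ hT hC)
    refine Set.compl_subset_compl.2 fun ω hgood => ⟨?_, ?_⟩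
    · have := hn.smallMargin_le hγ0.le hγτ
      linarith [hgood.1]
    · exact hgood.2.trans
        (ActiveLearning.massart_labelBound_le (hNθ hθ) hε0 hε1 hδ0 hδ1 hτ0 hn.2.2.1 hγ)
  · intro ζ₀ β c γ θ hn hγ hθ T C hT hC
    obtain ⟨-, -, hβ, hc, -⟩ := id hn
    have hγ0 : 0 < γ := by rw [hγ]; exact lt_min (by positivity) (by norm_num)
    have hγ4 : γ ≤ 1 / 4 := by rw [hγ]; exact min_le_right _ _
    -- The level `γ` balances the errors: small margins above `ζ₀` take half of `ε`, and estimation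
    -- takes the other half.
    have hγp : c * γ ^ (1 + β) ≤ ε / 2 := by
      have h1 : γ ^ (1 + β) ≤ ε / (2 * c) := by
        calc γ ^ (1 + β) ≤ ((ε / (2 * c)) ^ (1 / (1 + β))) ^ (1 + β) :=
              Real.rpow_le_rpow hγ0.le (by rw [hγ]; exact min_le_left _ _) (by linarith)
          _ = ε / (2 * c) := by
              rw [← Real.rpow_mul (by positivity), one_div_mul_cancel (by linarith),
                Real.rpow_one]
      calc c * γ ^ (1 + β) ≤ c * (ε / (2 * c)) := by gcongr
        _ = ε / 2 := by field_simp
    refine le_trans (measure_mono ?_) (ActiveLearning.measure_not_guarantee_le hZ hi hD hF hsep ho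
      hmb hd1 hd hreal hε0 hε1 hδ0 hδ1 hγ0 hγ4 hθ hT hC)
    refine Set.compl_subset_compl.2 fun ω hgood => ⟨?_, ?_⟩
    · have := hn.smallMargin_le hγ0
      linarith [hgood.1]
    · exact hgood.2.trans
        (ActiveLearning.tsybakov_labelBound_le (hNθ hθ) hε0 hε1 hδ0 hδ1 hβ hc hγ)
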